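/- Fix $n$, and let $X$ be the complex vector space with basis $t^je_i$ ($1\le i\le n$, $j\in\mathbb Z$), with the operator $t\colon t^je_i\mapsto t^{j+1}e_i$; let $X_0$ be the span of the $t^je_i$ with $j\ge 0$, and $V_i$ the span of the $t^je_i$, $j\in\mathbb Z$. A lattice is a subspace $Y\subseteq X$ with $tY\subseteq Y$ and $t^NX_0\subseteq Y\subseteq t^{-N}X_0$ for some $N$. For a subspace $Z$ let $Z_0$ be the span of all $t^je_i\in Z$, and $\dim_0 Z=\dim(Z/Z_0)$; for a lattice $Y$ let $\delta_i(Y)$ be the largest $j$ with $t^{-j}e_i\in Y$. A Kostant picture $\mathbf p$ is a finite multiset of loops; a loop $L$ is given by its left end $\ell$ and right end $r$, $1\le \ell<r\le n$, and $V_{[a,b]}=V_a\oplus\dots\oplus V_b$ (zero if $a>b$). Loop $L$ encircles a loop $L'\ne L$ with ends $\ell',r'$ if $[\ell',r']\subsetneq[\ell,r]$; loops with the same ends are nested in one another, i.e. linearly ordered by encirclement. For $\lambda\in\mathbb Z^n$ let $M(\mathbf p,\lambda)$ be the set of lattices $Y$ such that, for all $1\le \ell<r\le n$, the number of loops of $\mathbf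 p$ with ends $\ell,r$ equals $$\dim_0(Y\cap V_{[\ell,r]})-\dim_0(Y\cap V_{[\ell+1,r]})-\dim_0(Y\cap V_{[\ell,r-1]})+\dim_0(Y\cap V_{[\ell+1,r-1]}),$$ and, for all $i$, $\lambda_i=\delta_i(Y)+l_i$, where $l_i$ is the number of loops of $\mathbf p$ with left end $i$. For a loop $L$ of $\mathbf p$ with ends $\ell,r$ let $\mathbb P^L$ be the projective space of lines in $\langle e_\ell,\dots,e_r\rangle\subseteq\mathbb C^n$. If $L$ encircles no loop of $\mathbf p$ with right end $r$ put $m=r$; otherwise let $m$ be the left end of the largest loop with right end $r$ encircled by $L$. Let $\tilde{\mathbb P}^L\subseteq\mathbb P^L$ be the set of lines that project nontrivially onto both $\langle e_\ell\rangle$ and $\langle e_m\rangle$, and put $\tilde{\mathbb P}^{\mathbf p}=\prod_{L\in\mathbf p}\tilde{\mathbb P}^L\subseteq \mathbb P^{\mathbf p}=\prod_{L\in\mathbf p}\mathbb P^L$. **Proposition.** $\tilde{\mathbb P}^{\mathbf p}$ is Zariski open in $\mathbb P^{\mathbf p}$, and $M(\mathbf p,\lambda)$ is isomorphic to $\tilde{\mathbb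 P}^{\mathbf p}$ as an algebraic variety. In detail: for some $N$ and $k$, every $Y\in M(\mathbf p,\lambda)$ satisfies $t^NX_0\subseteq Y\subseteq t^{-N}X_0$ and $\dim(Y/t^NX_0)=k$; and there is a bijection $M(\mathbf p,\lambda)\to\tilde{\mathbb P}^{\mathbf p}$ such that, for all $N$ and $k$ with this property, $M(\mathbf p,\lambda)$, embedded by the Plücker coordinates of the Grassmannian of $k$-dimensional subspaces of $t^{-N}X_0/t^NX_0$, is a Zariski locally closed subset of projective space, and the bijection and its inverse are regular maps (locally given by multihomogeneous polynomials of one multidegree without common zeros). -/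

import Mathlib

noncomputable section

namespace LoopGr

/-! ### Multiprojective spaces, the Zariski topology, regular maps -/

/-- The product `∏ i, ℙ(ℂ^(τ i))` of complex projective spaces. -/
abbrev MultiProj {ι : Type} (τ : ι → Type) : Type :=
  ∀ i : ι, Projectivization ℂ (τ i → ℂ)

section Zariski

variable {ι : Type} {τ : ι → Type}

/-- `F` is multihomogeneous of multidegree `d`: it has degree `d i` in the variables of the `i`-th
group `⟨i, s⟩`, `s : τ i`. -/
def IsMultiHom (F : MvPolynomial (Σ i, τ i) ℂ) (d : ι →₀ ℕ) : Prop :=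
  MvPolynomial.IsWeightedHomogeneous (fun v : Σ i, τ i => Finsupp.single v.1 (1 : ℕ)) F d

/-- The value of a polynomial at the chosen homogeneous coordinates of a point. For a
multihomogeneous polynomial, whether it vanishes does not depend on that choice. -/
def evalAt (x : MultiProj τ) (F : MvPolynomial (Σ i, τ i) ℂ) : ℂ :=
  MvPolynomial.eval (fun v : Σ i, τ i => (x v.1).rep v.2) F

/-- Zariski closed subsets: zero loci of sets of multihomogeneous polynomials. -/
def IsZariskiClosed (Z : Set (MultiProj τ)) : Prop :=
  ∃ A : Set (MvPolynomial (Σ i, τ i) ℂ), (∀ F ∈ A, ∃ d, IsMultiHom F d) ∧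
    Z = {x | ∀ F ∈ A, evalAt x F = 0}

/-- Zariski open subsets. -/
def IsZariskiOpen (U : Set (MultiProj τ)) : Prop :=
  IsZariskiClosed Uᶜ

/-- Zariski locally closed subsets, i.e. quasi-projective algebraic sets. -/
def IsZariskiLocallyClosed (S : Set (MultiProj τ)) : Prop :=
  ∃ Z U : Set (MultiProj τ), IsZariskiClosed Z ∧ IsZariskiOpen U ∧ S = Z ∩ U

/-- Let `S` and `S'` be embedded in multiprojective spaces by `e` and `e'`. A map `f : S → S'` is
regular if, near every point of `S`, every component of `f` is given by multihomogeneous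
polynomials of one and the same multidegree without a common zero there. -/
def IsRegularMap {κ : Type} {σ : κ → Type} {S S' : Type}
    (e : S → MultiProj τ) (e' : S' → MultiProj σ) (f : S → S') : Prop :=
  ∀ (x : S) (j : κ), ∃ (U : Set (MultiProj τ)) (d : ι →₀ ℕ)
    (F : σ j → MvPolynomial (Σ i, τ i) ℂ),
    IsZariskiOpen U ∧ e x ∈ U ∧ (∀ s, IsMultiHom (F s) d) ∧
    ∀ x' : S, e x' ∈ U → ∃ h : (fun s => evalAt (e x') (F s)) ≠ 0,
      e' (f x') j = Projectivization.mk ℂ (fun s => evalAt (e x') (F s)) h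

end Zariski

/-! ### The Plücker embedding of a Grassmannian -/

theorem minors_ne_zero {k : ℕ} {σ : Type} [Fintype σ] (v : Fin k → σ → ℂ)
    (hv : LinearIndependent ℂ v) :
    (fun I : Fin k → σ => Matrix.det (Matrix.of fun a b => v a (I b))) ≠ 0 := by
  intro h0
  have hrk : (Matrix.of v).rank = k := by
    have := LinearIndependent.rank_matrix (M := Matrix.of v) hv
    simpa using this
  have hspan : Submodule.span ℂ (Set.range (Matrix.of v).col) = ⊤ := by
    apply Submodule.eq_top_of_finrank_eq
    rw [← Matrix.rank_eq_finrank_span_cols, hrk]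
    simp
  obtain ⟨κ, a, _, hsp, hli⟩ := exists_linearIndependent' ℂ (Matrix.of v).col
  rw [hspan] at hsp
  let B := Module.Basis.mk hli hsp.ge
  have : Fintype κ := FiniteDimensional.fintypeBasisIndex B
  have hcard : Fintype.card κ = k := by
    have := Module.finrank_eq_card_basis B
    simpa using this.symm
  let e : Fin k ≃ κ := (Fintype.equivFinOfCardEq hcard).symm
  have hli2 : LinearIndependent ℂ (fun b : Fin k => (Matrix.of v).col (a (e b))) :=
    hli.comp e e.injective
  have hdet := congrFun h0 (fun b => a (e b))
  have hu : IsUnit (Matrix.of fun x b : Fin k => v x (a (e b))) := by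
    rw [← Matrix.linearIndependent_cols_iff_isUnit]
    exact hli2
  rw [Matrix.isUnit_iff_isUnit_det] at hu
  exact hu.ne_zero hdet

/-- The Plücker point of a `k`-dimensional subspace `W` of `ℂ^σ`: its homogeneous coordinates
`p_{I 1, …, I k}` are the maximal minors of a matrix whose rows form a basis of `W`. (All
sequences `I` of columns are used; the coordinates are alternating in `I`.) -/
def pluckerPoint {σ : Type} [Fintype σ] {k : ℕ} (W : Submodule ℂ (σ → ℂ))
    (hW : Module.finrank ℂ W = k) : MultiProj (fun _ : Unit => Fin k → σ) := fun _ =>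
  Projectivization.mk ℂ
    (fun I : Fin k → σ =>
      Matrix.det (Matrix.of fun a b => (Module.finBasisOfFinrankEq ℂ W hW a : σ → ℂ) (I b)))
    (minors_ne_zero _ ((Module.finBasisOfFinrankEq ℂ W hW).linearIndependent.map'
      W.subtype W.ker_subtype))

/-! ### The lattice model of the loop Grassmannian of `GL_n` -/

/-- The space `X` with basis `t^j e_i`, indexed by the pairs `(i, j)`. -/
abbrev X (n : ℕ) : Type := Fin n × ℤ →₀ ℂ

/-- The basis vector `t^j e_i`. -/
def vec {n : ℕ} (i : Fin n) (j : ℤ) : X n := Finsupp.single (i, j) 1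

/-- The operator `t`, sending `t^j e_i` to `t^(j+1) e_i`. -/
def t (n : ℕ) : X n →ₗ[ℂ] X n :=
  Finsupp.lmapDomain ℂ ℂ (fun q : Fin n × ℤ => (q.1, q.2 + 1))

/-- The subspace `t^m X₀`, spanned by the `t^j e_i` with `j ≥ m`. -/
def level (n : ℕ) (m : ℤ) : Submodule ℂ (X n) :=
  Finsupp.supported ℂ ℂ {q : Fin n × ℤ | m ≤ q.2}

/-- Lattices in `X`, the points of the loop Grassmannian. -/
def IsLattice {n : ℕ} (Y : Submodule ℂ (X n)) : Prop :=
  (∀ y ∈ Y, t n y ∈ Y) ∧ ∃ N : ℕ, level n N ≤ Y ∧ Y ≤ level n (-N)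

/-- `δ_i(Y)`, the largest `j` with `t^(-j) e_i ∈ Y`. -/
def delta {n : ℕ} (Y : Submodule ℂ (X n)) (i : Fin n) : ℤ :=
  sSup {j : ℤ | vec i (-j) ∈ Y}

/-- `Y₀`, the span of all the basis vectors `t^j e_i` lying in `Y`. -/
def fixedPart {n : ℕ} (Y : Submodule ℂ (X n)) : Submodule ℂ (X n) :=
  Submodule.span ℂ {y | y ∈ Y ∧ ∃ i j, y = vec i j}

/-- `dim (Z / (Z ∩ W))` for subspaces `Z`, `W` of a vector space. -/
def relDim {V : Type} [AddCommGroup V] [Module ℂ V] (Z W : Submodule ℂ V) : ℕ :=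
  Module.finrank ℂ (Z ⧸ W.submoduleOf Z)

/-- `dim₀ Y = dim (Y / Y₀)`. -/
def dim0 {n : ℕ} (Y : Submodule ℂ (X n)) : ℕ :=
  relDim Y (fixedPart Y)

/-- The sum of the columns `V_a, …, V_b`. -/
def columns (n a b : ℕ) : Submodule ℂ (X n) :=
  Finsupp.supported ℂ ℂ {q : Fin n × ℤ | a ≤ (q.1 : ℕ) ∧ (q.1 : ℕ) ≤ b}

/-! ### Kostant pictures -/

/-- Positive roots of type `A_(n-1)`, given by the left end `ℓ` and the right end `r` (columns)
of a loop around the dots `ℓ, …, r - 1`. -/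
abbrev Root (n : ℕ) : Type := {q : Fin n × Fin n // q.1 < q.2}

/-- The left end. -/
abbrev Root.left {n : ℕ} (R : Root n) : Fin n := R.1.1

/-- The right end. -/
abbrev Root.right {n : ℕ} (R : Root n) : Fin n := R.1.2

/-- Kostant pictures: every positive root gets the number of loops around its dots. -/
abbrev Picture (n : ℕ) : Type := Root n → ℕ

/-- The loops of a Kostant picture. Loops around the same dots are numbered from inside to
outside. -/
abbrev Loop {n : ℕ} (p : Picture n) : Type := Σ R : Root n, Fin (p R)

/-- `L'` is encircled by `L`. -/
def Encircled {n : ℕ} {p : Picture n} (L' L : Loop p) : Prop :=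
  (L.1.left ≤ L'.1.left ∧ L'.1.right ≤ L.1.right ∧ L'.1 ≠ L.1) ∨
    (L'.1 = L.1 ∧ (L'.2 : ℕ) < (L.2 : ℕ))

/-- The number of loops of `p` with left end at column `i`. -/
def leftCount {n : ℕ} (p : Picture n) (i : Fin n) : ℕ :=
  ∑ R : Root n, if R.left = i then p R else 0

/-- The number `n_L = dim₀(Y ∩ V_L) - dim₀(Y ∩ V_{L₊}) - dim₀(Y ∩ V_{L₋}) + dim₀(Y ∩ V_{L±})`.
For `V_{L₊}`, `V_{L₋}`, `V_{L±}` a single column contributes `0`, just as the zero space does, so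
that short loops need no separate treatment. -/
def loopNumber {n : ℕ} (Y : Submodule ℂ (X n)) (L : Root n) : ℤ :=
  (dim0 (Y ⊓ columns n L.left L.right) : ℤ)
    - dim0 (Y ⊓ columns n (L.left + 1 : ℕ) L.right)
    - dim0 (Y ⊓ columns n L.left (L.right - 1 : ℕ))
    + dim0 (Y ⊓ columns n (L.left + 1 : ℕ) (L.right - 1 : ℕ))

/-- The piece `M(p, lam)`: all lattices whose Kostant picture is `p` and whose coweight is
`lam`. -/
def piece {n : ℕ} (p : Picture n) (lam : Fin n → ℤ) : Set (Submodule ℂ (X n)) :=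
  {Y | IsLattice Y ∧ (∀ L : Root n, loopNumber Y L = p L) ∧
    ∀ i, lam i = delta Y i + leftCount p i}

/-! ### The variety structure on sets of lattices -/

/-- The positions `(i, j)` with `-N ≤ j < N`. -/
abbrev Window (n N : ℕ) : Type := Fin n × ↥(Finset.Ico (-(N : ℤ)) (N : ℤ))

/-- Reading off the coordinates in the window; on `t^(-N) X₀` this is the quotient map onto
`t^(-N) X₀ / t^N X₀ = ℂ^(Window n N)`. -/
def toWindow (n N : ℕ) : X n →ₗ[ℂ] (Window n N → ℂ) where
  toFun y := fun q => y (q.1, (q.2 : ℤ))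
  map_add' _ _ := rfl
  map_smul' _ _ := rfl

/-- `t^N X₀ ⊆ Y ⊆ t^(-N) X₀` and `dim (Y / t^N X₀) = k`: then `Y` is a point of the Grassmannian of
`k`-dimensional subspaces of `t^(-N) X₀ / t^N X₀`. -/
def InGrass {n : ℕ} (N k : ℕ) (Y : Submodule ℂ (X n)) : Prop :=
  level n N ≤ Y ∧ Y ≤ level n (-N) ∧ Module.finrank ℂ (Y.map (toWindow n N)) = k

/-- A set of lattices inside one such Grassmannian, embedded by Plücker coordinates. -/
def pluckerEmb {n : ℕ} {M : Set (Submodule ℂ (X n))} {N k : ℕ}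
    (hM : ∀ Y ∈ M, InGrass N k Y) (Y : M) :
    MultiProj (fun _ : Unit => Fin k → Window n N) :=
  pluckerPoint ((Y : Submodule ℂ (X n)).map (toWindow n N)) (hM Y Y.2).2.2

/-! ### The open subset of a product of projective spaces -/

/-- The columns through which `L` passes. -/
abbrev Cols {n : ℕ} {p : Picture n} (L : Loop p) : Type :=
  {k : Fin n // L.1.left ≤ k ∧ k ≤ L.1.right}

/-- The product `ℙ^p` over the loops `L` of `p` of the spaces `ℙ^L` of lines in
`⟨e_ℓ, …, e_r⟩`. -/
abbrev PP {n : ℕ} (p : Picture n) : Type := MultiProj (fun L : Loop p => Cols L)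

/-- `M` is the largest loop encircled by `L` that has the same right end as `L`. -/
def IsLargestInner {n : ℕ} {p : Picture n} (L M : Loop p) : Prop :=
  Encircled M L ∧ M.1.right = L.1.right ∧
    ∀ M', Encircled M' L → M'.1.right = L.1.right → M' = M ∨ Encircled M' M

open Classical in
/-- The column `m` of a loop `L`: the left end of the largest loop encircled by `L` with the same
right end as `L` if there is such a loop, and otherwise that right end. -/
def pivot {n : ℕ} {p : Picture n} (L : Loop p) : Cols L :=
  if h : ∃ M, IsLargestInner L M then
    ⟨h.choose.1.left, by
      obtain ⟨h1, h2, -⟩ := h.choose_spec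
      refine ⟨?_, h2 ▸ h.choose.1.2.le⟩
      rcases h1 with h1 | h1
      · exact h1.1
      · exact (congrArg Root.left h1.1).ge⟩
  else ⟨L.1.right, L.1.2.le, le_rfl⟩

/-- The left end of `L`, as a column of `L`. -/
def leftCol {n : ℕ} {p : Picture n} (L : Loop p) : Cols L :=
  ⟨L.1.left, le_rfl, L.1.2.le⟩

/-- The subset of `ℙ^p` of families of lines whose `L`-th member projects nontrivially onto
`⟨e_ℓ⟩` and `⟨e_m⟩`, for every loop `L`. -/
def openPP {n : ℕ} (p : Picture n) : Set (PP p) :=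
  {x | ∀ L : Loop p,
    (x L).submodule.map (LinearMap.proj (leftCol L) : (Cols L → ℂ) →ₗ[ℂ] ℂ) ≠ ⊥ ∧
    (x L).submodule.map (LinearMap.proj (pivot L) : (Cols L → ℂ) →ₗ[ℂ] ℂ) ≠ ⊥}

end LoopGr

end

noncomputable section

namespace LoopGr

/-! ### Zariski closed, open and locally closed sets -/

section ZariskiBasics

variable {ι : Type} {τ : ι → Type}

/-! The proof rests on orders of columns. If `Z` is a lattice in an interval of columns, the `c`-th
columns of its vectors are exactly the Laurent polynomials of order at least some `o`
(`IsLat.exists_hasOrd`), and forcing that column to vanish lowers the dimension modulo `t^N X₀` by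
`N - o` (`IsLat.winDim_eq`). The alternating sums that count loops therefore collapse: the number of
loops with ends `l`, `r` is the drop of the order of column `l` when `Y ∩ (V_l ⊕ … ⊕ V_(r-1))` is
enlarged to `Y ∩ (V_l ⊕ … ⊕ V_r)`. A piece is thus the set of lattices with prescribed orders
(`mem_piece_iff`).

Lattices with these orders are built by induction on intervals. Put `A = Y ∩ (V_l ⊕ … ⊕ V_(r-1))`
and `B = Y ∩ (V_(l+1) ⊕ … ⊕ V_r)`, let `P` be the number of loops with ends `l`, `r`, and `o` the
order of column `l` in `A`. For `s ≤ P` there is a vector `g_s` with `l`-th column `t^(o-s)`, unique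
once it is normalized modulo `B`. Here `g_0 ∈ A` and `t g_(s+1) - g_s ∈ B`, so `g_(s+1)` is
determined by `g_s` and by its `r - l` coordinates just below the chart of `B`
(`IsGen.t_sub_apply`). Each loop thus contributes `r - l = dim ℙ^L` numbers. The only constraint is
that the last coordinate of `g_1` is nonzero (`IsGen.apply_ne_zero`): otherwise `A` would have to
grow. Conversely, `A`, `B` and such numbers glue to a lattice (`exists_glue`). Hence the coordinates
determine the lattice (`PieceOn.eq_of_hasCoords`) and may be prescribed (`exists_pieceOn`).

The numbers of a loop, with a `1` in front, are the homogeneous coordinates of a line. The pivot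
differs from the left end only for the innermost loop with given ends, the loop of `g_1`; exchanging
pivot and right end (`colPerm`) turns the constraint into the condition that defines the open set.

For regularity, the whole piece lies in one chart of the Grassmannian, where quotients of Plücker
coordinates are the entries of a reduced basis. The generators are unique solutions of linear
systems with such coefficients, hence regular by Cramer's rule (`RegChart.regVec_of_determining`).
Conversely, the inductive description produces regular families from regular coordinates
(`regChart_of_hasCoords`), and their minors are regular. Finally, inside the chart the piece is cut
out by the Plücker equations, stability under `t`, and the dimensions of the intersections with all
intervals of columns, which are seen by the vanishing of Plücker coordinates
(`range_pluckerEmb_eq`). -/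

theorem evalAt_mul (x : MultiProj τ) (F G : MvPolynomial (Σ i, τ i) ℂ) :
    evalAt x (F * G) = evalAt x F * evalAt x G := map_mul _ _ _

theorem isMultiHom_C (c : ℂ) : IsMultiHom (MvPolynomial.C c : MvPolynomial (Σ i, τ i) ℂ) 0 :=
  MvPolynomial.isWeightedHomogeneous_C _ _

theorem isMultiHom_X (v : Σ i, τ i) :
    IsMultiHom (MvPolynomial.X v : MvPolynomial (Σ i, τ i) ℂ) (Finsupp.single v.1 1) :=
  MvPolynomial.isWeightedHomogeneous_X _ _ _

theorem isZariskiClosed_empty : IsZariskiClosed (∅ : Set (MultiProj τ)) := by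
  refine ⟨{1}, ?_, ?_⟩
  · rintro F rfl
    exact ⟨0, MvPolynomial.isWeightedHomogeneous_one _ _⟩
  · ext x
    simp [evalAt]

theorem isZariskiClosed_univ : IsZariskiClosed (Set.univ : Set (MultiProj τ)) :=
  ⟨∅, by simp, by simp⟩

theorem isZariskiClosed_eq_zero {F : MvPolynomial (Σ i, τ i) ℂ} {d : ι →₀ ℕ}
    (hF : IsMultiHom F d) : IsZariskiClosed {x : MultiProj τ | evalAt x F = 0} :=
  ⟨{F}, by rintro G rfl; exact ⟨d, hF⟩, by simp⟩

theorem isZariskiOpen_ne_zero {F : MvPolynomial (Σ i, τ i) ℂ} {d : ι →₀ ℕ}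
    (hF : IsMultiHom F d) : IsZariskiOpen {x : MultiProj τ | evalAt x F ≠ 0} := by
  have : {x : MultiProj τ | evalAt x F ≠ 0}ᶜ = {x | evalAt x F = 0} := by
    ext; simp
  rw [IsZariskiOpen, this]
  exact isZariskiClosed_eq_zero hF

theorem IsZariskiClosed.iInter {α : Type*} {Z : α → Set (MultiProj τ)}
    (h : ∀ a, IsZariskiClosed (Z a)) : IsZariskiClosed (⋂ a, Z a) := by
  choose A hA hZ using h
  refine ⟨⋃ a, A a, ?_, ?_⟩
  · intro F hF
    obtain ⟨a, ha⟩ := Set.mem_iUnion.1 hF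
    exact hA a F ha
  · ext x
    simp only [hZ, Set.mem_iInter, Set.mem_ofPred_eq, Set.mem_iUnion]
    exact ⟨fun h F ⟨a, ha⟩ => h a F ha, fun h a F ha => h F ⟨a, ha⟩⟩

theorem IsZariskiClosed.inter {Z W : Set (MultiProj τ)} (hZ : IsZariskiClosed Z)
    (hW : IsZariskiClosed W) : IsZariskiClosed (Z ∩ W) := by
  rw [Set.inter_eq_iInter]
  exact IsZariskiClosed.iInter (by rintro (_ | _) <;> assumption)

theorem IsZariskiClosed.union {Z W : Set (MultiProj τ)} (hZ : IsZariskiClosed Z)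
    (hW : IsZariskiClosed W) : IsZariskiClosed (Z ∪ W) := by
  obtain ⟨A, hA, rfl⟩ := hZ
  obtain ⟨B, hB, rfl⟩ := hW
  refine ⟨Set.image2 (· * ·) A B, ?_, ?_⟩
  · rintro _ ⟨F, hF, G, hG, rfl⟩
    obtain ⟨d, hd⟩ := hA F hF
    obtain ⟨d', hd'⟩ := hB G hG
    exact ⟨d + d', hd.mul hd'⟩
  · ext x
    simp only [Set.mem_union, Set.mem_ofPred_eq, Set.forall_mem_image2, evalAt_mul, mul_eq_zero]
    constructor
    · rintro (h | h) F hF G hG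
      · exact Or.inl (h F hF)
      · exact Or.inr (h G hG)
    · intro h
      by_contra! hc
      obtain ⟨⟨F, hF, hF0⟩, G, hG, hG0⟩ := hc
      exact (h F hF G hG).elim hF0 hG0

theorem IsZariskiOpen.inter {Z W : Set (MultiProj τ)} (hZ : IsZariskiOpen Z)
    (hW : IsZariskiOpen W) : IsZariskiOpen (Z ∩ W) := by
  rw [IsZariskiOpen, Set.compl_inter]
  exact IsZariskiClosed.union hZ hW

theorem IsZariskiClosed.isZariskiLocallyClosed {Z : Set (MultiProj τ)} (hZ : IsZariskiClosed Z) :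
    IsZariskiLocallyClosed Z :=
  ⟨Z, Set.univ, hZ, by simpa [IsZariskiOpen] using isZariskiClosed_empty, by simp⟩

theorem IsZariskiOpen.isZariskiLocallyClosed {U : Set (MultiProj τ)} (hU : IsZariskiOpen U) :
    IsZariskiLocallyClosed U :=
  ⟨Set.univ, U, isZariskiClosed_univ, hU, by simp⟩

theorem IsZariskiLocallyClosed.inter {S T : Set (MultiProj τ)} (hS : IsZariskiLocallyClosed S)
    (hT : IsZariskiLocallyClosed T) : IsZariskiLocallyClosed (S ∩ T) := by
  obtain ⟨Z, U, hZ, hU, rfl⟩ := hS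
  obtain ⟨Z', U', hZ', hU', rfl⟩ := hT
  exact ⟨Z ∩ Z', U ∩ U', hZ.inter hZ', hU.inter hU', Set.inter_inter_inter_comm _ _ _ _⟩

theorem IsZariskiLocallyClosed.biInter {α : Type*} (s : Finset α) {S : α → Set (MultiProj τ)}
    (h : ∀ a, IsZariskiLocallyClosed (S a)) : IsZariskiLocallyClosed (⋂ a ∈ s, S a) := by
  classical
  induction s using Finset.induction_on with
  | empty => simpa using isZariskiClosed_univ.isZariskiLocallyClosed
  | insert a s _ ih =>
    rw [Finset.set_biInter_insert]
    exact (h a).inter ih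

end ZariskiBasics

/-! ### Regular functions -/

section Regular

variable {ι : Type} {τ : ι → Type} {S : Type}

/-- The algebra of regular functions on a set `S` embedded in a multiprojective space by `e`:
functions that are locally quotients of multihomogeneous polynomials of one multidegree. -/
def regAlg (e : S → MultiProj τ) : Subalgebra ℂ (S → ℂ) where
  carrier := {f | ∀ x, ∃ (d : ι →₀ ℕ) (F Q : MvPolynomial (Σ i, τ i) ℂ),
    IsMultiHom F d ∧ IsMultiHom Q d ∧ evalAt (e x) Q ≠ 0 ∧
    ∀ y, evalAt (e y) Q ≠ 0 → f y = evalAt (e y) F / evalAt (e y) Q}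
  mul_mem' := by
    intro f g hf hg x
    obtain ⟨d, F, Q, hF, hQ, hQx, h⟩ := hf x
    obtain ⟨d', F', Q', hF', hQ', hQx', h'⟩ := hg x
    refine ⟨d + d', F * F', Q * Q', hF.mul hF', hQ.mul hQ', ?_, ?_⟩
    · rw [evalAt_mul]; exact mul_ne_zero hQx hQx'
    · intro y hy
      rw [evalAt_mul] at hy
      rw [Pi.mul_apply, h y (left_ne_zero_of_mul hy), h' y (right_ne_zero_of_mul hy), evalAt_mul,
        evalAt_mul, div_mul_div_comm]
  add_mem' := by
    intro f g hf hg x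
    obtain ⟨d, F, Q, hF, hQ, hQx, h⟩ := hf x
    obtain ⟨d', F', Q', hF', hQ', hQx', h'⟩ := hg x
    refine ⟨d + d', F * Q' + Q * F', Q * Q', (hF.mul hQ').add (hQ.mul hF'), hQ.mul hQ', ?_, ?_⟩
    · rw [evalAt_mul]; exact mul_ne_zero hQx hQx'
    · intro y hy
      rw [evalAt_mul] at hy
      rw [Pi.add_apply, h y (left_ne_zero_of_mul hy), h' y (right_ne_zero_of_mul hy), evalAt_mul,
        div_add_div _ _ (left_ne_zero_of_mul hy) (right_ne_zero_of_mul hy)]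
      simp [evalAt]
  algebraMap_mem' := by
    intro c x
    exact ⟨0, MvPolynomial.C c, MvPolynomial.C 1, isMultiHom_C _, isMultiHom_C _,
      by simp [evalAt], fun y _ => by simp [evalAt]⟩

variable {e : S → MultiProj τ}

theorem const_mem_regAlg (c : ℂ) : (fun _ => c) ∈ regAlg e :=
  (regAlg e).algebraMap_mem c

theorem coord_div_mem_regAlg (i : ι) (s s' : τ i) (h : ∀ x, (e x i).rep s' ≠ 0) :
    (fun x => (e x i).rep s / (e x i).rep s') ∈ regAlg e := by
  intro x
  exact ⟨_, MvPolynomial.X ⟨i, s⟩, MvPolynomial.X ⟨i, s'⟩, isMultiHom_X _, isMultiHom_X _,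
    by simpa [evalAt] using h x, fun y _ => by simp [evalAt]⟩

/-- The denominator may depend on the point. Cramer's rule needs this, since the minor that does not
vanish varies over `S`. -/
theorem regAlg_of_locally_div {f : S → ℂ}
    (h : ∀ x, ∃ g ∈ regAlg e, ∃ q ∈ regAlg e, q x ≠ 0 ∧ ∀ y, q y ≠ 0 → f y = g y / q y) :
    f ∈ regAlg e := by
  intro x
  obtain ⟨g, hg, q, hq, hqx, hy⟩ := h x
  obtain ⟨d, F, Q, hF, hQ, hQx, hFQ⟩ := hg x
  obtain ⟨d', F', Q', hF', hQ', hQx', hFQ'⟩ := hq x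
  have hF'x : evalAt (e x) F' ≠ 0 := by
    intro h0
    rw [hFQ' x hQx', h0, zero_div] at hqx
    exact hqx rfl
  -- The extra factor `Q'` above and below makes the new denominator vanish wherever the formula for
  -- `q` is not available.
  refine ⟨d + d' + d', F * Q' * Q', Q * F' * Q', (hF.mul hQ').mul hQ', (hQ.mul hF').mul hQ', ?_, ?_⟩
  · simp only [evalAt_mul]
    exact mul_ne_zero (mul_ne_zero hQx hF'x) hQx'
  · intro y hy0
    simp only [evalAt_mul] at hy0 ⊢
    have h1 := left_ne_zero_of_mul (left_ne_zero_of_mul hy0)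
    have h2 := right_ne_zero_of_mul (left_ne_zero_of_mul hy0)
    have h3 := right_ne_zero_of_mul hy0
    have hqy : q y ≠ 0 := by
      rw [hFQ' y h3]; exact div_ne_zero h2 h3
    rw [hy y hqy, hFQ y h1, hFQ' y h3]
    field_simp

theorem det_mem_regAlg {m : Type} [Fintype m] [DecidableEq m] {M : S → Matrix m m ℂ}
    (hM : ∀ i j, (fun x => M x i j) ∈ regAlg e) : (fun x => (M x).det) ∈ regAlg e := by
  have : (fun x => (M x).det) = ∑ s : Equiv.Perm m,
      (s.sign : ℤ) • ∏ i, fun x => M x (s i) i := by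
    ext x
    simp only [Matrix.det_apply, Finset.sum_apply, Pi.smul_apply, Finset.prod_apply]
    rfl
  rw [this]
  exact Subalgebra.sum_mem _ fun s _ => Subalgebra.zsmul_mem _
    (Subalgebra.prod_mem _ fun i _ => hM _ _) _

/-- Injectivity is full column rank, so the rows span and a basis can be chosen among them. -/
theorem exists_submatrix_det_ne_zero {m k : Type} [Fintype m] [Fintype k] [DecidableEq k]
    (M : Matrix m k ℂ) (hM : ∀ c, M.mulVec c = 0 → c = 0) :
    ∃ f : k → m, (M.submatrix f id).det ≠ 0 := by
  classical
  have hinj : Function.Injective M.mulVecLin := by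
    rw [← LinearMap.ker_eq_bot, LinearMap.ker_eq_bot']
    exact hM
  have hrk : M.rank = Fintype.card k := by
    rw [Matrix.rank, LinearMap.finrank_range_of_inj hinj, Module.finrank_fintype_fun_eq_card]
  have hspan : Submodule.span ℂ (Set.range M.row) = ⊤ := by
    apply Submodule.eq_top_of_finrank_eq
    rw [← Matrix.rank_eq_finrank_span_row, hrk, Module.finrank_fintype_fun_eq_card]
  obtain ⟨κ, a, _, hsp, hli⟩ := exists_linearIndependent' ℂ M.row
  rw [hspan] at hsp
  let B := Module.Basis.mk hli hsp.ge
  have : Fintype κ := FiniteDimensional.fintypeBasisIndex B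
  have hcard : Fintype.card κ = Fintype.card k := by
    have := Module.finrank_eq_card_basis B
    rw [Module.finrank_fintype_fun_eq_card] at this
    exact this.symm
  let g : k ≃ κ := (Fintype.equivOfCardEq hcard).symm
  refine ⟨fun b => a (g b), ?_⟩
  have hli2 : LinearIndependent ℂ (M.submatrix (fun b => a (g b)) id).row :=
    hli.comp g g.injective
  rw [Matrix.linearIndependent_rows_iff_isUnit, Matrix.isUnit_iff_isUnit_det] at hli2
  exact hli2.ne_zero

/-- The unique solution of a linear system with regular coefficients is regular. -/
theorem regAlg_of_mulVec {m k : Type} [Fintype m] [Fintype k] {M : S → Matrix m k ℂ}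
    {c : S → k → ℂ} (hM : ∀ i j, (fun x => M x i j) ∈ regAlg e)
    (hinj : ∀ x c, (M x).mulVec c = 0 → c = 0)
    (hc : ∀ i, (fun x => (M x).mulVec (c x) i) ∈ regAlg e) (j : k) :
    (fun x => c x j) ∈ regAlg e := by
  classical
  refine regAlg_of_locally_div fun x => ?_
  obtain ⟨f, hf⟩ := exists_submatrix_det_ne_zero (M x) (hinj x)
  -- Cramer's rule for the square subsystem that is invertible at `x`; it remains valid wherever its
  -- determinant does not vanish.
  refine ⟨fun y => (((M y).submatrix f id).updateCol j fun i => (M y).mulVec (c y) (f i)).det,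
    det_mem_regAlg fun a b => ?_, fun y => ((M y).submatrix f id).det,
    det_mem_regAlg fun a b => hM _ _, hf, fun y hy => ?_⟩
  · by_cases hb : b = j
    · subst hb
      simpa using hc (f a)
    · simpa [Matrix.updateCol_ne hb] using hM (f a) b
  · have h1 : (fun i => (M y).mulVec (c y) (f i)) = ((M y).submatrix f id).mulVec (c y) := rfl
    have hy' : ((M y).submatrix f id).det ≠ 0 := hy
    change c y j = (((M y).submatrix f id).updateCol j _).det / ((M y).submatrix f id).det
    rw [eq_div_iff hy', h1, ← Matrix.cramer_apply, Matrix.cramer_eq_adjugate_mulVec,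
      Matrix.mulVec_mulVec, Matrix.adjugate_mul, Matrix.smul_mulVec, Matrix.one_mulVec]
    simp [mul_comm]

theorem evalAt_prod {α : Type} (x : MultiProj τ) (s : Finset α)
    (F : α → MvPolynomial (Σ i, τ i) ℂ) : evalAt x (∏ a ∈ s, F a) = ∏ a ∈ s, evalAt x (F a) :=
  map_prod _ _ _

/-- Maps whose homogeneous coordinates are regular functions are regular. -/
theorem isRegularMap_of_mem_regAlg {κ : Type} {σ : κ → Type} [∀ j, Fintype (σ j)] {S' : Type}
    (e' : S' → MultiProj σ) (f : S → S') (φ : ∀ j, S → σ j → ℂ)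
    (hφ : ∀ j s, (fun x => φ j x s) ∈ regAlg e)
    (h : ∀ j x, ∃ h0 : φ j x ≠ 0, e' (f x) j = Projectivization.mk ℂ (φ j x) h0) :
    IsRegularMap e e' f := by
  classical
  intro x j
  choose d F Q hF hQ hQx hFQ using fun s => hφ j s x
  -- All coordinates are brought to the common denominator `∏ s, Q s`; this also makes their
  -- multidegrees equal.
  refine ⟨{y | evalAt y (∏ s, Q s) ≠ 0}, ∑ s, d s,
    fun s => F s * ∏ s' ∈ Finset.univ.erase s, Q s', isZariskiOpen_ne_zero
      (MvPolynomial.IsWeightedHomogeneous.prod Finset.univ Q d fun s _ => hQ s), ?_, ?_, ?_⟩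
  · simp only [Set.mem_ofPred_eq, evalAt_prod]
    exact Finset.prod_ne_zero_iff.2 fun s _ => hQx s
  · intro s
    rw [← Finset.add_sum_erase Finset.univ d (Finset.mem_univ s)]
    exact (hF s).mul (MvPolynomial.IsWeightedHomogeneous.prod _ Q d fun s _ => hQ s)
  · intro y hy
    simp only [Set.mem_ofPred_eq, evalAt_prod] at hy
    have hne : ∀ s, evalAt (e y) (Q s) ≠ 0 := fun s => Finset.prod_ne_zero_iff.1 hy s (by simp)
    have key : (fun s => evalAt (e y) (F s * ∏ s' ∈ Finset.univ.erase s, Q s')) =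
        (∏ s, evalAt (e y) (Q s)) • φ j y := by
      ext s
      have hs : φ j y s = _ := hFQ s y (hne s)
      rw [evalAt_mul, evalAt_prod, Pi.smul_apply, smul_eq_mul, hs,
        ← Finset.mul_prod_erase Finset.univ _ (Finset.mem_univ s)]
      have := hne s
      field_simp
    obtain ⟨h0, h1⟩ := h j y
    refine ⟨?_, ?_⟩
    · rw [key]
      exact smul_ne_zero hy h0
    · rw [h1, Projectivization.mk_eq_mk_iff']
      refine ⟨(∏ s, evalAt (e y) (Q s))⁻¹, ?_⟩
      rw [key, smul_smul, inv_mul_cancel₀ hy, one_smul]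

end Regular

/-! ### Plücker coordinates -/

section Plucker

variable {σ : Type} {k : ℕ}

/-- The maximal minor of the rows `v` in the columns `I`. -/
def minor (v : Fin k → σ → ℂ) (I : Fin k → σ) : ℂ :=
  Matrix.det (Matrix.of fun a b => v a (I b))

theorem minor_mul (g : Matrix (Fin k) (Fin k) ℂ) (v : Fin k → σ → ℂ) (I : Fin k → σ) :
    minor (fun a => ∑ c, g a c • v c) I = g.det * minor v I := by
  rw [minor, minor, ← Matrix.det_mul]
  congr 1
  ext a b
  simp [Matrix.mul_apply]

theorem minor_basis_ne_zero [Fintype σ] {v : Fin k → σ → ℂ} (hv : LinearIndependent ℂ v) :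
    minor v ≠ 0 :=
  minors_ne_zero v hv

/-- Two bases of `W` differ by a square matrix, and the minors change by its determinant; so any
basis computes the Plücker point. -/
theorem exists_rep_pluckerPoint [Fintype σ] {W : Submodule ℂ (σ → ℂ)} (hW : Module.finrank ℂ W = k)
    {v : Fin k → σ → ℂ} (hv : LinearIndependent ℂ v) (hvW : ∀ a, v a ∈ W) (u : Unit) :
    pluckerPoint W hW u = Projectivization.mk ℂ (minor v) (minor_basis_ne_zero hv) := by
  set B := Module.finBasisOfFinrankEq ℂ W hW
  let g : Matrix (Fin k) (Fin k) ℂ := Matrix.of fun a c => B.repr ⟨v a, hvW a⟩ c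
  have hg : v = fun a => ∑ c, g a c • (B c : σ → ℂ) := by
    ext1 a
    have := congrArg (Subtype.val) (B.sum_repr ⟨v a, hvW a⟩)
    rw [AddSubmonoidClass.coe_finsetSum] at this
    exact this.symm
  have hm : minor v = g.det • minor (fun c => (B c : σ → ℂ)) := by
    ext I
    conv_lhs => rw [hg]
    rw [minor_mul]; rfl
  rw [pluckerPoint, Projectivization.mk_eq_mk_iff']
  have hd : g.det ≠ 0 := by
    intro h0
    rw [h0, zero_smul] at hm
    exact minor_basis_ne_zero hv hm
  refine ⟨g.det⁻¹, ?_⟩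
  rw [hm, smul_smul, inv_mul_cancel₀ hd, one_smul]
  rfl

/-- Rows which form the identity matrix in the columns `I₀`. -/
def IsReduced (I₀ : Fin k → σ) (A : Fin k → σ → ℂ) : Prop :=
  ∀ a b, A a (I₀ b) = if a = b then 1 else 0

theorem IsReduced.linearIndependent {I₀ : Fin k → σ} {A : Fin k → σ → ℂ} (h : IsReduced I₀ A) :
    LinearIndependent ℂ A := by
  rw [Fintype.linearIndependent_iff]
  intro g hg b
  have := congrFun hg (I₀ b)
  simpa [h _ b] using this

theorem IsReduced.minor_self {I₀ : Fin k → σ} {A : Fin k → σ → ℂ} (h : IsReduced I₀ A) :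
    minor A I₀ = 1 := by
  rw [minor, ← Matrix.det_one (n := Fin k)]
  congr 1
  ext a b
  simp [h a b, Matrix.one_apply]

/-- The minor is that of an identity matrix with one column replaced. The entries of a reduced basis
are therefore Plücker coordinates themselves. -/
theorem IsReduced.minor_update [DecidableEq σ] {I₀ : Fin k → σ} {A : Fin k → σ → ℂ}
    (h : IsReduced I₀ A) (a : Fin k) (q : σ) :
    minor A (Function.update I₀ a q) = A a q := by
  have : (Matrix.of fun c b => A c (Function.update I₀ a q b)) =
      (1 : Matrix (Fin k) (Fin k) ℂ).updateCol a fun c => A c q := by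
    ext c b
    by_cases hb : b = a
    · subst hb; simp
    · simp [hb, h c b, Matrix.one_apply]
  rw [minor, this, ← Matrix.cramer_apply, Matrix.cramer_one]
  rfl

theorem IsReduced.sum_eq {W : Submodule ℂ (σ → ℂ)} {I₀ : Fin k → σ} {A : Fin k → σ → ℂ}
    (h : IsReduced I₀ A) (hA : ∀ a, A a ∈ W) (hI : ∀ w ∈ W, (∀ b, w (I₀ b) = 0) → w = 0)
    {w : σ → ℂ} (hw : w ∈ W) : w = ∑ a, w (I₀ a) • A a := by
  rw [← sub_eq_zero]
  refine hI _ (W.sub_mem hw (W.sum_mem fun a _ => W.smul_mem _ (hA a))) fun b => ?_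
  simp [h _ b]

/-- Restriction to the positions `I₀` is an injection between spaces of dimension `k`, hence
bijective; the rows are the preimages of the standard basis. -/
theorem exists_isReduced [Fintype σ] {W : Submodule ℂ (σ → ℂ)} (hW : Module.finrank ℂ W = k)
    {I₀ : Fin k → σ} (hI : ∀ w ∈ W, (∀ b, w (I₀ b) = 0) → w = 0) :
    ∃ A : Fin k → σ → ℂ, IsReduced I₀ A ∧ ∀ a, A a ∈ W := by
  let f : W →ₗ[ℂ] (Fin k → ℂ) := (LinearMap.funLeft ℂ ℂ I₀).comp W.subtype
  have hf : Function.Injective f := by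
    rw [← LinearMap.ker_eq_bot, LinearMap.ker_eq_bot']
    rintro ⟨w, hw⟩ h0
    exact Subtype.ext (hI w hw fun b => congrFun h0 b)
  have hs : Function.Surjective f :=
    (LinearMap.injective_iff_surjective_of_finrank_eq_finrank (by simp [hW])).1 hf
  choose A hA using fun a : Fin k => hs (Pi.single a 1)
  refine ⟨fun a => A a, fun a b => ?_, fun a => (A a).2⟩
  have := congrFun (hA a) b
  simpa [f, LinearMap.funLeft_apply, Pi.single_apply, eq_comm] using this

/-- Homogeneous Plücker coordinates in terms of a reduced basis. -/
theorem IsReduced.rep_pluckerPoint [Fintype σ] {W : Submodule ℂ (σ → ℂ)}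
    (hW : Module.finrank ℂ W = k)
    {I₀ : Fin k → σ} {A : Fin k → σ → ℂ} (h : IsReduced I₀ A) (hA : ∀ a, A a ∈ W) (u : Unit) :
    (pluckerPoint W hW u).rep I₀ ≠ 0 ∧
      ∀ I, (pluckerPoint W hW u).rep I = (pluckerPoint W hW u).rep I₀ * minor A I := by
  obtain ⟨α, hα⟩ := Projectivization.exists_smul_eq_mk_rep ℂ (minor A)
    (minor_basis_ne_zero h.linearIndependent)
  rw [← exists_rep_pluckerPoint hW h.linearIndependent hA u] at hα
  rw [← hα]
  have h1 : (α • minor A) I₀ = (α : ℂ) := by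
    rw [Pi.smul_apply, h.minor_self, Units.smul_def, smul_eq_mul, mul_one]
  rw [h1]
  exact ⟨α.ne_zero, fun I => rfl⟩

/-- Rank and nullity of the map sending coefficients `c` to `∑ a, c a • v a` restricted to `C`. -/
theorem finrank_span_cols_add [Fintype σ] {v : Fin k → σ → ℂ} (hv : LinearIndependent ℂ v)
    (C : Set σ) :
    Module.finrank ℂ (Submodule.span ℂ ((fun q a => v a q) '' C)) +
      Module.finrank ℂ (Submodule.span ℂ (Set.range v) ⊓
        Submodule.pi C (fun _ => (⊥ : Submodule ℂ ℂ)) : Submodule ℂ (σ → ℂ)) = k := by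
  classical
  let M : Matrix (Fin k) C ℂ := Matrix.of fun a q => v a q
  have h1 : Module.finrank ℂ (Submodule.span ℂ ((fun q a => v a q) '' C)) =
      Module.finrank ℂ (LinearMap.range M.transpose.mulVecLin) := by
    have : M.transpose.rank = M.rank := Matrix.rank_transpose M
    rw [Matrix.rank, Matrix.rank_eq_finrank_span_cols] at this
    have h0 : (fun q a => v a q) '' C = Set.range M.col := by
      rw [Set.image_eq_range]
      rfl
    rw [this, h0]
  have h2 : (LinearMap.ker M.transpose.mulVecLin).map (Fintype.linearCombination ℂ v) =
      Submodule.span ℂ (Set.range v) ⊓ Submodule.pi C (fun _ => (⊥ : Submodule ℂ ℂ)) := by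
    ext w
    simp only [Submodule.mem_map, LinearMap.mem_ker, Submodule.mem_inf, Submodule.mem_pi,
      Submodule.mem_bot]
    rw [← Fintype.range_linearCombination ℂ, LinearMap.mem_range]
    have hc : ∀ c : Fin k → ℂ, M.transpose.mulVecLin c = 0 ↔
        ∀ q ∈ C, Fintype.linearCombination ℂ v c q = 0 := by
      intro c
      rw [funext_iff, Subtype.forall]
      refine forall_congr' fun q => forall_congr' fun hq => ?_
      rw [Fintype.linearCombination_apply, Finset.sum_apply, Matrix.mulVecLin_apply]
      simp only [M, Matrix.mulVec, dotProduct, Matrix.transpose_apply, Matrix.of_apply,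
        Pi.smul_apply, smul_eq_mul, mul_comm, Pi.zero_apply]
    constructor
    · rintro ⟨c, hc0, rfl⟩
      exact ⟨⟨c, rfl⟩, (hc c).1 hc0⟩
    · rintro ⟨⟨c, rfl⟩, h⟩
      exact ⟨c, (hc c).2 h, rfl⟩
  have hinj : Function.Injective (Fintype.linearCombination ℂ v) :=
    hv.fintypeLinearCombination_injective
  rw [h1, ← h2, ← (Submodule.equivMapOfInjective _ hinj _).finrank_eq,
    LinearMap.finrank_range_add_finrank_ker]
  simp

/-- The rank of the restriction of a subspace to a set of columns, in Plücker coordinates. -/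
theorem exists_minor_ne_zero_iff [Fintype σ] [DecidableEq σ] {v : Fin k → σ → ℂ}
    (hv : LinearIndependent ℂ v)
    (C : Set σ) [DecidablePred (· ∈ C)] (s : ℕ) :
    (∃ I, minor v I ≠ 0 ∧ s ≤ (Finset.univ.filter fun b => I b ∈ C).card) ↔
      Module.finrank ℂ (Submodule.span ℂ (Set.range v) ⊓
        Submodule.pi C (fun _ => (⊥ : Submodule ℂ ℂ)) : Submodule ℂ (σ → ℂ)) + s ≤ k := by
  have hrk := finrank_span_cols_add hv C
  set col : σ → Fin k → ℂ := fun q a => v a q with hcol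
  suffices (∃ I, minor v I ≠ 0 ∧ s ≤ (Finset.univ.filter fun b => I b ∈ C).card) ↔
      s ≤ Module.finrank ℂ (Submodule.span ℂ (col '' C)) by
    rw [this]; omega
  constructor
  · rintro ⟨I, hI, hs⟩
    refine hs.trans ?_
    have hu : IsUnit (Matrix.of fun a b => v a (I b)) := by
      rw [Matrix.isUnit_iff_isUnit_det]
      exact isUnit_iff_ne_zero.2 hI
    rw [← Matrix.linearIndependent_cols_iff_isUnit] at hu
    have hli : LinearIndependent ℂ fun b => col (I b) := hu
    have hli' := hli.comp (fun b : {b // I b ∈ C} => b.1) Subtype.val_injective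
    have hli'' : LinearIndependent ℂ fun b : {b // I b ∈ C} =>
        (⟨col (I b), Submodule.subset_span ⟨_, b.2, rfl⟩⟩ : Submodule.span ℂ (col '' C)) := by
      apply LinearIndependent.of_comp (Submodule.subtype _)
      exact hli'
    have := hli''.fintype_card_le_finrank
    rwa [Fintype.card_subtype] at this
  · intro hs
    -- A basis of the columns in `C` is extended to a basis of all columns, which gives a nonzero
    -- minor with as many entries in `C` as their rank allows.
    obtain ⟨S, hSC, -, hSs, hSli⟩ := exists_linearIndepOn_extension (K := ℂ) (v := col)
      (linearIndepOn_empty ℂ col) (Set.empty_subset C)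
    obtain ⟨S', -, hSS', hS's, hS'li⟩ := exists_linearIndepOn_extension (K := ℂ) (v := col)
      hSli (Set.subset_univ S)
    have htop : Submodule.span ℂ (col '' Set.univ) = ⊤ := by
      apply Submodule.eq_top_of_finrank_eq
      have hrk' := finrank_span_cols_add hv Set.univ
      have hb : (Submodule.span ℂ (Set.range v) ⊓
          Submodule.pi Set.univ (fun _ => (⊥ : Submodule ℂ ℂ)) : Submodule ℂ (σ → ℂ)) = ⊥ := by
        rw [Submodule.pi_univ_bot, inf_bot_eq]
      rw [hb, finrank_bot] at hrk'
      simpa using hrk'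
    have hS'fin : Fintype S' := Fintype.ofFinite _
    have hspan : Submodule.span ℂ (Set.range fun q : S' => col q) = ⊤ := by
      rw [← Set.image_eq_range, eq_top_iff, ← htop, Submodule.span_le]
      exact hS's
    let B := Module.Basis.mk hS'li hspan.ge
    have hcard : Fintype.card S' = k := by
      have := Module.finrank_eq_card_basis B
      simpa using this.symm
    let f : Fin k ≃ S' := (Fintype.equivFinOfCardEq hcard).symm
    refine ⟨fun b => f b, ?_, hs.trans ?_⟩
    · have hli : LinearIndependent ℂ (fun b : Fin k => col (f b)) := hS'li.comp f f.injective
      have hu : IsUnit (Matrix.of fun a b => v a (f b)) := by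
        rw [← Matrix.linearIndependent_cols_iff_isUnit]
        exact hli
      rw [Matrix.isUnit_iff_isUnit_det] at hu
      exact hu.ne_zero
    · have hle : Submodule.span ℂ (col '' C) ≤ Submodule.span ℂ (Set.range fun q : S => col q) := by
        rw [Submodule.span_le, ← Set.image_eq_range]
        exact hSs
      have hSfin : Fintype S := Fintype.ofFinite _
      have h1 := (Submodule.finrank_mono hle).trans
        (finrank_range_le_card (R := ℂ) (fun q : S => col q))
      refine h1.trans ?_
      rw [← Finset.card_univ]
      refine Finset.card_le_card_of_injOn (fun q => f.symm ⟨q, hSS' q.2⟩) ?_ ?_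
      · intro q _
        simpa using hSC q.2
      · intro q _ q' _ h
        simpa [Subtype.ext_iff] using h

end Plucker

/-! ### Columns, shifts and orders -/

section Columns

variable {n : ℕ}

/-- The sum of the columns `V_i` with `a ≤ i < b`. -/
def cols (n a b : ℕ) : Submodule ℂ (X n) :=
  Finsupp.supported ℂ ℂ {q : Fin n × ℤ | a ≤ (q.1 : ℕ) ∧ (q.1 : ℕ) < b}

theorem mem_cols {a b : ℕ} {y : X n} :
    y ∈ cols n a b ↔ ∀ (i : Fin n) (j : ℤ), ¬ (a ≤ (i : ℕ) ∧ (i : ℕ) < b) → y (i, j) = 0 := by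
  rw [cols, Finsupp.mem_supported']
  simp [Prod.forall]

theorem mem_level {m : ℤ} {y : X n} : y ∈ level n m ↔ ∀ i j, j < m → y (i, j) = 0 := by
  rw [level, Finsupp.mem_supported']
  simp [Prod.forall]

theorem columns_eq_cols (a b : ℕ) : columns n a b = cols n a (b + 1) := by
  rw [columns, cols]
  congr 1
  ext q
  simp

theorem cols_zero_top : cols n 0 n = ⊤ := by
  rw [eq_top_iff]
  intro y _
  rw [mem_cols]
  intro i j h
  exact absurd ⟨Nat.zero_le _, i.2⟩ h

theorem cols_mono {a b a' b' : ℕ} (ha : a ≤ a') (hb : b' ≤ b) : cols n a' b' ≤ cols n a b := by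
  intro y hy
  rw [mem_cols] at hy ⊢
  exact fun i j h => hy i j fun h' => h ⟨by omega, by omega⟩

theorem cols_eq_bot {a b : ℕ} (h : b ≤ a) : cols n a b = ⊥ := by
  rw [eq_bot_iff]
  intro y hy
  rw [mem_cols] at hy
  rw [Submodule.mem_bot]
  ext ⟨i, j⟩
  exact hy i j (by omega)

theorem inf_cols_inf_cols (Z : Submodule ℂ (X n)) {a b a' b' : ℕ} (ha : a ≤ a') (hb : b' ≤ b) :
    Z ⊓ cols n a b ⊓ cols n a' b' = Z ⊓ cols n a' b' := by
  rw [inf_assoc, inf_eq_right.2 (cols_mono ha hb)]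

/-- Multiplication by `t ^ k`. -/
def sh (n : ℕ) (k : ℤ) : X n ≃ₗ[ℂ] X n :=
  Finsupp.domLCongr ((Equiv.refl (Fin n)).prodCongr (Equiv.addRight k))

@[simp] theorem sh_apply (k : ℤ) (y : X n) (i : Fin n) (j : ℤ) :
    sh n k y (i, j) = y (i, j - k) := by
  simp [sh, sub_eq_add_neg]

theorem t_eq_sh (y : X n) : t n y = sh n 1 y := by
  have : t n = (sh n 1).toLinearMap := by
    ext q : 2
    simp [t, sh]
    rfl
  rw [this]; rfl

@[simp] theorem t_apply (y : X n) (i : Fin n) (j : ℤ) : t n y (i, j) = y (i, j - 1) := by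
  rw [t_eq_sh, sh_apply]

theorem sh_sh (k l : ℤ) (y : X n) : sh n k (sh n l y) = sh n (k + l) y := by
  ext ⟨i, j⟩
  simp only [sh_apply]
  congr 2
  ring

theorem sh_zero (y : X n) : sh n 0 y = y := by
  ext ⟨i, j⟩
  simp

theorem sh_mem {Z : Submodule ℂ (X n)} (hZ : ∀ y ∈ Z, t n y ∈ Z) {k : ℤ} (hk : 0 ≤ k) {y : X n}
    (hy : y ∈ Z) : sh n k y ∈ Z := by
  obtain ⟨k, rfl⟩ := Int.eq_ofNat_of_zero_le hk
  induction k with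
  | zero => simpa [sh_zero] using hy
  | succ k ih =>
    have := hZ _ (ih (by omega))
    rwa [t_eq_sh, sh_sh, add_comm] at this

theorem t_mem_cols {a b : ℕ} {y : X n} (hy : y ∈ cols n a b) : t n y ∈ cols n a b := by
  rw [mem_cols] at hy ⊢
  intro i j h
  rw [t_apply]
  exact hy i _ h

theorem sh_mem_cols {a b : ℕ} {y : X n} (k : ℤ) (hy : y ∈ cols n a b) : sh n k y ∈ cols n a b := by
  rw [mem_cols] at hy ⊢
  intro i j h
  rw [sh_apply]
  exact hy i _ h

theorem vec_apply (i i' : Fin n) (j j' : ℤ) :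
    vec i j (i', j') = if i' = i ∧ j' = j then 1 else 0 := by
  rw [vec, Finsupp.single_apply]
  simp [Prod.ext_iff, eq_comm]

/-- The `c`-th column of a vector. -/
def colProj (c : Fin n) : X n →ₗ[ℂ] (ℤ →₀ ℂ) :=
  Finsupp.lcomapDomain (fun j => (c, j)) (Prod.mk_right_injective c)

@[simp] theorem colProj_apply (c : Fin n) (y : X n) (j : ℤ) : colProj c y j = y (c, j) := rfl

/-- The vector with `c`-th column `u` and no others. -/
def colIncl (c : Fin n) : (ℤ →₀ ℂ) →ₗ[ℂ] X n :=
  Finsupp.lmapDomain ℂ ℂ (fun j => (c, j))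

theorem colIncl_apply (c : Fin n) (u : ℤ →₀ ℂ) (i : Fin n) (j : ℤ) :
    colIncl c u (i, j) = if i = c then u j else 0 := by
  rw [colIncl, Finsupp.lmapDomain_apply]
  split_ifs with h
  · subst h
    exact Finsupp.mapDomain_apply (Prod.mk_right_injective i) u j
  · apply Finsupp.mapDomain_of_notMem_range
    rintro ⟨j', h'⟩
    exact h (congrArg Prod.fst h').symm

theorem inf_ker_colProj_left {Z : Submodule ℂ (X n)} {a b : ℕ} (hZ : Z ≤ cols n a b) (c : Fin n)
    (hc : (c : ℕ) = a) : Z ⊓ LinearMap.ker (colProj c) = Z ⊓ cols n (a + 1) b := by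
  ext y
  simp only [Submodule.mem_inf, LinearMap.mem_ker]
  refine and_congr_right fun hy => ?_
  have hy' := mem_cols.1 (hZ hy)
  rw [mem_cols]
  constructor
  · intro h i j hi
    by_cases hic : i = c
    · subst hic; exact DFunLike.congr_fun h j
    · exact hy' i j fun h' => hi ⟨by have : (i : ℕ) ≠ c := fun h => hic (Fin.ext h)
                                     omega, h'.2⟩
  · intro h
    ext j
    exact h c j (by omega)

theorem inf_ker_colProj_right {Z : Submodule ℂ (X n)} {a : ℕ} (c : Fin n)
    (hZ : Z ≤ cols n a (c + 1)) :
    Z ⊓ LinearMap.ker (colProj c) = Z ⊓ cols n a c := by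
  ext y
  simp only [Submodule.mem_inf, LinearMap.mem_ker]
  refine and_congr_right fun hy => ?_
  have hy' := mem_cols.1 (hZ hy)
  rw [mem_cols]
  constructor
  · intro h i j hi
    by_cases hic : i = c
    · subst hic; exact DFunLike.congr_fun h j
    · exact hy' i j fun h' => hi ⟨h'.1, by have : (i : ℕ) ≠ c := fun h => hic (Fin.ext h)
                                           omega⟩
  · intro h
    ext j
    exact h c j (by omega)

/-- The `c`-th columns of the vectors of `Z` are all those of order at least `o`. -/
def HasOrd (Z : Submodule ℂ (X n)) (c : Fin n) (o : ℤ) : Prop :=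
  Z.map (colProj c) = Finsupp.supported ℂ ℂ (Set.Ici o)

theorem hasOrd_iff {Z : Submodule ℂ (X n)} {c : Fin n} {o : ℤ} :
    HasOrd Z c o ↔ (∀ y ∈ Z, ∀ j < o, y (c, j) = 0) ∧
      ∀ u : ℤ →₀ ℂ, (∀ j < o, u j = 0) → ∃ y ∈ Z, ∀ j, y (c, j) = u j := by
  rw [HasOrd, le_antisymm_iff, Submodule.map_le_iff_le_comap]
  refine and_congr ?_ ?_
  · refine forall_congr' fun y => forall_congr' fun hy => ?_
    rw [Submodule.mem_comap, Finsupp.mem_supported']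
    simp
  · refine forall_congr' fun u => ?_
    rw [Finsupp.mem_supported', Submodule.mem_map]
    simp [DFunLike.ext_iff]

theorem HasOrd.eq_zero {Z : Submodule ℂ (X n)} {c : Fin n} {o : ℤ} (h : HasOrd Z c o) {y : X n}
    (hy : y ∈ Z) {j : ℤ} (hj : j < o) : y (c, j) = 0 := (hasOrd_iff.1 h).1 y hy j hj

theorem HasOrd.exists_mem {Z : Submodule ℂ (X n)} {c : Fin n} {o : ℤ} (h : HasOrd Z c o)
    (u : ℤ →₀ ℂ) (hu : ∀ j < o, u j = 0) : ∃ y ∈ Z, ∀ j, y (c, j) = u j := (hasOrd_iff.1 h).2 u hu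

theorem HasOrd.unique {Z : Submodule ℂ (X n)} {c : Fin n} {o o' : ℤ} (h : HasOrd Z c o)
    (h' : HasOrd Z c o') : o = o' := by
  by_contra hne
  wlog hlt : o < o' generalizing o o'
  · exact this h' h (Ne.symm hne) (by omega)
  obtain ⟨y, hy, hyo⟩ := h.exists_mem (Finsupp.single o 1)
    (fun j hj => Finsupp.single_eq_of_ne (by omega))
  have := h'.eq_zero hy hlt
  rw [hyo] at this
  simp at this

/-- A lattice in the sum of the columns from `a` to `b - 1`. -/
structure IsLat (N a b : ℕ) (Z : Submodule ℂ (X n)) : Prop where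
  stable : ∀ y ∈ Z, t n y ∈ Z
  le_cols : Z ≤ cols n a b
  lower : level n N ⊓ cols n a b ≤ Z
  upper : Z ≤ level n (-N)

theorem IsLat.inf_cols {N a b a' b' : ℕ} {Z : Submodule ℂ (X n)} (h : IsLat N a b Z) (ha : a ≤ a')
    (hb : b' ≤ b) : IsLat N a' b' (Z ⊓ cols n a' b') where
  stable y hy := ⟨h.stable y hy.1, t_mem_cols hy.2⟩
  le_cols := inf_le_right
  lower := le_inf ((inf_le_inf_left _ (cols_mono ha hb)).trans h.lower) inf_le_right
  upper := inf_le_left.trans h.upper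

theorem level_anti {m m' : ℤ} (h : m ≤ m') : level n m' ≤ level n m := by
  intro y hy
  rw [mem_level] at hy ⊢
  exact fun i j hj => hy i j (by omega)

theorem isLattice_iff {Y : Submodule ℂ (X n)} : IsLattice Y ↔ ∃ N, IsLat N 0 n Y := by
  constructor
  · rintro ⟨h1, N, h2, h3⟩
    exact ⟨N, h1, by rw [cols_zero_top]; exact le_top, inf_le_left.trans h2, h3⟩
  · rintro ⟨N, h⟩
    refine ⟨h.stable, N, ?_, h.upper⟩
    have := h.lower
    rwa [cols_zero_top, inf_top_eq] at this

/-- The order is the least exponent that occurs in the column. Shifts of a vector attaining it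
remove leading terms one by one until only exponents from `N` on remain, where the lattice contains
everything. -/
theorem IsLat.exists_hasOrd {N a b : ℕ} {Z : Submodule ℂ (X n)} (h : IsLat N a b Z) (c : Fin n)
    (hca : a ≤ (c : ℕ)) (hcb : (c : ℕ) < b) : ∃ o : ℤ, -N ≤ o ∧ o ≤ N ∧ HasOrd Z c o := by
  have hlow : ∀ u : ℤ →₀ ℂ, (∀ j < (N : ℤ), u j = 0) → ∃ y ∈ Z, ∀ j, y (c, j) = u j := by
    intro u hu
    refine ⟨colIncl c u, h.lower ⟨?_, ?_⟩, fun j => by rw [colIncl_apply, if_pos rfl]⟩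
    · exact mem_level.2 fun i j hj => by rw [colIncl_apply, hu j hj, ite_self]
    · refine mem_cols.2 fun i j hj => ?_
      rw [colIncl_apply, if_neg]
      rintro rfl
      exact hj ⟨hca, hcb⟩
  obtain ⟨o, ⟨y₀, hy₀, hy₀o⟩, ho⟩ := Int.exists_least_of_bdd (P := fun j => ∃ y ∈ Z, y (c, j) ≠ 0)
    ⟨-N, fun j ⟨y, hy, hyj⟩ => by
      by_contra hj
      exact hyj (mem_level.1 (h.upper hy) c j (by omega))⟩
    (by
      obtain ⟨y, hy, hyu⟩ := hlow (Finsupp.single N 1)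
        (fun j hj => Finsupp.single_eq_of_ne (by omega))
      exact ⟨N, y, hy, by rw [hyu]; simp⟩)
  refine ⟨o, ?_, ?_, hasOrd_iff.2 ⟨?_, ?_⟩⟩
  · by_contra hj
    exact hy₀o (mem_level.1 (h.upper hy₀) c o (by omega))
  · refine ho _ ?_
    obtain ⟨y, hy, hyu⟩ := hlow (Finsupp.single N 1)
      (fun j hj => Finsupp.single_eq_of_ne (by omega))
    exact ⟨y, hy, by rw [hyu]; simp⟩
  · intro y hy j hj
    by_contra hne
    exact absurd (ho j ⟨y, hy, hne⟩) (by omega)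
  · suffices ∀ (d : ℕ) (j : ℤ), o ≤ j → N - d ≤ j → ∀ u : ℤ →₀ ℂ, (∀ i < j, u i = 0) →
        ∃ y ∈ Z, ∀ j, y (c, j) = u j from
      this (N - o).toNat o le_rfl (by omega)
    intro d
    induction d with
    | zero => exact fun j _ hj u hu => hlow u fun i hi => hu i (by push_cast at hj; omega)
    | succ d ih =>
      intro j hoj hj u hu
      let z := sh n (j - o) y₀
      have hz : z ∈ Z := sh_mem h.stable (by omega) hy₀
      have hzj : ∀ i, z (c, i) = y₀ (c, i - (j - o)) := fun i => sh_apply _ _ _ _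
      obtain ⟨y, hy, hyu⟩ := ih (j + 1) (by omega) (by push_cast at hj ⊢; omega)
        (u - (u j / z (c, j)) • colProj c z) (by
          intro i hi
          rw [Finsupp.sub_apply, Finsupp.smul_apply, colProj_apply, smul_eq_mul]
          rcases eq_or_ne i j with rfl | hij
          · have : z (c, i) ≠ 0 := by
              rw [hzj, sub_sub_cancel]; exact hy₀o
            field_simp
            simp
          · have : z (c, i) = 0 := by
              rw [hzj]
              by_contra hne
              exact absurd (ho _ ⟨y₀, hy₀, hne⟩) (by omega)
            rw [hu i (by omega), this]
            simp)
      refine ⟨y + (u j / z (c, j)) • z, Z.add_mem hy (Z.smul_mem _ hz), fun i => ?_⟩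
      rw [Finsupp.add_apply, hyu, Finsupp.sub_apply, Finsupp.smul_apply, Finsupp.smul_apply,
        colProj_apply]
      ring

end Columns

/-! ### Charts: sets of coordinates on which the vectors of a subspace can be prescribed -/

section Charts

variable {n : ℕ}

/-- The vectors of `Z` have unique and arbitrary coordinates in the positions `J`. -/
def IsChart (Z : Submodule ℂ (X n)) (J : Set (Fin n × ℤ)) : Prop :=
  (∀ z ∈ Z, (∀ q ∈ J, z q = 0) → z = 0) ∧ ∀ u : X n, ∃ z ∈ Z, ∀ q ∈ J, z q = u q

/-- The positions of order at least `κ i` in the columns `i` with `a ≤ i < b`. -/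
def chartSet (a b : ℕ) (κ : Fin n → ℤ) : Set (Fin n × ℤ) :=
  {q | a ≤ (q.1 : ℕ) ∧ (q.1 : ℕ) < b ∧ κ q.1 ≤ q.2}

theorem mem_chartSet {a b : ℕ} {κ : Fin n → ℤ} {i : Fin n} {j : ℤ} :
    (i, j) ∈ chartSet a b κ ↔ a ≤ (i : ℕ) ∧ (i : ℕ) < b ∧ κ i ≤ j := Iff.rfl

theorem chartSet_eq_union {a b : ℕ} (κ : Fin n → ℤ) (c : Fin n) (hc : (c : ℕ) = a)
    (hcb : (c : ℕ) < b) : chartSet a b κ = chartSet (a + 1) b κ ∪ {q | q.1 = c ∧ κ c ≤ q.2} := by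
  subst hc
  ext ⟨i, j⟩
  simp only [chartSet, Set.mem_ofPred_eq, Set.mem_union]
  constructor
  · rintro ⟨h1, h2, h3⟩
    rcases eq_or_ne i c with rfl | hi
    · exact Or.inr ⟨rfl, h3⟩
    · have : (i : ℕ) ≠ c := fun h => hi (Fin.ext h)
      exact Or.inl ⟨by omega, h2, h3⟩
  · rintro (⟨h1, h2, h3⟩ | ⟨rfl, h2⟩)
    · exact ⟨by omega, h2, h3⟩
    · exact ⟨le_rfl, hcb, h2⟩

/-- The `c`-th column can be prescribed freely from order `o` on, and what is left undetermined is a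
vector with zero `c`-th column, governed by `J`. -/
theorem IsChart.insert_column {Z : Submodule ℂ (X n)} {c : Fin n} {o : ℤ} (h : HasOrd Z c o)
    {J : Set (Fin n × ℤ)} (hJ : IsChart (Z ⊓ LinearMap.ker (colProj c)) J) :
    IsChart Z (J ∪ {q | q.1 = c ∧ o ≤ q.2}) := by
  constructor
  · intro z hz hzJ
    refine hJ.1 z ⟨hz, LinearMap.mem_ker.2 ?_⟩ fun q hq => hzJ q (Or.inl hq)
    ext j
    rw [colProj_apply]
    rcases lt_or_ge j o with hj | hj
    · exact h.eq_zero hz hj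
    · exact hzJ _ (Or.inr ⟨rfl, hj⟩)
  · intro u
    obtain ⟨y, hy, hyu⟩ := h.exists_mem ((colProj c u).filter (fun j => o ≤ j))
      (fun j hj => Finsupp.filter_apply_neg _ _ (by omega))
    obtain ⟨z, hz, hzu⟩ := hJ.2 (u - y)
    refine ⟨y + z, Z.add_mem hy hz.1, ?_⟩
    rintro ⟨i, j⟩ (hq | ⟨hi, hj⟩)
    · rw [Finsupp.add_apply, hzu _ hq, Finsupp.sub_apply]
      ring
    · dsimp only at hi hj
      subst hi
      have hz0 : z (i, j) = 0 := DFunLike.congr_fun (LinearMap.mem_ker.1 hz.2) j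
      rw [Finsupp.add_apply, hz0, hyu, Finsupp.filter_apply_pos _ _ hj, add_zero, colProj_apply]

theorem isChart_bot : IsChart (⊥ : Submodule ℂ (X n)) ∅ :=
  ⟨fun z hz _ => hz, fun _ => ⟨0, Submodule.zero_mem _, by simp⟩⟩

theorem isChart_chartSet {b : ℕ} (hb : b ≤ n) (κ : Fin n → ℤ) (a : ℕ) {Z : Submodule ℂ (X n)}
    (hZ : Z ≤ cols n a b)
    (h : ∀ i : Fin n, a ≤ (i : ℕ) → (i : ℕ) < b → HasOrd (Z ⊓ cols n i b) i (κ i)) :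
    IsChart Z (chartSet a b κ) := by
  induction hd : b - a generalizing a Z with
  | zero =>
    rw [cols_eq_bot (by omega), le_bot_iff] at hZ
    subst hZ
    convert isChart_bot
    ext q
    simp only [chartSet, Set.mem_ofPred_eq, Set.mem_empty_iff_false, iff_false]
    omega
  | succ d ih =>
    let c : Fin n := ⟨a, by omega⟩
    have h1 := inf_ker_colProj_left hZ c rfl
    have h2 := ih (a + 1) (Z := Z ⊓ cols n (a + 1) b) inf_le_right
      (fun i hi hib => by
        rw [inf_cols_inf_cols _ hi le_rfl]
        exact h i (by omega) hib) (by omega)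
    rw [← h1] at h2
    have h3 := h c le_rfl (by change a < b; omega)
    rw [inf_eq_left.2 hZ] at h3
    rw [chartSet_eq_union κ c rfl (by change a < b; omega)]
    exact IsChart.insert_column h3 h2

/-- Here the last column is peeled off first: it is prescribed from its order in all of `Z`, the
others as in the part of `Z` before it. -/
theorem IsChart.insert_right {a : ℕ} {r : Fin n} {Z : Submodule ℂ (X n)} {o : ℤ}
    (hZ : Z ≤ cols n a (r + 1)) (har : a ≤ (r : ℕ)) (h : HasOrd Z r o) {κ : Fin n → ℤ}
    (hκ : IsChart (Z ⊓ cols n a r) (chartSet a r κ)) :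
    IsChart Z (chartSet a (r + 1) fun i => if i = r then o else κ i) := by
  rw [← inf_ker_colProj_right r hZ] at hκ
  convert IsChart.insert_column h hκ using 1
  ext ⟨i, j⟩
  simp only [chartSet, Set.mem_ofPred_eq, Set.mem_union]
  rcases eq_or_ne i r with rfl | hi
  · simp only [if_true, true_and, lt_irrefl, false_and, and_false, false_or]
    omega
  · have : (i : ℕ) ≠ r := fun h => hi (Fin.ext h)
    simp only [hi, if_false, false_and, or_false]
    constructor
    · rintro ⟨h1, h2, h3⟩
      exact ⟨h1, by omega, h3⟩
    · rintro ⟨h1, h2, h3⟩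
      exact ⟨h1, by omega, h3⟩

end Charts

/-! ### Dimensions -/

section Dimensions

variable {n : ℕ}

/-- The dimension of `Z` modulo `t ^ N X₀`. -/
def winDim (N : ℕ) (Z : Submodule ℂ (X n)) : ℕ :=
  Module.finrank ℂ (Z.map (toWindow n N))

theorem IsLat.hasOrd_bounds {N a b : ℕ} {Z : Submodule ℂ (X n)} (h : IsLat N a b Z) {c : Fin n}
    (hca : a ≤ (c : ℕ)) (hcb : (c : ℕ) < b) {o : ℤ} (ho : HasOrd Z c o) : -N ≤ o ∧ o ≤ N := by
  obtain ⟨o', h1, h2, h3⟩ := h.exists_hasOrd c hca hcb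
  rw [ho.unique h3]
  exact ⟨h1, h2⟩

theorem toWindow_apply {N : ℕ} (y : X n) (q : Window n N) : toWindow n N y q = y (q.1, q.2) := rfl

/-- Removing the part above the window. -/
theorem IsLat.exists_window_rep {N a b : ℕ} {Z : Submodule ℂ (X n)} (h : IsLat N a b Z) {z : X n}
    (hz : z ∈ Z) : ∃ y ∈ Z, ∀ i j, y (i, j) = if j < N then z (i, j) else 0 := by
  let u : X n := z.filter (fun q => (N : ℤ) ≤ q.2)
  have hu : ∀ i j, u (i, j) = if (N : ℤ) ≤ j then z (i, j) else 0 := fun i j =>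
    Finsupp.filter_apply _ _ _
  have huZ : u ∈ Z := by
    refine h.lower ⟨mem_level.2 fun i j hj => ?_, mem_cols.2 fun i j hi => ?_⟩
    · rw [hu, if_neg (by omega)]
    · rw [hu, mem_cols.1 (h.le_cols hz) i j hi, ite_self]
  refine ⟨z - u, Z.sub_mem hz huZ, fun i j => ?_⟩
  rw [Finsupp.sub_apply, hu]
  split_ifs <;> first | omega | simp

/-- Rank and nullity of reading off column `c` in the window: the image consists of the free
coordinates in the positions `o ≤ j < N`. -/
theorem IsLat.winDim_eq {N a b : ℕ} {Z : Submodule ℂ (X n)} (h : IsLat N a b Z) {c : Fin n}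
    (hca : a ≤ (c : ℕ)) (hcb : (c : ℕ) < b) {o : ℤ} (ho : HasOrd Z c o) :
    (winDim N Z : ℤ) = winDim N (Z ⊓ LinearMap.ker (colProj c)) + (N - o) := by
  obtain ⟨hoN, hoN'⟩ := h.hasOrd_bounds hca hcb ho
  set W := Z.map (toWindow n N) with hW
  let g : (Window n N → ℂ) →ₗ[ℂ] (↥(Finset.Ico o (N : ℤ)) → ℂ) :=
    LinearMap.funLeft ℂ ℂ fun j => (c, ⟨j, Finset.mem_Ico.2
      ⟨hoN.trans (Finset.mem_Ico.1 j.2).1, (Finset.mem_Ico.1 j.2).2⟩⟩)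
  let f := g.domRestrict W
  have hsurj : LinearMap.range f = ⊤ := by
    rw [LinearMap.range_eq_top]
    intro u
    obtain ⟨y, hy, hyu⟩ := ho.exists_mem
      (Finsupp.onFinset (Finset.Ico o (N : ℤ)) (fun j => if hj : j ∈ Finset.Ico o (N : ℤ) then
        u ⟨j, hj⟩ else 0) (fun j hj => by by_contra h'; simp [h'] at hj))
      (fun j hj => by
        rw [Finsupp.onFinset_apply, dif_neg]
        rw [Finset.mem_Ico]; omega)
    refine ⟨⟨_, Submodule.mem_map_of_mem hy⟩, ?_⟩
    ext ⟨j, hj⟩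
    change y (c, j) = _
    rw [hyu, Finsupp.onFinset_apply, dif_pos hj]
  have hker : (LinearMap.ker f).map W.subtype =
      (Z ⊓ LinearMap.ker (colProj c)).map (toWindow n N) := by
    ext w
    simp only [Submodule.mem_map, LinearMap.mem_ker]
    constructor
    · rintro ⟨⟨w, z, hz, rfl⟩, hw, rfl⟩
      -- The window does not see column `c` from `N` on, so the part of `z` above the window is
      -- discarded first.
      obtain ⟨y, hy, hyz⟩ := h.exists_window_rep hz
      refine ⟨y, ⟨hy, LinearMap.mem_ker.2 ?_⟩, ?_⟩
      · ext j
        rw [colProj_apply]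
        rcases lt_or_ge j o with hj | hj
        · exact ho.eq_zero hy hj
        · rw [hyz]
          split_ifs with hjN
          · exact congrFun hw ⟨j, Finset.mem_Ico.2 ⟨hj, hjN⟩⟩
          · rfl
      · ext ⟨i, j, hj⟩
        change y (i, j) = z (i, j)
        rw [hyz, if_pos (Finset.mem_Ico.1 hj).2]
    · rintro ⟨z, ⟨hz, hz0⟩, rfl⟩
      refine ⟨⟨_, Submodule.mem_map_of_mem hz⟩, ?_, rfl⟩
      ext j
      exact DFunLike.congr_fun (LinearMap.mem_ker.1 hz0) (j : ℤ)
  have hrk := LinearMap.finrank_range_add_finrank_ker f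
  rw [hsurj, finrank_top, Module.finrank_fintype_fun_eq_card, Fintype.card_coe, Int.card_Ico,
    ← Submodule.finrank_map_subtype_eq W (LinearMap.ker f), hker] at hrk
  rw [winDim, winDim, ← hW]
  omega

theorem IsLat.winDim_left {N a b : ℕ} {Z : Submodule ℂ (X n)} (h : IsLat N a b Z) {c : Fin n}
    (hca : (c : ℕ) = a) (hcb : (c : ℕ) < b) {o : ℤ} (ho : HasOrd Z c o) :
    (winDim N Z : ℤ) = winDim N (Z ⊓ cols n (a + 1) b) + (N - o) := by
  rw [h.winDim_eq hca.ge hcb ho, inf_ker_colProj_left h.le_cols c hca]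

theorem IsLat.winDim_right {N a : ℕ} {Z : Submodule ℂ (X n)} {c : Fin n}
    (h : IsLat N a (c + 1) Z) (hca : a ≤ (c : ℕ)) {o : ℤ} (ho : HasOrd Z c o) :
    (winDim N Z : ℤ) = winDim N (Z ⊓ cols n a c) + (N - o) := by
  rw [h.winDim_eq hca (Nat.lt_succ_self _) ho, inf_ker_colProj_right c h.le_cols]

/-- The loops are counted in the same way by their left and by their right ends. -/
theorem IsLat.hasOrd_exchange {N : ℕ} {l r : Fin n} (hlr : l < r) {Z : Submodule ℂ (X n)}
    (h : IsLat N l (r + 1) Z) {o₁ o₂ o₃ o₄ : ℤ} (h₁ : HasOrd Z l o₁)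
    (h₂ : HasOrd (Z ⊓ cols n l r) l o₂) (h₃ : HasOrd Z r o₃)
    (h₄ : HasOrd (Z ⊓ cols n (l + 1) (r + 1)) r o₄) : o₁ + o₄ = o₂ + o₃ := by
  have hlr' : (l : ℕ) < r := hlr
  -- Columns `l` and `r` are peeled off in both orders; the two computations end in the same
  -- intersection, whose dimension cancels.
  have e₁ := h.winDim_left rfl (by omega) h₁
  have e₃ := h.winDim_right (by omega) h₃
  have e₂ := (h.inf_cols le_rfl (Nat.le_succ (r : ℕ))).winDim_left rfl hlr' h₂
  have e₄ := (h.inf_cols (Nat.le_succ (l : ℕ)) le_rfl).winDim_right (by omega) h₄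
  rw [inf_cols_inf_cols _ (by omega) le_rfl] at e₂
  rw [inf_cols_inf_cols _ le_rfl (by omega)] at e₄
  rw [Nat.succ_eq_add_one] at e₄
  omega

theorem vec_mem_iff {Z : Submodule ℂ (X n)} {i : Fin n} {o : ℤ}
    (h : HasOrd (Z ⊓ cols n i (i + 1)) i o) (j : ℤ) : vec i j ∈ Z ↔ o ≤ j := by
  constructor
  · intro hv
    by_contra hj
    have hc : vec i j ∈ cols n i (i + 1) := mem_cols.2 fun i' j' hi' => by
      rw [vec_apply, if_neg]
      rintro ⟨rfl, -⟩
      omega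
    have := h.eq_zero ⟨hv, hc⟩ (j := j) (by omega)
    simp [vec_apply] at this
  · intro hj
    obtain ⟨y, hy, hyu⟩ := h.exists_mem (Finsupp.single j 1)
      (fun j' hj' => Finsupp.single_eq_of_ne (by omega))
    suffices vec i j = y from this ▸ hy.1
    ext ⟨i', j'⟩
    rw [vec_apply]
    rcases eq_or_ne i' i with rfl | hi
    · rw [hyu, Finsupp.single_apply]
      simp [eq_comm]
    · rw [mem_cols.1 hy.2 i' j' (by have : (i' : ℕ) ≠ i := fun h => hi (Fin.ext h)
                                    omega), if_neg (by tauto)]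

theorem delta_eq {Y : Submodule ℂ (X n)} {i : Fin n} {o : ℤ}
    (h : HasOrd (Y ⊓ cols n i (i + 1)) i o) : delta Y i = -o := by
  have : {j : ℤ | vec i (-j) ∈ Y} = Set.Iic (-o) := by
    ext j
    simp only [Set.mem_ofPred_eq, vec_mem_iff h, Set.mem_Iic]
    omega
  rw [delta, this, csSup_Iic]

/-- The span of the basis vectors in the positions `chartSet a b κ`. -/
def blockLat (a b : ℕ) (κ : Fin n → ℤ) : Submodule ℂ (X n) :=
  Finsupp.supported ℂ ℂ (chartSet a b κ)

theorem mem_blockLat {a b : ℕ} {κ : Fin n → ℤ} {y : X n} : y ∈ blockLat a b κ ↔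
    ∀ (i : Fin n) (j : ℤ), ¬ (a ≤ (i : ℕ) ∧ (i : ℕ) < b ∧ κ i ≤ j) → y (i, j) = 0 := by
  rw [blockLat, Finsupp.mem_supported']
  simp only [chartSet, Prod.forall, Set.mem_ofPred_eq]

theorem blockLat_inf_cols {a b a' b' : ℕ} (ha : a ≤ a') (hb : b' ≤ b) (κ : Fin n → ℤ) :
    blockLat a b κ ⊓ cols n a' b' = blockLat a' b' κ := by
  ext y
  rw [Submodule.mem_inf, mem_blockLat, mem_cols, mem_blockLat]
  constructor
  · rintro ⟨h1, h2⟩ i j h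
    by_cases hi : a' ≤ (i : ℕ) ∧ (i : ℕ) < b'
    · exact h1 i j fun h' => h ⟨hi.1, hi.2, h'.2.2⟩
    · exact h2 i j hi
  · intro h
    exact ⟨fun i j hi => h i j fun h' => hi ⟨by omega, by omega, h'.2.2⟩,
      fun i j hi => h i j fun h' => hi ⟨h'.1, h'.2.1⟩⟩

theorem hasOrd_blockLat {a b : ℕ} (κ : Fin n → ℤ) {c : Fin n} (hca : a ≤ (c : ℕ))
    (hcb : (c : ℕ) < b) : HasOrd (blockLat a b κ) c (κ c) := by
  rw [hasOrd_iff]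
  constructor
  · intro y hy j hj
    exact mem_blockLat.1 hy c j (by omega)
  · intro u hu
    refine ⟨colIncl c u, mem_blockLat.2 fun i j h => ?_, fun j => by simp [colIncl_apply]⟩
    rw [colIncl_apply]
    split_ifs with hi
    · subst hi
      exact hu j (by omega)
    · rfl

theorem isLat_blockLat {N a b : ℕ} {κ : Fin n → ℤ}
    (h : ∀ i : Fin n, a ≤ (i : ℕ) → (i : ℕ) < b → -N ≤ κ i ∧ κ i ≤ N) :
    IsLat N a b (blockLat a b κ) where
  stable y hy := by
    rw [mem_blockLat] at hy ⊢
    intro i j h'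
    rw [t_apply]
    exact hy i _ (by omega)
  le_cols y hy := by
    rw [mem_blockLat] at hy
    exact mem_cols.2 fun i j h' => hy i j (by omega)
  lower y hy := by
    rw [Submodule.mem_inf, mem_level, mem_cols] at hy
    refine mem_blockLat.2 fun i j h' => ?_
    by_cases hi : a ≤ (i : ℕ) ∧ (i : ℕ) < b
    · exact hy.1 i j (by have := h i hi.1 hi.2; omega)
    · exact hy.2 i j hi
  upper y hy := by
    rw [mem_blockLat] at hy
    refine mem_level.2 fun i j h' => hy i j ?_
    rintro ⟨h1, h2, h3⟩
    have := h i h1 h2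
    omega

theorem fixedPart_eq_blockLat {N a b : ℕ} {Z : Submodule ℂ (X n)} (hZ : IsLat N a b Z)
    {κ : Fin n → ℤ} (h : ∀ i : Fin n, a ≤ (i : ℕ) → (i : ℕ) < b →
      HasOrd (Z ⊓ cols n i (i + 1)) i (κ i)) : fixedPart Z = blockLat a b κ := by
  rw [blockLat, Finsupp.supported_eq_span_single, fixedPart]
  congr 1
  ext y
  constructor
  · rintro ⟨hy, i, j, rfl⟩
    have hi : a ≤ (i : ℕ) ∧ (i : ℕ) < b := by
      by_contra hi
      have := mem_cols.1 (hZ.le_cols hy) i j hi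
      simp [vec_apply] at this
    exact ⟨(i, j), ⟨hi.1, hi.2, (vec_mem_iff (h i hi.1 hi.2) j).1 hy⟩, rfl⟩
  · rintro ⟨⟨i, j⟩, ⟨h1, h2, h3⟩, rfl⟩
    exact ⟨(vec_mem_iff (h i h1 h2) j).2 h3, i, j, rfl⟩

/-- Since `W` contains the vectors of `Z` killed by `f`, the quotient of `Z` by `W` is that of the
images. This moves a relative dimension in an infinite-dimensional space to a finite-dimensional
one. -/
theorem relDim_add_finrank_map {V V' : Type} [AddCommGroup V] [Module ℂ V] [AddCommGroup V']
    [Module ℂ V'] [FiniteDimensional ℂ V'] (f : V →ₗ[ℂ] V') {Z W : Submodule ℂ V} (hWZ : W ≤ Z)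
    (hf : Z ⊓ LinearMap.ker f ≤ W) :
    relDim Z W + Module.finrank ℂ (W.map f) = Module.finrank ℂ (Z.map f) := by
  let g : Z →ₗ[ℂ] Z.map f ⧸ (W.map f).submoduleOf (Z.map f) :=
    (Submodule.mkQ _).comp (f.submoduleMap Z)
  have hg : Function.Surjective g :=
    (Submodule.mkQ_surjective _).comp (f.submoduleMap_surjective Z)
  have hker : LinearMap.ker g = W.submoduleOf Z := by
    ext ⟨z, hz⟩
    rw [LinearMap.mem_ker, LinearMap.comp_apply, Submodule.mkQ_apply,
      Submodule.Quotient.mk_eq_zero, Submodule.submoduleOf, Submodule.mem_comap,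
      Submodule.submoduleOf, Submodule.mem_comap]
    change f z ∈ W.map f ↔ z ∈ W
    refine ⟨?_, fun h => Submodule.mem_map_of_mem h⟩
    rintro ⟨w, hw, hwz⟩
    have : z - w ∈ W := hf ⟨Z.sub_mem hz (hWZ hw), by simp [hwz]⟩
    simpa using W.add_mem this hw
  have e := (LinearMap.quotKerEquivOfSurjective g hg).finrank_eq
  rw [hker] at e
  rw [relDim, e, ← (Submodule.submoduleOfEquivOfLe (Submodule.map_mono (f := f) hWZ)).finrank_eq]
  exact Submodule.finrank_quotient_add_finrank _

/-- The fixed part is spanned by the basis vectors from the single-column orders on. These orders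
are at most `N`, so it contains all vectors of `Z` that vanish in the window, and the quotient can
be measured there. -/
theorem IsLat.dim0_add_winDim {N a b : ℕ} {Z : Submodule ℂ (X n)} (hZ : IsLat N a b Z)
    {κ : Fin n → ℤ} (h : ∀ i : Fin n, a ≤ (i : ℕ) → (i : ℕ) < b →
      HasOrd (Z ⊓ cols n i (i + 1)) i (κ i)) :
    dim0 Z + winDim N (blockLat a b κ) = winDim N Z := by
  rw [dim0, ← fixedPart_eq_blockLat hZ h]
  refine relDim_add_finrank_map _ (Submodule.span_le.2 fun y hy => hy.1) ?_
  rw [fixedPart_eq_blockLat hZ h]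
  rintro z ⟨hz, hz0⟩
  have hz0' := LinearMap.mem_ker.1 hz0
  refine mem_blockLat.2 fun i j hij => ?_
  rcases lt_or_ge j (-N : ℤ) with hj | hj
  · exact mem_level.1 (hZ.upper hz) i j hj
  rcases lt_or_ge j (N : ℤ) with hj' | hj'
  · exact congrFun hz0' (i, ⟨j, Finset.mem_Ico.2 ⟨hj, hj'⟩⟩)
  · refine mem_cols.1 (hZ.le_cols hz) i j fun hi => hij ⟨hi.1, hi.2, ?_⟩
    have := (hZ.inf_cols hi.1 hi.2 : IsLat N i (i + 1) _).hasOrd_bounds le_rfl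
      (Nat.lt_succ_self _) (h i hi.1 hi.2)
    omega

/-- Dropping column `l` from an interval lowers `dim0` by the single-column order `κ l` minus the
order of column `l` in that interval. For the two right ends in question the `κ l` cancel. -/
theorem loopNumber_eq {N : ℕ} {Y : Submodule ℂ (X n)} (hY : IsLat N 0 n Y) (L : Root n)
    {o₁ o₂ : ℤ} (h₁ : HasOrd (Y ⊓ cols n L.left (L.right + 1)) L.left o₁)
    (h₂ : HasOrd (Y ⊓ cols n L.left L.right) L.left o₂) : loopNumber Y L = o₂ - o₁ := by
  have hlr : (L.left : ℕ) < L.right := L.2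
  have hrn := L.right.2
  choose κ _ _ hκ using fun i : Fin n => (hY.inf_cols (Nat.zero_le i) i.2).exists_hasOrd i
    le_rfl (Nat.lt_succ_self (i : ℕ))
  have hlat : ∀ a b, b ≤ n → IsLat N a b (Y ⊓ cols n a b) := fun a b hb =>
    hY.inf_cols (Nat.zero_le a) hb
  have hdim : ∀ a b, b ≤ n → dim0 (Y ⊓ cols n a b) + winDim N (blockLat a b κ) =
      winDim N (Y ⊓ cols n a b) := fun a b hb =>
    (hlat a b hb).dim0_add_winDim fun i ha hi => by
      rw [inf_cols_inf_cols _ ha hi]; exact hκ i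
  have hblock : ∀ a b, b ≤ n → IsLat N a b (blockLat a b κ) := fun a b hb =>
    isLat_blockLat fun i _ _ =>
      (hlat i (i + 1) i.2).hasOrd_bounds le_rfl (Nat.lt_succ_self _) (hκ i)
  have e₁ := (hlat L.left (L.right + 1) hrn).winDim_left rfl (by omega) h₁
  have e₂ := (hlat L.left L.right (by omega)).winDim_left rfl (by omega) h₂
  have f₁ := (hblock L.left (L.right + 1) hrn).winDim_left rfl (by omega)
    (hasOrd_blockLat κ le_rfl (by omega))
  have f₂ := (hblock L.left L.right (by omega)).winDim_left rfl (by omega)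
    (hasOrd_blockLat κ le_rfl (by omega))
  rw [inf_cols_inf_cols _ (by omega) le_rfl] at e₁ e₂
  rw [blockLat_inf_cols (by omega) le_rfl] at f₁ f₂
  rw [loopNumber]
  simp only [columns_eq_cols]
  -- The right end exceeds the left one, so the truncated subtraction is exact.
  rw [Nat.sub_add_cancel (by omega : 1 ≤ (L.right : ℕ))]
  have d₁ := hdim L.left (L.right + 1) hrn
  have d₂ := hdim (L.left + 1) (L.right + 1) hrn
  have d₃ := hdim L.left L.right (by omega)
  have d₄ := hdim (L.left + 1) L.right (by omega)
  omega

end Dimensions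

/-! ### The pieces in terms of orders -/

section Pieces

variable {n : ℕ}

/-- The number of loops with left end `a` and right end `b`. -/
def loops (p : Picture n) (a b : ℕ) : ℕ :=
  if h : a < b ∧ b < n then p ⟨(⟨a, h.1.trans h.2⟩, ⟨b, h.2⟩), h.1⟩ else 0

theorem loops_root (p : Picture n) (L : Root n) : loops p L.left L.right = p L := by
  have : (L.left : ℕ) < L.right ∧ (L.right : ℕ) < n := ⟨L.2, L.right.2⟩
  rw [loops, dif_pos this]

/-- The order of the `i`-th columns in `Y ∩ (V_i ⊕ … ⊕ V_(b-1))`, for `Y` in a piece. -/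
def leftOrd (p : Picture n) (lam : Fin n → ℤ) (b : ℕ) (i : Fin n) : ℤ :=
  leftCount p i - lam i - ∑ k ∈ Finset.Ico ((i : ℕ) + 1) b, (loops p i k : ℤ)

/-- The order of the `r`-th columns in `Y ∩ (V_a ⊕ … ⊕ V_r)`, for `Y` in a piece. -/
def rightOrd (p : Picture n) (lam : Fin n → ℤ) (a : ℕ) (r : Fin n) : ℤ :=
  leftCount p r - lam r - ∑ k ∈ Finset.Ico a (r : ℕ), (loops p k r : ℤ)

variable {p : Picture n} {lam : Fin n → ℤ}

theorem leftOrd_self (i : Fin n) : leftOrd p lam (i + 1) i = leftCount p i - lam i := by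
  simp [leftOrd]

theorem rightOrd_self (i : Fin n) : rightOrd p lam i i = leftCount p i - lam i := by
  simp [rightOrd]

theorem leftOrd_succ {i : Fin n} {r : ℕ} (h : (i : ℕ) < r) :
    leftOrd p lam (r + 1) i = leftOrd p lam r i - loops p i r := by
  rw [leftOrd, leftOrd, Finset.sum_Ico_succ_top h]
  ring

theorem rightOrd_of_lt {a : ℕ} {r : Fin n} (h : a < r) :
    rightOrd p lam a r = rightOrd p lam (a + 1) r - loops p a r := by
  rw [rightOrd, rightOrd, Finset.sum_eq_sum_Ico_succ_bot h]
  ring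

/-- The conditions on `Y ∩ (V_a ⊕ … ⊕ V_(b-1))` for `Y` in a piece. -/
structure PieceOn (p : Picture n) (lam : Fin n → ℤ) (a b : ℕ) (Z : Submodule ℂ (X n)) : Prop where
  isLat : ∃ N, IsLat N a b Z
  left : ∀ (i : Fin n) (c : ℕ), a ≤ (i : ℕ) → (i : ℕ) < c → c ≤ b →
    HasOrd (Z ⊓ cols n i c) i (leftOrd p lam c i)

/-- The coweight fixes the order of each single column, and each loop number fixes the drop when one
more column is allowed on the right. -/
theorem mem_piece_iff {Y : Submodule ℂ (X n)} : Y ∈ piece p lam ↔ PieceOn p lam 0 n Y := by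
  constructor
  · rintro ⟨hY, hloop, hlam⟩
    refine ⟨isLattice_iff.1 hY, ?_⟩
    obtain ⟨N, hN⟩ := isLattice_iff.1 hY
    intro i c _ hic
    induction c, hic using Nat.le_induction with
    | base =>
      intro hi
      obtain ⟨o, -, -, ho⟩ := (hN.inf_cols (Nat.zero_le i) hi).exists_hasOrd i le_rfl
        (Nat.lt_succ_self _)
      have h1 := hlam i
      rw [delta_eq ho] at h1
      rw [Nat.succ_eq_add_one, leftOrd_self]
      convert ho using 1
      omega
    | succ c hic ih =>
      intro hc
      obtain ⟨o, -, -, ho⟩ := (hN.inf_cols (Nat.zero_le i) hc).exists_hasOrd i le_rfl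
        (by omega)
      let L : Root n := ⟨(i, ⟨c, by omega⟩), hic⟩
      have h1 := loopNumber_eq hN L ho (ih (by omega))
      rw [hloop L, ← loops_root p L] at h1
      rw [leftOrd_succ hic]
      convert ho using 1
      change (loops p i c : ℤ) = _ at h1
      omega
  · rintro ⟨hlat, hleft⟩
    obtain ⟨N, hN⟩ := hlat
    refine ⟨isLattice_iff.2 ⟨N, hN⟩, fun L => ?_, fun i => ?_⟩
    · have hlr : (L.left : ℕ) < L.right := L.2
      rw [loopNumber_eq hN L (hleft L.left (L.right + 1) (Nat.zero_le _) (by omega) L.right.2)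
        (hleft L.left L.right (Nat.zero_le _) hlr L.right.2.le), leftOrd_succ hlr, loops_root]
      ring
    · rw [delta_eq (hleft i (i + 1) (Nat.zero_le _) (Nat.lt_succ_self _) i.2), leftOrd_self]
      ring

theorem PieceOn.inf_cols {a b a' b' : ℕ} {Z : Submodule ℂ (X n)} (h : PieceOn p lam a b Z)
    (ha : a ≤ a') (hb : b' ≤ b) : PieceOn p lam a' b' (Z ⊓ cols n a' b') := by
  obtain ⟨⟨N, hN⟩, hl⟩ := h
  refine ⟨⟨N, hN.inf_cols ha hb⟩, fun i c hi hic hc => ?_⟩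
  rw [inf_cols_inf_cols _ hi hc]
  exact hl i c (by omega) hic (by omega)

theorem PieceOn.le_cols {a b : ℕ} {Z : Submodule ℂ (X n)} (h : PieceOn p lam a b Z) :
    Z ≤ cols n a b := by
  obtain ⟨N, hN⟩ := h.isLat
  exact hN.le_cols

theorem PieceOn.stable {a b : ℕ} {Z : Submodule ℂ (X n)} (h : PieceOn p lam a b Z) :
    ∀ y ∈ Z, t n y ∈ Z := by
  obtain ⟨N, hN⟩ := h.isLat
  exact hN.stable

/-- By `IsLat.hasOrd_exchange`, allowing column `a'` on the left lowers the order of column `r` by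
the same number of loops as allowing column `r` lowers that of column `a'`. -/
theorem PieceOn.right {a b : ℕ} {Z : Submodule ℂ (X n)} (h : PieceOn p lam a b Z) {r : Fin n}
    (hr : (r : ℕ) < b) {a' : ℕ} (ha : a ≤ a') (ha' : a' ≤ r) :
    HasOrd (Z ⊓ cols n a' (r + 1)) r (rightOrd p lam a' r) := by
  obtain ⟨N, hN⟩ := h.isLat
  induction hd : (r : ℕ) - a' generalizing a' with
  | zero =>
    obtain rfl : a' = r := by omega
    rw [rightOrd_self, ← leftOrd_self]
    exact h.left r _ ha (Nat.lt_succ_self _) hr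
  | succ d ih =>
    have har : a' < r := by omega
    let l : Fin n := ⟨a', har.trans r.2⟩
    have hlr : l < r := har
    have hl := hN.inf_cols (b' := r + 1) ha hr
    obtain ⟨o, -, -, ho⟩ := hl.exists_hasOrd r ha' (Nat.lt_succ_self _)
    have h1 := h.left l (r + 1) ha (by change a' < _; omega) hr
    have h2 := h.left l r ha har (by omega)
    have h4 := ih (a' := a' + 1) (by omega) har (by omega)
    have := IsLat.hasOrd_exchange (l := l) hlr hl h1
      (by rw [inf_cols_inf_cols _ le_rfl (Nat.le_succ _)]; exact h2) ho
      (by rw [inf_cols_inf_cols _ (Nat.le_succ _) le_rfl]; exact h4)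
    rw [leftOrd_succ (i := l) har] at this
    rw [rightOrd_of_lt har]
    convert ho using 1
    change leftOrd p lam r l - loops p a' r + _ = _ at this
    omega

theorem PieceOn.isChart {a b : ℕ} {Z : Submodule ℂ (X n)} (h : PieceOn p lam a b Z) (hb : b ≤ n) :
    IsChart Z (chartSet a b (leftOrd p lam b)) :=
  isChart_chartSet hb _ a h.le_cols fun i hi hib => h.left i b hi hib le_rfl

end Pieces

/-! ### Generators of the intersections with intervals of columns -/

section Generators

variable {n : ℕ} {p : Picture n} {lam : Fin n → ℤ}

/-- The vector `∑ j, u j • t ^ (j - o) v`. -/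
def comb (v : X n) (o : ℤ) : (ℤ →₀ ℂ) →ₗ[ℂ] X n :=
  Finsupp.linearCombination ℂ fun j => sh n (j - o) v

theorem comb_mem {Z : Submodule ℂ (X n)} (hZ : ∀ y ∈ Z, t n y ∈ Z) {v : X n} (hv : v ∈ Z) {o : ℤ}
    {u : ℤ →₀ ℂ} (hu : ∀ j < o, u j = 0) : comb v o u ∈ Z := by
  rw [comb, Finsupp.linearCombination_apply]
  refine Z.sum_mem fun j hj => Z.smul_mem _ (sh_mem hZ ?_ hv)
  by_contra hlt
  exact Finsupp.mem_support_iff.1 hj (hu j (by omega))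

theorem colProj_comb {v : X n} {o : ℤ} {l : Fin n}
    (hv : ∀ j, v (l, j) = if j = o then 1 else 0) (u : ℤ →₀ ℂ) : colProj l (comb v o u) = u := by
  suffices (colProj l).comp (comb v o) = LinearMap.id from LinearMap.congr_fun this u
  ext j j'
  rw [LinearMap.comp_apply, LinearMap.comp_apply, comb, Finsupp.lsingle_apply,
    Finsupp.linearCombination_single, one_smul, colProj_apply, sh_apply, hv]
  simp only [LinearMap.id_comp, Finsupp.lsingle_apply, Finsupp.single_apply]
  refine if_congr ?_ rfl rfl
  omega

theorem t_comb (v : X n) (o : ℤ) (u : ℤ →₀ ℂ) :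
    t n (comb v o u) = comb v o (Finsupp.lmapDomain ℂ ℂ (· + 1) u) := by
  suffices (t n).comp (comb v o) = (comb v o).comp (Finsupp.lmapDomain ℂ ℂ (· + 1)) from
    LinearMap.congr_fun this u
  ext j : 2
  simp only [LinearMap.comp_apply, Finsupp.lsingle_apply, Finsupp.lmapDomain_apply,
    Finsupp.mapDomain_single, comb, Finsupp.linearCombination_single, one_smul]
  rw [t_eq_sh, sh_sh]
  congr 2
  ring

theorem level_stable (m : ℤ) : ∀ y ∈ level n m, t n y ∈ level n m := by
  intro y hy
  rw [mem_level] at hy ⊢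
  intro i j hj
  rw [t_apply]
  exact hy i _ (by omega)

theorem exists_mem_level (v : X n) : ∃ m : ℤ, v ∈ level n m := by
  obtain ⟨m, hm⟩ := (v.support.image Prod.snd).bddBelow
  refine ⟨m, mem_level.2 fun i j hj => ?_⟩
  by_contra hne
  have := hm (Finset.mem_coe.2 (Finset.mem_image_of_mem Prod.snd (Finsupp.mem_support_iff.2 hne)))
  dsimp only at this
  omega

/-- The orders for the chart of `Y ∩ (V_(l+1) ⊕ … ⊕ V_r)` that starts with its last column. -/
def mixOrd (p : Picture n) (lam : Fin n → ℤ) (l r : Fin n) (i : Fin n) : ℤ :=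
  if i = r then rightOrd p lam (l + 1) r else leftOrd p lam r i

theorem PieceOn.isChart_mixOrd {l r : Fin n} (hlr : l < r) {B : Submodule ℂ (X n)}
    (hB : PieceOn p lam (l + 1) (r + 1) B) :
    IsChart B (chartSet (l + 1) (r + 1) (mixOrd p lam l r)) := by
  have hlr' : (l : ℕ) < r := hlr
  have h1 := hB.right (Nat.lt_succ_self _) le_rfl hlr'
  rw [inf_eq_left.2 hB.le_cols] at h1
  exact IsChart.insert_right hB.le_cols hlr' h1
    ((hB.inf_cols le_rfl (Nat.le_succ _)).isChart r.2.le)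

/-- The normalized vector of order `leftOrd p lam r l - s` in the `l`-th column. -/
structure IsGen (p : Picture n) (lam : Fin n → ℤ) (Z : Submodule ℂ (X n)) (l r : Fin n) (s : ℕ)
    (y : X n) : Prop where
  mem : y ∈ Z
  col : ∀ j, y (l, j) = if j = leftOrd p lam r l - s then 1 else 0
  zero : ∀ i j, l < i → i ≤ r → mixOrd p lam l r i ≤ j → y (i, j) = 0

variable {l r : Fin n} {Z : Submodule ℂ (X n)}

theorem mem_cols_succ {a b : ℕ} {l : Fin n} (hl : (l : ℕ) = a) {y : X n} (hy : y ∈ cols n a b)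
    (h : ∀ j, y (l, j) = 0) : y ∈ cols n (a + 1) b := by
  rw [mem_cols] at hy ⊢
  intro i j hi
  by_cases hil : i = l
  · rw [hil, h]
  · exact hy i j fun h' => hi ⟨by have : (i : ℕ) ≠ l := fun h => hil (Fin.ext h)
                                  omega, h'.2⟩

theorem mem_cols_of_col_eq_zero {a : ℕ} {r : Fin n} {y : X n} (hy : y ∈ cols n a (r + 1))
    (h : ∀ j, y (r, j) = 0) : y ∈ cols n a r := by
  rw [mem_cols] at hy ⊢
  intro i j hi
  by_cases hil : i = r
  · rw [hil, h]
  · exact hy i j fun h' => hi ⟨h'.1, by have : (i : ℕ) ≠ r := fun h => hil (Fin.ext h)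
                                        omega⟩

/-- The difference of two candidates has zero `l`-th column, so it lies in the part without column
`l`, and it vanishes on a chart of that part. -/
theorem IsGen.unique (hlr : l < r) (hZ : PieceOn p lam l (r + 1) Z) {s : ℕ} {y y' : X n}
    (hy : IsGen p lam Z l r s y) (hy' : IsGen p lam Z l r s y') : y = y' := by
  rw [← sub_eq_zero]
  have hB := (hZ.inf_cols (Nat.le_succ _) le_rfl).isChart_mixOrd hlr
  refine hB.1 _ ⟨Z.sub_mem hy.mem hy'.mem, mem_cols_succ rfl
    (hZ.le_cols (Z.sub_mem hy.mem hy'.mem)) fun j => ?_⟩ ?_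
  · rw [Finsupp.sub_apply, hy.col, hy'.col, sub_self]
  · rintro ⟨i, j⟩ ⟨h1, h2, h3⟩
    rw [Finsupp.sub_apply, hy.zero i j h1 (Nat.lt_succ_iff.1 h2) h3,
      hy'.zero i j h1 (Nat.lt_succ_iff.1 h2) h3, sub_self]

/-- The bound on `s` keeps the leading exponent at or above the order of column `l` in `Z`.
Normalization subtracts the vector without column `l` that has the same chart coordinates. -/
theorem PieceOn.exists_isGen (hlr : l < r) (hZ : PieceOn p lam l (r + 1) Z) {s : ℕ}
    (hs : s ≤ loops p l r) : ∃ y, IsGen p lam Z l r s y := by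
  have hlr' : (l : ℕ) < r := hlr
  have hB := (hZ.inf_cols (Nat.le_succ _) le_rfl).isChart_mixOrd hlr
  have ho := hZ.left l (r + 1) le_rfl (by omega) le_rfl
  rw [inf_eq_left.2 hZ.le_cols, leftOrd_succ hlr'] at ho
  obtain ⟨y, hy, hyu⟩ := ho.exists_mem (Finsupp.single (leftOrd p lam r l - s) 1)
    (fun j hj => Finsupp.single_eq_of_ne (by omega))
  obtain ⟨z, ⟨hz, hz'⟩, hzu⟩ := hB.2 y
  refine ⟨y - z, Z.sub_mem hy hz, fun j => ?_, fun i j h1 h2 h3 => ?_⟩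
  · rw [Finsupp.sub_apply, hyu, mem_cols.1 hz' l j (by omega), Finsupp.single_apply, sub_zero]
    exact if_congr eq_comm rfl rfl
  · have h1' : (l : ℕ) + 1 ≤ i := h1
    have h2' : (i : ℕ) < r + 1 := Nat.lt_succ_of_le h2
    rw [Finsupp.sub_apply, hzu (i, j) ⟨h1', h2', h3⟩, sub_self]

/-- The generator with `s = 0` lives in the columns before `r`. -/
theorem IsGen.mem_cols_of_zero (hlr : l < r) (hZ : PieceOn p lam l (r + 1) Z) {y : X n}
    (hy : IsGen p lam Z l r 0 y) : y ∈ cols n l r := by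
  have hlr' : (l : ℕ) < r := hlr
  have hA := hZ.inf_cols (b' := r) le_rfl (Nat.le_succ _)
  have hch := (hA.inf_cols (Nat.le_succ _) le_rfl).isChart r.2.le
  have ho := hA.left l r le_rfl hlr' le_rfl
  rw [inf_eq_left.2 hA.le_cols] at ho
  obtain ⟨x, hx, hxu⟩ := ho.exists_mem (Finsupp.single (leftOrd p lam r l) 1)
    (fun j hj => Finsupp.single_eq_of_ne (by omega))
  obtain ⟨z, ⟨hz, hz'⟩, hzu⟩ := hch.2 x
  -- A normalized vector built inside the columns before `r` satisfies the same conditions, since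
  -- off column `r` the orders `mixOrd` are those of its chart; uniqueness then applies.
  have hg : IsGen p lam Z l r 0 (x - z) := by
    refine ⟨Z.sub_mem hx.1 hz.1, fun j => ?_, fun i j h1 h2 h3 => ?_⟩
    · rw [Finsupp.sub_apply, hxu, mem_cols.1 hz' l j (by omega), Finsupp.single_apply, sub_zero,
        Nat.cast_zero, sub_zero]
      exact if_congr eq_comm rfl rfl
    · have h1' : (l : ℕ) + 1 ≤ i := h1
      have h2' : (i : ℕ) ≤ r := h2
      rw [Finsupp.sub_apply]
      rcases eq_or_ne i r with hir | hir
      · rw [mem_cols.1 hx.2 i j (by rw [hir]; omega), mem_cols.1 hz' i j (by rw [hir]; omega),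
          sub_self]
      · have : (i : ℕ) ≠ r := fun h => hir (Fin.ext h)
        rw [mixOrd, if_neg hir] at h3
        rw [hzu (i, j) ⟨h1', lt_of_le_of_ne h2' this, h3⟩, sub_self]
  rw [hy.unique hlr hZ hg]
  exact (cols n l r).sub_mem hx.2 hz.2

/-- Consecutive generators differ by a shift and an element of `Y ∩ (V_(l+1) ⊕ … ⊕ V_r)`. -/
theorem IsGen.t_sub_mem (hZ : PieceOn p lam l (r + 1) Z) {s : ℕ}
    {y y' : X n} (hy : IsGen p lam Z l r s y) (hy' : IsGen p lam Z l r (s + 1) y') :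
    t n y' - y ∈ Z ⊓ cols n (l + 1) (r + 1) := by
  have h := Z.sub_mem (hZ.stable _ hy'.mem) hy.mem
  refine ⟨h, mem_cols_succ rfl (hZ.le_cols h) fun j => ?_⟩
  rw [Finsupp.sub_apply, t_apply, hy.col, hy'.col, sub_eq_zero]
  refine if_congr ?_ rfl rfl
  push_cast
  omega

/-- Multiplication by `t` moves just one position per column into the chart. So one number per
column, the coordinate just below the chart, contains all the information in `t y' - y`. -/
theorem IsGen.t_sub_apply {s : ℕ} {y y' : X n} (hy : IsGen p lam Z l r s y)
    (hy' : IsGen p lam Z l r (s + 1) y') {i : Fin n} {j : ℤ} (h1 : l < i) (h2 : i ≤ r)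
    (h3 : mixOrd p lam l r i ≤ j) : (t n y' - y) (i, j) =
      if j = mixOrd p lam l r i then y' (i, mixOrd p lam l r i - 1) else 0 := by
  rw [Finsupp.sub_apply, t_apply, hy.zero i j h1 h2 h3, sub_zero]
  split_ifs with h
  · rw [h]
  · exact hy'.zero i _ h1 h2 (by omega)

theorem mixOrd_right : mixOrd p lam l r r = rightOrd p lam (l + 1) r := if_pos rfl

/-- Otherwise the `r`-th column of the first generator vanishes below, at and above the order of the
smaller lattice. The generator then lies in the columns before `r`, where column `l` cannot have
order `leftOrd p lam r l - 1`. -/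
theorem IsGen.apply_ne_zero (hlr : l < r) (hZ : PieceOn p lam l (r + 1) Z) {y : X n}
    (hy : IsGen p lam Z l r 1 y) : y (r, mixOrd p lam l r r - 1) ≠ 0 := by
  have hlr' : (l : ℕ) < r := hlr
  intro h0
  obtain ⟨y₀, hy₀⟩ := hZ.exists_isGen hlr (Nat.zero_le _)
  have hc := hy₀.mem_cols_of_zero hlr hZ
  have hB := (hZ.inf_cols (Nat.le_succ _) le_rfl).right (r := r) (Nat.lt_succ_self _) le_rfl hlr'
  rw [inf_cols_inf_cols _ le_rfl le_rfl] at hB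
  have hr : ∀ j, y (r, j) = 0 := by
    intro j
    have h1 : (t n y - y₀) (r, j + 1) = y (r, j) := by
      rw [Finsupp.sub_apply, t_apply, mem_cols.1 hc r _ (by omega), sub_zero, add_sub_cancel_right]
    rw [← h1]
    rcases lt_or_ge (j + 1) (rightOrd p lam (l + 1) r) with hj | hj
    · exact hB.eq_zero (hy₀.t_sub_mem hZ hy) hj
    · rw [← mixOrd_right (p := p)] at hj
      rw [hy₀.t_sub_apply hy hlr le_rfl hj, h0, ite_self]
  have hA := hZ.left l r le_rfl hlr' (Nat.le_succ _)
  have := hA.eq_zero ⟨hy.mem, mem_cols_of_col_eq_zero (hZ.le_cols hy.mem) hr⟩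
    (j := leftOrd p lam r l - 1) (by omega)
  rw [hy.col, if_pos (by simp)] at this
  exact one_ne_zero this

/-- Induction on `s`: with equal predecessors, the vectors `t y - g_s` lie in the common part
without column `l` and have equal chart coordinates, and `t` is injective. -/
theorem IsGen.eq_of_coords (hlr : l < r) {Z Z' : Submodule ℂ (X n)}
    (hZ : PieceOn p lam l (r + 1) Z) (hZ' : PieceOn p lam l (r + 1) Z')
    (hA : Z ⊓ cols n l r = Z' ⊓ cols n l r)
    (hB : Z ⊓ cols n (l + 1) (r + 1) = Z' ⊓ cols n (l + 1) (r + 1))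
    (hco : ∀ s < loops p l r, ∃ y y', IsGen p lam Z l r (s + 1) y ∧ IsGen p lam Z' l r (s + 1) y' ∧
      ∀ i, l < i → i ≤ r → y (i, mixOrd p lam l r i - 1) = y' (i, mixOrd p lam l r i - 1))
    {s : ℕ} (hs : s ≤ loops p l r) {y y' : X n} (hy : IsGen p lam Z l r s y)
    (hy' : IsGen p lam Z' l r s y') : y = y' := by
  induction s generalizing y y' with
  | zero =>
    have h1 : y ∈ Z ⊓ cols n l r := ⟨hy.mem, hy.mem_cols_of_zero hlr hZ⟩
    rw [hA] at h1
    exact IsGen.unique hlr hZ' ⟨h1.1, hy.col, hy.zero⟩ hy'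
  | succ s ih =>
    obtain ⟨x, hx⟩ := hZ.exists_isGen hlr (s := s) (by omega)
    obtain ⟨x', hx'⟩ := hZ'.exists_isGen hlr (s := s) (by omega)
    obtain ⟨w, w', hw, hw', hww⟩ := hco s (by omega)
    obtain rfl := hw.unique hlr hZ hy
    obtain rfl := hw'.unique hlr hZ' hy'
    obtain rfl := ih (by omega) hx hx'
    have hch := (hZ.inf_cols (Nat.le_succ _) le_rfl).isChart_mixOrd hlr
    have h1 := hx.t_sub_mem hZ hw
    have h2 := hx'.t_sub_mem hZ' hw'
    rw [← hB] at h2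
    have h3 := hch.1 _ (Submodule.sub_mem _ h1 h2) (by
      rintro ⟨i, j⟩ ⟨h1, h2, h3⟩
      rw [Finsupp.sub_apply, hx.t_sub_apply hw h1 (Nat.lt_succ_iff.1 h2) h3,
        hx'.t_sub_apply hw' h1 (Nat.lt_succ_iff.1 h2) h3,
          hww i h1 (Nat.lt_succ_iff.1 h2), sub_self])
    rw [sub_sub_sub_cancel_right, sub_eq_zero, t_eq_sh, t_eq_sh] at h3
    exact (sh n 1).injective h3

/-- Every vector is a combination of the last generator and of `Y ∩ (V_(l+1) ⊕ … ⊕ V_r)`. -/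
theorem IsGen.sub_comb_mem (hlr : l < r) (hZ : PieceOn p lam l (r + 1) Z) {g : X n}
    (hg : IsGen p lam Z l r (loops p l r) g) {y : X n} (hy : y ∈ Z) :
    (∀ j < leftOrd p lam (r + 1) l, colProj l y j = 0) ∧
    y - comb g (leftOrd p lam (r + 1) l) (colProj l y) ∈ Z ⊓ cols n (l + 1) (r + 1) := by
  have hlr' : (l : ℕ) < r := hlr
  have ho := hZ.left l (r + 1) le_rfl (by omega) le_rfl
  rw [inf_eq_left.2 hZ.le_cols] at ho
  have hu : ∀ j < leftOrd p lam (r + 1) l, colProj l y j = 0 := fun j hj => ho.eq_zero hy hj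
  have hz := Z.sub_mem hy (comb_mem hZ.stable hg.mem hu)
  refine ⟨hu, hz, mem_cols_succ rfl (hZ.le_cols hz) fun j => ?_⟩
  rw [← colProj_apply, map_sub, colProj_comb, sub_self, Finsupp.zero_apply]
  intro j
  rw [hg.col, leftOrd_succ hlr']

theorem PieceOn.le_of_coords (hlr : l < r) {Z Z' : Submodule ℂ (X n)}
    (hZ : PieceOn p lam l (r + 1) Z) (hZ' : PieceOn p lam l (r + 1) Z')
    (hA : Z ⊓ cols n l r = Z' ⊓ cols n l r)
    (hB : Z ⊓ cols n (l + 1) (r + 1) = Z' ⊓ cols n (l + 1) (r + 1))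
    (hco : ∀ s < loops p l r, ∃ y y', IsGen p lam Z l r (s + 1) y ∧ IsGen p lam Z' l r (s + 1) y' ∧
      ∀ i, l < i → i ≤ r → y (i, mixOrd p lam l r i - 1) = y' (i, mixOrd p lam l r i - 1)) :
    Z ≤ Z' := by
  obtain ⟨g, hg⟩ := hZ.exists_isGen hlr le_rfl
  obtain ⟨g', hg'⟩ := hZ'.exists_isGen hlr le_rfl
  obtain rfl := hg.eq_of_coords hlr hZ hZ' hA hB hco le_rfl hg'
  intro y hy
  obtain ⟨hu, h1⟩ := hg.sub_comb_mem hlr hZ hy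
  rw [hB] at h1
  have := Z'.add_mem h1.1 (comb_mem hZ'.stable hg'.mem hu)
  rwa [sub_add_cancel] at this

/-- The numbers `ξ l r s i` are the coordinates of the generators of `Z`. -/
def HasCoords (p : Picture n) (lam : Fin n → ℤ) (ξ : Fin n → Fin n → ℕ → Fin n → ℂ) (a b : ℕ)
    (Z : Submodule ℂ (X n)) : Prop :=
  ∀ l r : Fin n, a ≤ (l : ℕ) → l < r → (r : ℕ) < b → ∀ s < loops p l r,
    ∃ y, IsGen p lam (Z ⊓ cols n l (r + 1)) l r (s + 1) y ∧
      ∀ i, l < i → i ≤ r → y (i, mixOrd p lam l r i - 1) = ξ l r s i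

variable {ξ : Fin n → Fin n → ℕ → Fin n → ℂ}

theorem HasCoords.inf_cols {a b a' b' : ℕ} (h : HasCoords p lam ξ a b Z) (ha : a ≤ a')
    (hb : b' ≤ b) : HasCoords p lam ξ a' b' (Z ⊓ cols n a' b') := by
  intro l r hl hlr hr
  rw [inf_cols_inf_cols _ hl hr]
  exact h l r (by omega) hlr (by omega)

/-- A lattice in a piece is determined by its coordinates. -/
theorem PieceOn.eq_of_hasCoords {a b : ℕ} (hb : b ≤ n) {Z Z' : Submodule ℂ (X n)}
    (hZ : PieceOn p lam a b Z) (hZ' : PieceOn p lam a b Z') (hξ : HasCoords p lam ξ a b Z)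
    (hξ' : HasCoords p lam ξ a b Z') : Z = Z' := by
  induction hd : b - a using Nat.strong_induction_on generalizing a b Z Z' with
  | _ d ih =>
    rcases le_or_gt b a with hab | hab
    · have h1 := hZ.le_cols
      have h2 := hZ'.le_cols
      rw [cols_eq_bot hab, le_bot_iff] at h1 h2
      rw [h1, h2]
    rcases eq_or_ne b (a + 1) with rfl | hab'
    · have key : ∀ {Z Z' : Submodule ℂ (X n)}, PieceOn p lam a (a + 1) Z →
          PieceOn p lam a (a + 1) Z' → Z ≤ Z' := by
        intro Z Z' hZ hZ' y hy
        let c : Fin n := ⟨a, hb⟩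
        have h1 := hZ.left c (a + 1) le_rfl (Nat.lt_succ_self _) le_rfl
        have h2 := hZ'.left c (a + 1) le_rfl (Nat.lt_succ_self _) le_rfl
        rw [inf_eq_left.2 hZ.le_cols] at h1
        rw [inf_eq_left.2 hZ'.le_cols] at h2
        obtain ⟨y', hy', hyy⟩ := h2.exists_mem (colProj c y) fun j hj => h1.eq_zero hy hj
        have h3 : y - y' ∈ cols n (a + 1) (a + 1) := by
          refine mem_cols_succ (l := c) rfl
            (Submodule.sub_mem _ (hZ.le_cols hy) (hZ'.le_cols hy')) fun j => ?_
          rw [Finsupp.sub_apply, hyy, colProj_apply, sub_self]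
        rw [cols_eq_bot le_rfl, Submodule.mem_bot, sub_eq_zero] at h3
        rwa [h3]
      exact le_antisymm (key hZ hZ') (key hZ' hZ)
    · obtain ⟨r, rfl⟩ : ∃ r, b = r + 1 := ⟨b - 1, by omega⟩
      let l' : Fin n := ⟨a, by omega⟩
      let r' : Fin n := ⟨r, hb⟩
      have hlr : l' < r' := by change a < r; omega
      -- Dropping the last or the first column leaves shorter intervals, where the two lattices
      -- agree by induction.
      have hA := ih (r - a) (by omega) (by omega) (hZ.inf_cols le_rfl (Nat.le_succ r))
        (hZ'.inf_cols le_rfl (Nat.le_succ r)) (hξ.inf_cols le_rfl (Nat.le_succ r))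
        (hξ'.inf_cols le_rfl (Nat.le_succ r)) rfl
      have hB := ih (r + 1 - (a + 1)) (by omega) (by omega) (hZ.inf_cols (Nat.le_succ a) le_rfl)
        (hZ'.inf_cols (Nat.le_succ a) le_rfl) (hξ.inf_cols (Nat.le_succ a) le_rfl)
        (hξ'.inf_cols (Nat.le_succ a) le_rfl) rfl
      have hco : ∀ s < loops p l' r', ∃ y y', IsGen p lam Z l' r' (s + 1) y ∧
          IsGen p lam Z' l' r' (s + 1) y' ∧ ∀ i, l' < i → i ≤ r' →
            y (i, mixOrd p lam l' r' i - 1) = y' (i, mixOrd p lam l' r' i - 1) := by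
        intro s hs
        obtain ⟨y, hy, hyξ⟩ := hξ l' r' le_rfl hlr (Nat.lt_succ_self _) s hs
        obtain ⟨y', hy', hyξ'⟩ := hξ' l' r' le_rfl hlr (Nat.lt_succ_self _) s hs
        rw [inf_eq_left.2 hZ.le_cols] at hy
        rw [inf_eq_left.2 hZ'.le_cols] at hy'
        exact ⟨y, y', hy, hy', fun i h1 h2 => by rw [hyξ i h1 h2, hyξ' i h1 h2]⟩
      refine le_antisymm (hZ.le_of_coords (l := l') (r := r') hlr hZ' hA hB hco)
        (hZ'.le_of_coords (l := l') (r := r') hlr hZ hA.symm hB.symm fun s hs => ?_)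
      obtain ⟨y, y', hy, hy', h⟩ := hco s hs
      exact ⟨y', y, hy', hy, fun i h1 h2 => (h i h1 h2).symm⟩

end Generators

/-! ### Construction of a lattice from its coordinates -/

section Construction

variable {n : ℕ} {p : Picture n} {lam : Fin n → ℤ} {l r : Fin n}

theorem sh_neg_one_t (y : X n) : t n (sh n (-1) y) = y := by
  rw [t_eq_sh, sh_sh]
  simpa using sh_zero y

/-- Generators with prescribed coordinates. -/
theorem exists_generators (hlr : l < r) {A B : Submodule ℂ (X n)} (hA : PieceOn p lam l r A)
    (hB : PieceOn p lam (l + 1) (r + 1) B) (ξ : ℕ → Fin n → ℂ) :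
    ∃ G : ℕ → X n, G 0 ∈ A ∧ (∀ s, t n (G (s + 1)) - G s ∈ B) ∧
      (∀ s, G s ∈ cols n l (r + 1)) ∧
      (∀ s j, G s (l, j) = if j = leftOrd p lam r l - s then 1 else 0) ∧
      (∀ s i j, l < i → i ≤ r → mixOrd p lam l r i ≤ j → G s (i, j) = 0) ∧
      ∀ s i, l < i → i ≤ r → G (s + 1) (i, mixOrd p lam l r i - 1) = ξ s i := by
  have hlr' : (l : ℕ) < r := hlr
  have hch := hB.isChart_mixOrd hlr
  -- Vectors of `B` with prescribed values at the lowest chart positions and zeros above; they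
  -- correct one generator before it is divided by `t`.
  have hβ : ∀ f : Fin n → ℂ, ∃ y ∈ B, ∀ i j, l < i → i ≤ r → mixOrd p lam l r i ≤ j →
      y (i, j) = if j = mixOrd p lam l r i then f i else 0 := by
    intro f
    obtain ⟨y, hy, hyu⟩ := hch.2 (∑ i, f i • vec i (mixOrd p lam l r i))
    refine ⟨y, hy, fun i j h1 h2 h3 => ?_⟩
    rw [hyu (i, j) ⟨h1, Nat.lt_succ_of_le h2, h3⟩, Finsupp.finsetSum_apply]
    simp only [Finsupp.smul_apply, vec_apply, smul_eq_mul]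
    rw [Finset.sum_eq_single i]
    · simp
    · intro i' _ hi'
      rw [if_neg (fun h => hi' h.1.symm), mul_zero]
    · simp
  choose β hβB hβ using hβ
  obtain ⟨g, hgA, hgl, hgz⟩ : ∃ g ∈ A, (∀ j, g (l, j) = if j = leftOrd p lam r l then 1 else 0) ∧
      ∀ i j, l < i → i ≤ r → mixOrd p lam l r i ≤ j → g (i, j) = 0 := by
    have hch' := hA.isChart r.2.le
    obtain ⟨g, hg, hgu⟩ := hch'.2 (vec l (leftOrd p lam r l))
    refine ⟨g, hg, fun j => ?_, fun i j h1 h2 h3 => ?_⟩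
    · rcases lt_or_ge j (leftOrd p lam r l) with hj | hj
      · have ho := hA.left l r le_rfl hlr' le_rfl
        rw [inf_eq_left.2 hA.le_cols] at ho
        rw [ho.eq_zero hg hj, if_neg hj.ne]
      · rw [hgu (l, j) ⟨le_rfl, hlr', hj⟩, vec_apply]
        simp
    · rcases eq_or_ne i r with hir | hir
      · rw [mem_cols.1 (hA.le_cols hg) i j (by rw [hir]; omega)]
      · have h2' : (i : ℕ) ≠ r := fun h => hir (Fin.ext h)
        rw [mixOrd, if_neg hir] at h3
        rw [hgu (i, j) ⟨h1.le, lt_of_le_of_ne h2 h2', h3⟩, vec_apply, if_neg]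
        exact fun h => h1.ne' h.1
  let G : ℕ → X n := fun s => Nat.rec g (fun s y => sh n (-1) (y + β (ξ s))) s
  have hG : ∀ s, G (s + 1) = sh n (-1) (G s + β (ξ s)) := fun s => rfl
  have hβl : ∀ f j, β f (l, j) = 0 := fun f j => mem_cols.1 (hB.le_cols (hβB f)) l j (by omega)
  have hz : ∀ s i j, l < i → i ≤ r → mixOrd p lam l r i ≤ j → G s (i, j) = 0 := by
    intro s
    induction s with
    | zero => exact hgz
    | succ s ih =>
      intro i j h1 h2 h3
      rw [hG, sh_apply, Finsupp.add_apply, ih i _ h1 h2 (by omega), hβ _ i _ h1 h2 (by omega),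
        if_neg (by omega), add_zero]
  refine ⟨G, hgA, fun s => ?_, fun s => ?_, fun s => ?_, hz, fun s i h1 h2 => ?_⟩
  · rw [hG, sh_neg_one_t, add_sub_cancel_left]
    exact hβB _
  · induction s with
    | zero => exact cols_mono le_rfl (Nat.le_succ _) (hA.le_cols hgA)
    | succ s ih =>
      rw [hG]
      exact sh_mem_cols _ (Submodule.add_mem _ ih
        (cols_mono (Nat.le_succ _) le_rfl (hB.le_cols (hβB _))))
  · induction s with
    | zero =>
      have h0 : G 0 = g := rfl
      simpa [h0] using hgl
    | succ s ih =>
      intro j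
      rw [hG, sh_apply, Finsupp.add_apply, ih, hβl, add_zero]
      refine if_congr ?_ rfl rfl
      push_cast
      omega
  · rw [hG, sh_apply, Finsupp.add_apply, sub_neg_eq_add, sub_add_cancel, hz s i _ h1 h2 le_rfl,
      hβ _ i _ h1 h2 le_rfl, if_pos rfl, zero_add]

/-- The lattice is generated by `B` and the last generator. Enlarging `B` in this way adds nothing
to the part without column `l`; that the part without column `r` is no larger than `A` is what the
nonzero coordinate guarantees. -/
theorem exists_glue (hlr : l < r) {A B : Submodule ℂ (X n)} (hA : PieceOn p lam l r A)
    (hB : PieceOn p lam (l + 1) (r + 1) B) (hAB : A ⊓ cols n (l + 1) r = B ⊓ cols n (l + 1) r)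
    (ξ : ℕ → Fin n → ℂ) (hξ : 0 < loops p l r → ξ 0 r ≠ 0) :
    ∃ C, PieceOn p lam l (r + 1) C ∧ C ⊓ cols n l r = A ∧ C ⊓ cols n (l + 1) (r + 1) = B ∧
      ∀ s < loops p l r, ∃ y, IsGen p lam C l r (s + 1) y ∧
        ∀ i, l < i → i ≤ r → y (i, mixOrd p lam l r i - 1) = ξ s i := by
  have hlr' : (l : ℕ) < r := hlr
  obtain ⟨G, hG0, hGB, hGc, hGl, hGz, hGξ⟩ := exists_generators hlr hA hB ξ
  set P := loops p l r with hP
  set o := leftOrd p lam r l with ho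
  have hoA := hA.left l r le_rfl hlr' le_rfl
  rw [inf_eq_left.2 hA.le_cols, ← ho] at hoA
  let C : Submodule ℂ (X n) :=
    B ⊔ (Finsupp.supported ℂ ℂ (Set.Ici (o - P))).map (comb (G P) (o - P))
  have hC : ∀ y, y ∈ C ↔ ∃ b ∈ B, ∃ u : ℤ →₀ ℂ, (∀ j < o - P, u j = 0) ∧
      b + comb (G P) (o - P) u = y := by
    intro y
    rw [Submodule.mem_sup]
    simp only [Submodule.mem_map, Finsupp.mem_supported', Set.mem_Ici, not_le]
    constructor
    · rintro ⟨b, hb, _, ⟨u, hu, rfl⟩, rfl⟩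
      exact ⟨b, hb, u, hu, rfl⟩
    · rintro ⟨b, hb, u, hu, rfl⟩
      exact ⟨b, hb, _, ⟨u, hu, rfl⟩, rfl⟩
  have hBl : ∀ b ∈ B, ∀ j, b (l, j) = 0 := fun b hb j => mem_cols.1 (hB.le_cols hb) l j (by omega)
  have hcol : ∀ b ∈ B, ∀ u, colProj l (b + comb (G P) (o - P) u) = u := by
    intro b hb u
    rw [map_add, colProj_comb (hGl P)]
    ext j
    rw [Finsupp.add_apply, colProj_apply, hBl b hb, zero_add]
  have hstable : ∀ y ∈ C, t n y ∈ C := by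
    intro y hy
    obtain ⟨b, hb, u, hu, rfl⟩ := (hC y).1 hy
    refine (hC _).2 ⟨t n b, hB.stable b hb, Finsupp.lmapDomain ℂ ℂ (· + 1) u, fun j hj => ?_, ?_⟩
    · have : j = (j - 1) + 1 := by ring
      rw [this, Finsupp.lmapDomain_apply, Finsupp.mapDomain_apply (add_left_injective 1)]
      exact hu _ (by omega)
    · rw [map_add, t_comb]
  have hBC : B ≤ C := le_sup_left
  have hGPC : G P ∈ C := by
    refine (hC _).2 ⟨0, B.zero_mem, Finsupp.single (o - P) 1,
      fun j hj => Finsupp.single_eq_of_ne (by omega), ?_⟩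
    rw [comb, Finsupp.linearCombination_single, sub_self, sh_zero, zero_add, one_smul]
  -- Downward induction: each generator is `t` times the next one, up to a vector of `B`.
  have hGC : ∀ s ≤ P, G s ∈ C := by
    intro s hs
    induction hd : P - s generalizing s with
    | zero =>
      obtain rfl : s = P := by omega
      exact hGPC
    | succ d ih =>
      have h1 := C.sub_mem (hstable _ (ih (s + 1) (by omega) (by omega))) (hBC (hGB s))
      rwa [sub_sub_cancel] at h1
  have hleC : C ≤ cols n l (r + 1) := by
    have hst : ∀ y ∈ cols n l (r + 1), t n y ∈ cols n l (r + 1) := fun y => t_mem_cols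
    intro y hy
    obtain ⟨b, hb, u, hu, rfl⟩ := (hC y).1 hy
    exact Submodule.add_mem _ (cols_mono (Nat.le_succ _) le_rfl (hB.le_cols hb))
      (comb_mem hst (hGc P) hu)
  have hordC : HasOrd C l (o - P) := by
    rw [hasOrd_iff]
    constructor
    · intro y hy j hj
      obtain ⟨b, hb, u, hu, rfl⟩ := (hC y).1 hy
      rw [← colProj_apply, hcol b hb, hu j hj]
    · intro u hu
      refine ⟨0 + comb (G P) (o - P) u, (hC _).2 ⟨0, B.zero_mem, u, hu, rfl⟩, fun j => ?_⟩
      rw [← colProj_apply, hcol 0 B.zero_mem]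
  have hCB : C ⊓ cols n (l + 1) (r + 1) = B := by
    refine le_antisymm ?_ (le_inf hBC hB.le_cols)
    rintro y ⟨hy, hy'⟩
    obtain ⟨b, hb, u, hu, rfl⟩ := (hC y).1 hy
    have hu0 : u = 0 := by
      rw [← hcol b hb u]
      ext j
      exact mem_cols.1 hy' l j (by omega)
    rwa [hu0, map_zero, add_zero]
  have hsub : ∀ {y z}, y ∈ C → z ∈ C → (∀ j, y (l, j) = z (l, j)) → y - z ∈ B := by
    intro y z hy hz h
    rw [← hCB]
    refine ⟨C.sub_mem hy hz, mem_cols_succ rfl (hleC (C.sub_mem hy hz)) fun j => ?_⟩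
    rw [Finsupp.sub_apply, h, sub_self]
  have hAC : A ≤ C := by
    intro y hy
    have hu : ∀ j < o, colProj l y j = 0 := fun j hj => hoA.eq_zero hy hj
    have hm := comb_mem hA.stable hG0 hu
    have h1 : y - comb (G 0) o (colProj l y) ∈ A ⊓ cols n (l + 1) r := by
      refine ⟨A.sub_mem hy hm, mem_cols_succ rfl (hA.le_cols (A.sub_mem hy hm)) fun j => ?_⟩
      rw [← colProj_apply, map_sub, colProj_comb (by simpa using hGl 0), sub_self,
        Finsupp.zero_apply]
    rw [hAB] at h1
    have := C.add_mem (hBC h1.1) (comb_mem hstable (hGC 0 (Nat.zero_le _)) hu)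
    rwa [sub_add_cancel] at this
  have hBr := hB.right (r := r) (Nat.lt_succ_self _) le_rfl hlr'
  rw [inf_eq_left.2 hB.le_cols] at hBr
  have hCA : C ⊓ cols n l r = A := by
    refine le_antisymm ?_ (le_inf hAC hA.le_cols)
    rintro y ⟨hy, hyc⟩
    -- Otherwise shift `y` so that its leading exponent `j₀` becomes `o - 1`, cancel the leading
    -- term by a multiple of `G 1`, and remove the rest of column `l` by a vector of `A`. The result
    -- lies in `B`, but its `r`-th column has the nonzero entry `-y (l, j₀) * ξ 0 r` just below the
    -- order of `B`.
    have hy0 : ∀ j < o, y (l, j) = 0 := by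
      by_contra! hne
      obtain ⟨j₀, ⟨hj₀, hyj₀⟩, hmin⟩ := Int.exists_least_of_bdd
        (P := fun j => j < o ∧ y (l, j) ≠ 0)
        ⟨o - P, fun j hj => by
          by_contra hlt
          exact hj.2 (hordC.eq_zero hy (by omega))⟩ hne
      have hP0 : 0 < P := by
        by_contra hP0
        exact hyj₀ (hordC.eq_zero hy (by omega))
      have hG1 := hGC 1 hP0
      let w := sh n (o - 1 - j₀) y - y (l, j₀) • G 1
      have hw : w ∈ C := C.sub_mem (sh_mem hstable (by omega) hy) (C.smul_mem _ hG1)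
      obtain ⟨x, hx, hxu⟩ := hoA.exists_mem (colProj l w) (by
        intro j hj
        rw [colProj_apply, Finsupp.sub_apply, Finsupp.smul_apply, sh_apply, hGl]
        rcases eq_or_ne j (o - 1) with rfl | hj'
        · rw [if_pos (by simp)]
          simp
        · rw [if_neg (by push_cast; omega), smul_zero, sub_zero]
          by_contra h
          have := hmin _ ⟨by omega, h⟩
          omega)
      have h1 : w - x ∈ B := hsub hw (hAC hx) fun j => by rw [hxu, colProj_apply]
      have h2 := hBr.eq_zero h1 (j := mixOrd p lam l r r - 1) (by rw [mixOrd_right]; omega)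
      rw [Finsupp.sub_apply, Finsupp.sub_apply, Finsupp.smul_apply, sh_apply,
        mem_cols.1 hyc r _ (by omega), mem_cols.1 (hA.le_cols hx) r _ (by omega),
        hGξ 0 r hlr le_rfl] at h2
      have h3 := mul_ne_zero hyj₀ (hξ hP0)
      simp only [smul_eq_mul, zero_sub, sub_zero, neg_eq_zero] at h2
      exact h3 h2
    obtain ⟨x, hx, hxu⟩ := hoA.exists_mem (colProj l y) hy0
    have h1 : y - x ∈ B ⊓ cols n (l + 1) r := by
      refine ⟨hsub hy (hAC hx) fun j => by rw [hxu, colProj_apply],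
        mem_cols_succ rfl (Submodule.sub_mem _ hyc (hA.le_cols hx)) fun j => ?_⟩
      rw [Finsupp.sub_apply, hxu, colProj_apply, sub_self]
    rw [← hAB] at h1
    have := A.add_mem h1.1 hx
    rwa [sub_add_cancel] at this
  refine ⟨C, ⟨?_, ?_⟩, hCA, hCB, fun s hs => ⟨G (s + 1), ⟨hGC _ hs, hGl _, hGz _⟩, hGξ s⟩⟩
  · obtain ⟨NA, hNA⟩ := hA.isLat
    obtain ⟨NB, hNB⟩ := hB.isLat
    obtain ⟨m, hm⟩ := exists_mem_level (G P)
    let N := max (max NA NB) m.natAbs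
    refine ⟨N, hstable, hleC, ?_, ?_⟩
    · rintro y ⟨hy1, hy2⟩
      have hyr : colIncl r (colProj r y) ∈ B := by
        refine hNB.lower ⟨mem_level.2 fun i j hj => ?_, mem_cols.2 fun i j hi => ?_⟩
        · rw [colIncl_apply, colProj_apply, mem_level.1 hy1 r j (by omega), ite_self]
        · rw [colIncl_apply, if_neg]
          rintro rfl
          omega
      have hyA : y - colIncl r (colProj r y) ∈ A := by
        refine hNA.lower ⟨mem_level.2 fun i j hj => ?_, mem_cols_of_col_eq_zero
          (Submodule.sub_mem _ hy2 (cols_mono (Nat.le_succ _) le_rfl (hB.le_cols hyr)))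
          fun j => ?_⟩
        · rw [Finsupp.sub_apply, colIncl_apply, colProj_apply, mem_level.1 hy1 r j (by omega),
            mem_level.1 hy1 i j (by omega), ite_self, sub_zero]
        · rw [Finsupp.sub_apply, colIncl_apply, colProj_apply, if_pos rfl, sub_self]
      have := C.add_mem (hAC hyA) (hBC hyr)
      rwa [sub_add_cancel] at this
    · intro y hy
      obtain ⟨b, hb, u, hu, rfl⟩ := (hC y).1 hy
      exact Submodule.add_mem _ (level_anti (by omega) (hNB.upper hb))
        (comb_mem (level_stable _) (level_anti (by omega) hm) hu)
  · intro i c hli hic hcr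
    rcases eq_or_ne i l with rfl | hil
    · rcases eq_or_ne c (r + 1) with rfl | hcr'
      · rw [inf_eq_left.2 hleC, leftOrd_succ hlr']
        exact hordC
      · have := hA.left i c le_rfl hic (by omega)
        rwa [← hCA, inf_cols_inf_cols _ le_rfl (by omega)] at this
    · have hil' : (i : ℕ) ≠ l := fun h => hil (Fin.ext h)
      have := hB.left i c (by omega) hic hcr
      rwa [← hCB, inf_cols_inf_cols _ (by omega) hcr] at this

theorem pieceOn_bot {a b : ℕ} (h : b ≤ a) : PieceOn p lam a b ⊥ where
  isLat := ⟨0, fun y hy => by rw [Submodule.mem_bot] at hy ⊢; rw [hy, map_zero], bot_le,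
    by rw [cols_eq_bot h, inf_bot_eq], bot_le⟩
  left i c h1 h2 h3 := by omega

theorem pieceOn_blockLat {a : ℕ} (h : a < n) :
    PieceOn p lam a (a + 1) (blockLat a (a + 1) (leftOrd p lam (a + 1))) where
  isLat := by
    refine ⟨(leftOrd p lam (a + 1) ⟨a, h⟩).natAbs, isLat_blockLat fun i h1 h2 => ?_⟩
    obtain rfl : i = ⟨a, h⟩ := Fin.ext (by change (i : ℕ) = a; omega)
    omega
  left i c h1 h2 h3 := by
    obtain rfl : (i : ℕ) = a := by omega
    obtain rfl : c = i + 1 := by omega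
    rw [blockLat_inf_cols le_rfl le_rfl]
    exact hasOrd_blockLat _ le_rfl h2

/-- Lattices with given coordinates exist. -/
theorem exists_pieceOn (ξ : Fin n → Fin n → ℕ → Fin n → ℂ)
    (hξ : ∀ l r : Fin n, l < r → 0 < loops p l r → ξ l r 0 r ≠ 0) {a b : ℕ} (hb : b ≤ n) :
    ∃ Z, PieceOn p lam a b Z ∧ HasCoords p lam ξ a b Z := by
  induction hd : b - a using Nat.strong_induction_on generalizing a b with
  | _ d ih =>
    rcases le_or_gt b a with hab | hab
    · exact ⟨⊥, pieceOn_bot hab, fun l r h1 h2 h3 => by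
        have : (l : ℕ) < r := h2
        omega⟩
    rcases eq_or_ne b (a + 1) with rfl | hab'
    · exact ⟨_, pieceOn_blockLat hb, fun l r h1 h2 h3 => by
        have : (l : ℕ) < r := h2
        omega⟩
    · obtain ⟨r, rfl⟩ : ∃ r, b = r + 1 := ⟨b - 1, by omega⟩
      obtain ⟨A, hA, hAξ⟩ := ih (r - a) (by omega) (a := a) (b := r) (by omega) rfl
      obtain ⟨B, hB, hBξ⟩ := ih (r + 1 - (a + 1)) (by omega) (a := a + 1) (b := r + 1) hb rfl
      let l' : Fin n := ⟨a, by omega⟩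
      let r' : Fin n := ⟨r, hb⟩
      have hlr : l' < r' := by change a < r; omega
      -- The overlaps have the same coordinates, so uniqueness on the shorter interval identifies
      -- them.
      have hAB : A ⊓ cols n (a + 1) r = B ⊓ cols n (a + 1) r :=
        PieceOn.eq_of_hasCoords (by omega) (hA.inf_cols (Nat.le_succ _) le_rfl)
          (hB.inf_cols le_rfl (Nat.le_succ _)) (hAξ.inf_cols (Nat.le_succ _) le_rfl)
          (hBξ.inf_cols le_rfl (Nat.le_succ _))
      obtain ⟨C, hC, hCA, hCB, hCξ⟩ := exists_glue (l := l') (r := r') hlr hA hB hAB (ξ l' r')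
        (hξ l' r' hlr)
      refine ⟨C, hC, fun l₁ r₁ h1 h2 h3 s hs => ?_⟩
      have h2' : (l₁ : ℕ) < r₁ := h2
      rcases lt_or_ge (r₁ : ℕ) r with hr | hr
      · have := hAξ l₁ r₁ h1 h2 hr s hs
        rw [← hCA] at this
        rwa [inf_cols_inf_cols _ h1 (by exact hr)] at this
      obtain rfl : r₁ = r' := Fin.ext (by change (r₁ : ℕ) = r; omega)
      rcases eq_or_ne l₁ l' with rfl | hl
      · rw [inf_eq_left.2 hC.le_cols]
        exact hCξ s hs
      · have hl' : (l₁ : ℕ) ≠ a := fun h => hl (Fin.ext h)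
        have := hBξ l₁ r' (by omega) h2 h3 s hs
        rw [← hCB] at this
        rwa [inf_cols_inf_cols _ (by change a + 1 ≤ (l₁ : ℕ); omega) le_rfl] at this

end Construction

/-! ### Regular families of vectors -/

section RegularFamilies

variable {ι : Type} {τ : ι → Type} {S : Type} {e : S → MultiProj τ} {n : ℕ}

/-- Families of vectors with regular coordinates and jointly finite support. -/
structure RegVec (e : S → MultiProj τ) (v : S → X n) : Prop where
  coord : ∀ q, (fun x => v x q) ∈ regAlg e
  bdd : ∃ s : Finset (Fin n × ℤ), ∀ x, ∀ q ∉ s, v x q = 0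

theorem RegVec.const (v : X n) : RegVec e fun _ => v where
  coord q := const_mem_regAlg _
  bdd := ⟨v.support, fun _ q hq => by simpa using hq⟩

theorem RegVec.add {v w : S → X n} (hv : RegVec e v) (hw : RegVec e w) :
    RegVec e fun x => v x + w x where
  coord q := (regAlg e).add_mem (hv.coord q) (hw.coord q)
  bdd := by
    classical
    obtain ⟨s, hs⟩ := hv.bdd
    obtain ⟨s', hs'⟩ := hw.bdd
    refine ⟨s ∪ s', fun x q hq => ?_⟩
    rw [Finset.mem_union, not_or] at hq
    rw [Finsupp.add_apply, hs x q hq.1, hs' x q hq.2, add_zero]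

theorem RegVec.smul {f : S → ℂ} {v : S → X n} (hf : f ∈ regAlg e) (hv : RegVec e v) :
    RegVec e fun x => f x • v x where
  coord q := (regAlg e).mul_mem hf (hv.coord q)
  bdd := by
    obtain ⟨s, hs⟩ := hv.bdd
    exact ⟨s, fun x q hq => by rw [Finsupp.smul_apply, hs x q hq, smul_zero]⟩

theorem RegVec.sub {v w : S → X n} (hv : RegVec e v) (hw : RegVec e w) :
    RegVec e fun x => v x - w x := by
  have := hv.add (hw.smul (const_mem_regAlg (-1)))
  simpa [sub_eq_add_neg] using this

theorem RegVec.sum {α : Type} (s : Finset α) {v : α → S → X n} (h : ∀ a ∈ s, RegVec e (v a)) :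
    RegVec e fun x => ∑ a ∈ s, v a x := by
  classical
  induction s using Finset.induction_on with
  | empty => simpa using RegVec.const 0
  | insert a s ha ih =>
    simp only [Finset.sum_insert ha]
    exact (h a (Finset.mem_insert_self a s)).add
      (ih fun b hb => h b (Finset.mem_insert_of_mem hb))

theorem RegVec.sh {v : S → X n} (hv : RegVec e v) (k : ℤ) : RegVec e fun x => sh n k (v x) where
  coord := fun ⟨i, j⟩ => by simpa using hv.coord (i, j - k)
  bdd := by
    classical
    obtain ⟨s, hs⟩ := hv.bdd
    refine ⟨s.image fun q => (q.1, q.2 + k), fun x ⟨i, j⟩ hq => ?_⟩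
    rw [sh_apply]
    refine hs x _ fun h => hq (Finset.mem_image.2 ⟨_, h, ?_⟩)
    simp

/-- The vectors of `Z x` with regular coordinates in the positions `J` are regular. -/
structure RegChart (e : S → MultiProj τ) (Z : S → Submodule ℂ (X n)) (J : Set (Fin n × ℤ)) :
    Prop where
  isChart : ∀ x, IsChart (Z x) J
  regVec : ∀ u v : S → X n, RegVec e u → (∀ x, v x ∈ Z x) → (∀ x, ∀ q ∈ J, v x q = u x q) →
    RegVec e v

variable {Z : S → Submodule ℂ (X n)} {J : Set (Fin n × ℤ)}

/-- Shifts of `g` with regular coefficients produce the prescribed column `c`; a finite sum suffices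
because the supports are jointly finite. The remainder has zero `c`-th column. -/
theorem RegChart.insert_column {c : Fin n} {o : ℤ} (hZ : ∀ x, ∀ y ∈ Z x, LoopGr.t n y ∈ Z x)
    (ho : ∀ x, HasOrd (Z x) c o) (hJ : RegChart e (fun x => Z x ⊓ LinearMap.ker (colProj c)) J)
    {g : S → X n} (hg : RegVec e g) (hgZ : ∀ x, g x ∈ Z x)
    (hgc : ∀ x j, g x (c, j) = if j = o then 1 else 0) :
    RegChart e Z (J ∪ {q | q.1 = c ∧ o ≤ q.2}) := by
  classical
  refine ⟨fun x => (hJ.isChart x).insert_column (ho x), fun u v hu hv huv => ?_⟩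
  obtain ⟨s, hs⟩ := hu.bdd
  let s' : Finset ℤ := (s.image Prod.snd).filter (o ≤ ·)
  let w : S → X n := fun x => ∑ j ∈ s', u x (c, j) • LoopGr.sh n (j - o) (g x)
  have hw : RegVec e w := RegVec.sum _ fun j _ => (hg.sh _).smul (hu.coord _)
  have hwZ : ∀ x, w x ∈ Z x := fun x => (Z x).sum_mem fun j hj => (Z x).smul_mem _
    (sh_mem (hZ x) (by have := (Finset.mem_filter.1 hj).2; omega) (hgZ x))
  have hwc : ∀ x j, w x (c, j) = if o ≤ j then u x (c, j) else 0 := by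
    intro x j
    have h1 : w x (c, j) = ∑ j' ∈ s', if j = j' then u x (c, j') else 0 := by
      simp only [w, Finsupp.finsetSum_apply, Finsupp.smul_apply, sh_apply, hgc, smul_eq_mul,
        mul_ite, mul_one, mul_zero]
      refine Finset.sum_congr rfl fun j' _ => if_congr (by omega) rfl rfl
    rw [h1, Finset.sum_ite_eq]
    by_cases hj : o ≤ j
    · rw [if_pos hj]
      split_ifs with hjs
      · rfl
      · symm
        refine hs x _ fun hmem => hjs (Finset.mem_filter.2 ⟨Finset.mem_image_of_mem _ hmem, hj⟩)
    · rw [if_neg hj, if_neg fun h => hj (Finset.mem_filter.1 h).2]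
  have hvw := hJ.regVec (fun x => u x - w x) (fun x => v x - w x) (hu.sub hw)
    (fun x => ⟨(Z x).sub_mem (hv x) (hwZ x), LinearMap.mem_ker.2 (by
      ext j
      rw [colProj_apply, Finsupp.sub_apply, hwc]
      split_ifs with hj
      · rw [huv x _ (Or.inr ⟨rfl, hj⟩), sub_self]; rfl
      · rw [(ho x).eq_zero (hv x) (not_le.1 hj), sub_self]; rfl)⟩)
    (fun x q hq => by rw [Finsupp.sub_apply, Finsupp.sub_apply, huv x q (Or.inl hq)])
  simpa using hvw.add hw

/-- Regularity of vectors of `Z x` can be tested on any determining set `Q` of positions. -/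
theorem RegChart.regVec_of_determining (hJ : RegChart e Z J) {v : S → X n} (hv : ∀ x, v x ∈ Z x)
    (hbdd : ∃ s : Finset (Fin n × ℤ), ∀ x, ∀ q ∉ s, v x q = 0) {Q : Set (Fin n × ℤ)}
    (hQ : ∀ x, ∀ z ∈ Z x, (∀ q ∈ Q, z q = 0) → z = 0)
    (hvQ : ∀ q ∈ Q, (fun x => v x q) ∈ regAlg e) : RegVec e v := by
  classical
  obtain ⟨s, hs⟩ := hbdd
  -- For `q ∈ J` these vectors form the dual basis of the chart; they have constant chart
  -- coordinates and are therefore regular.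
  choose b hbZ hbJ using fun (q : Fin n × ℤ) (x : S) => (hJ.isChart x).2 (vec q.1 q.2)
  have hb : ∀ q, RegVec e (b q) := fun q =>
    hJ.regVec (fun _ => vec q.1 q.2) (b q) (RegVec.const _) (hbZ q) (hbJ q)
  have hbq : ∀ q q' x, q' ∈ J → b q x q' = if q' = q then 1 else 0 := by
    rintro ⟨i, j⟩ ⟨i', j'⟩ x hq'
    rw [hbJ _ x _ hq', vec_apply]
    simp [Prod.ext_iff]
  choose R hR using fun q => (hb q).bdd
  let K := s.filter (· ∈ J)
  have hsum : ∀ x, v x = ∑ q : K, v x q • b q x := by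
    intro x
    rw [← sub_eq_zero]
    refine (hJ.isChart x).1 _ ((Z x).sub_mem (hv x)
      ((Z x).sum_mem fun q _ => (Z x).smul_mem _ (hbZ _ _))) fun q hq => ?_
    rw [Finsupp.sub_apply, Finsupp.finsetSum_apply]
    simp only [Finsupp.smul_apply, hbq _ _ _ hq, smul_eq_mul, mul_ite, mul_one, mul_zero]
    rw [Finset.sum_coe_sort K fun q' => if q = q' then v x q' else 0, Finset.sum_ite_eq]
    split_ifs with hqK
    · rw [sub_self]
    · rw [hs x q fun h => hqK (Finset.mem_filter.2 ⟨h, hq⟩), sub_self]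
  -- Positions of `Q` outside `T` meet no support of the finitely many basis vectors involved. Hence
  -- the coefficients of `v x` solve a finite linear system over `T` with trivial kernel.
  let T := (K.biUnion R).filter (· ∈ Q)
  let M : S → Matrix T K ℂ := fun x => Matrix.of fun q' q => b q x q'
  have hM : ∀ x (c : K → ℂ) (q' : T), (M x).mulVec c q' = (∑ q, c q • b q x) q' := by
    intro x c q'
    rw [Finsupp.finsetSum_apply]
    simp [M, Matrix.mulVec, dotProduct, mul_comm]
  have hc : ∀ q : K, (fun x => v x q) ∈ regAlg e := by
    refine regAlg_of_mulVec (M := M) (c := fun x q => v x q) (fun q' q => (hb q).coord q')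
      (fun x c hMc => ?_) (fun q' => ?_)
    · have hz : ∑ q, c q • b q x = 0 := by
        refine hQ x _ ((Z x).sum_mem fun q _ => (Z x).smul_mem _ (hbZ _ _)) fun q' hq' => ?_
        by_cases hT : q' ∈ T
        · rw [← hM x c ⟨q', hT⟩, hMc]; rfl
        · rw [Finsupp.finsetSum_apply]
          refine Finset.sum_eq_zero fun q _ => ?_
          rw [Finsupp.smul_apply, hR q x q' fun h => hT (Finset.mem_filter.2
            ⟨Finset.mem_biUnion.2 ⟨q, q.2, h⟩, hq'⟩), smul_zero]
      ext q
      have h1 := DFunLike.congr_fun hz (q : Fin n × ℤ)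
      rw [Finsupp.finsetSum_apply] at h1
      simp only [Finsupp.smul_apply, hbq _ _ _ (Finset.mem_filter.1 q.2).2, smul_eq_mul, mul_ite,
        mul_one, mul_zero, Subtype.coe_inj, Finset.sum_ite_eq, Finset.mem_univ, if_true] at h1
      exact h1
    · simp only [hM, ← hsum]
      exact hvQ _ (Finset.mem_filter.1 q'.2).2
  have : v = fun x => ∑ q : K, v x q • b q x := funext hsum
  rw [this]
  exact RegVec.sum _ fun q _ => (hb q).smul (hc q)

end RegularFamilies

/-! ### Bounds -/

section Bounds

variable {n : ℕ} {p : Picture n} {lam : Fin n → ℤ}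

/-- Multiplication by `t` to the number of loops around the whole interval makes a vector of `Z` a
sum of vectors from its parts without the last and without the first column. These are bounded by
induction, independently of `Z`. -/
theorem exists_pieceOn_le_level (p : Picture n) (lam : Fin n → ℤ) {a b : ℕ} (hb : b ≤ n) :
    ∃ m : ℤ, ∀ Z, PieceOn p lam a b Z → Z ≤ level n m := by
  induction hd : b - a using Nat.strong_induction_on generalizing a b with
  | _ d ih =>
    rcases le_or_gt b a with hab | hab
    · refine ⟨0, fun Z hZ => ?_⟩
      have := hZ.le_cols
      rw [cols_eq_bot hab] at this
      exact this.trans bot_le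
    rcases eq_or_ne b (a + 1) with rfl | hab'
    · let c : Fin n := ⟨a, hb⟩
      refine ⟨leftOrd p lam (a + 1) c, fun Z hZ y hy => mem_level.2 fun i j hj => ?_⟩
      by_cases hi : i = c
      · subst hi
        have h1 := hZ.left c (a + 1) le_rfl (Nat.lt_succ_self _) le_rfl
        rw [inf_eq_left.2 hZ.le_cols] at h1
        exact h1.eq_zero hy hj
      · have hi' : (i : ℕ) ≠ a := fun h => hi (Fin.ext h)
        exact mem_cols.1 (hZ.le_cols hy) i j (by omega)
    · obtain ⟨r, rfl⟩ : ∃ r, b = r + 1 := ⟨b - 1, by omega⟩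
      obtain ⟨mA, hA⟩ := ih (r - a) (by omega) (a := a) (b := r) (by omega) rfl
      obtain ⟨mB, hB⟩ := ih (r + 1 - (a + 1)) (by omega) (a := a + 1) (b := r + 1) hb rfl
      let l : Fin n := ⟨a, by omega⟩
      have hlr : (l : ℕ) < r := by change a < r; omega
      refine ⟨min mA mB - loops p a r, fun Z hZ y hy => ?_⟩
      have hy' : sh n (loops p a r) y ∈ Z := sh_mem hZ.stable (Nat.cast_nonneg _) hy
      have h1 := hZ.left l (r + 1) le_rfl (by omega) le_rfl
      rw [inf_eq_left.2 hZ.le_cols, leftOrd_succ hlr] at h1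
      have h2 := hZ.left l r le_rfl hlr (Nat.le_succ _)
      obtain ⟨x, hx, hxu⟩ := h2.exists_mem (colProj l (sh n (loops p a r) y)) (by
        intro j hj
        rw [colProj_apply, sh_apply]
        refine h1.eq_zero hy ?_
        change j - (loops p a r : ℤ) < leftOrd p lam r l - (loops p a r : ℤ)
        omega)
      have h3 : sh n (loops p a r) y - x ∈ Z ⊓ cols n (a + 1) (r + 1) := by
        refine ⟨Z.sub_mem hy' hx.1, mem_cols_succ (l := l) rfl
          (hZ.le_cols (Z.sub_mem hy' hx.1)) fun j => ?_⟩
        rw [Finsupp.sub_apply, hxu, colProj_apply, sub_self]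
      have h4 := hB _ (hZ.inf_cols (Nat.le_succ _) le_rfl) h3
      have h5 := hA _ (hZ.inf_cols le_rfl (Nat.le_succ _)) hx
      refine mem_level.2 fun i j hj => ?_
      have h6 := Submodule.add_mem _ (level_anti (min_le_right mA mB) h4)
        (level_anti (min_le_left mA mB) h5)
      rw [sub_add_cancel] at h6
      have := mem_level.1 h6 i (j + loops p a r) (by omega)
      rwa [sh_apply, add_sub_cancel_right] at this

theorem PieceOn.level_le {Y : Submodule ℂ (X n)} (hY : PieceOn p lam 0 n Y) {m : ℤ}
    (hm : ∀ i : Fin n, leftOrd p lam (i + 1) i ≤ m) : level n m ≤ Y := by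
  rw [level, Finsupp.supported_eq_span_single, Submodule.span_le]
  rintro _ ⟨⟨i, j⟩, hj, rfl⟩
  refine (vec_mem_iff (hY.left i (i + 1) (Nat.zero_le _) (Nat.lt_succ_self _) i.2) j).2 ?_
  exact (hm i).trans hj

theorem PieceOn.winDim_eq {N a b : ℕ} (hb : b ≤ n) {Z Z' : Submodule ℂ (X n)}
    (hZ : PieceOn p lam a b Z) (hZ' : PieceOn p lam a b Z') (hN : IsLat N a b Z)
    (hN' : IsLat N a b Z') : winDim N Z = winDim N Z' := by
  induction hd : b - a generalizing a Z Z' with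
  | zero =>
    have h1 := hZ.le_cols
    have h2 := hZ'.le_cols
    rw [cols_eq_bot (by omega), le_bot_iff] at h1 h2
    rw [h1, h2]
  | succ d ih =>
    let c : Fin n := ⟨a, by omega⟩
    have hcb : (c : ℕ) < b := by change a < b; omega
    have h1 := hZ.left c b le_rfl hcb le_rfl
    have h2 := hZ'.left c b le_rfl hcb le_rfl
    rw [inf_eq_left.2 hZ.le_cols] at h1
    rw [inf_eq_left.2 hZ'.le_cols] at h2
    have e1 := hN.winDim_left rfl hcb h1
    have e2 := hN'.winDim_left rfl hcb h2
    have e3 := ih (hZ.inf_cols (Nat.le_succ _) le_rfl) (hZ'.inf_cols (Nat.le_succ _) le_rfl)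
      (hN.inf_cols (Nat.le_succ _) le_rfl) (hN'.inf_cols (Nat.le_succ _) le_rfl) (by omega)
    change _ = (winDim N (Z ⊓ cols n (a + 1) b) : ℤ) + _ at e1
    change _ = (winDim N (Z' ⊓ cols n (a + 1) b) : ℤ) + _ at e2
    rw [Nat.succ_eq_add_one] at e3
    omega

theorem exists_inGrass (p : Picture n) (lam : Fin n → ℤ) :
    ∃ N k : ℕ, ∀ Y ∈ piece p lam, InGrass N k Y := by
  obtain ⟨m, hm⟩ := exists_pieceOn_le_level p lam (a := 0) (b := n) le_rfl
  -- The first summand bounds the lattices from above, the second dominates every single-column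
  -- order and so bounds them from below.
  let N : ℕ := m.natAbs + ∑ i : Fin n, (leftOrd p lam (i + 1) i).natAbs
  have hN : ∀ Y ∈ piece p lam, level n N ≤ Y ∧ Y ≤ level n (-N) := by
    intro Y hY
    rw [mem_piece_iff] at hY
    refine ⟨hY.level_le fun i => ?_, (hm Y hY).trans (level_anti (by omega))⟩
    have := Finset.single_le_sum (f := fun i : Fin n => (leftOrd p lam ((i : ℕ) + 1) i).natAbs)
      (fun _ _ => Nat.zero_le _) (Finset.mem_univ i)
    omega
  have hlat : ∀ Y ∈ piece p lam, IsLat N 0 n Y := fun Y hY =>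
    ⟨(mem_piece_iff.1 hY).stable, (mem_piece_iff.1 hY).le_cols,
      inf_le_left.trans (hN Y hY).1, (hN Y hY).2⟩
  by_cases hne : (piece p lam).Nonempty
  · obtain ⟨Y₀, hY₀⟩ := hne
    exact ⟨N, winDim N Y₀, fun Y hY => ⟨(hN Y hY).1, (hN Y hY).2,
      PieceOn.winDim_eq le_rfl (mem_piece_iff.1 hY) (mem_piece_iff.1 hY₀) (hlat Y hY)
        (hlat Y₀ hY₀)⟩⟩
  -- For an empty piece any `N` and `k` will do.
  · exact ⟨0, 0, fun Y hY => absurd ⟨Y, hY⟩ hne⟩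

theorem exists_finset_of_bounds (m : ℤ) (κ : Fin n → ℤ) :
    ∃ s : Finset (Fin n × ℤ), ∀ i j, m ≤ j → j ≤ κ i → (i, j) ∈ s := by
  refine ⟨Finset.univ.biUnion fun i => (Finset.Icc m (κ i)).image (Prod.mk i), fun i j h1 h2 => ?_⟩
  simp [h1, h2]

end Bounds

/-! ### Regularity of the generators -/

section RegularGenerators

variable {ι : Type} {τ : ι → Type} {S : Type} {e : S → MultiProj τ} {n : ℕ} {p : Picture n}
  {lam : Fin n → ℤ} {Y : S → Submodule ℂ (X n)} {l r : Fin n}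

theorem bdd_of_isGen (hY : ∀ x, PieceOn p lam 0 n (Y x)) {s : ℕ} {v : S → X n}
    (hv : ∀ x, IsGen p lam (Y x ⊓ cols n l (r + 1)) l r s (v x)) :
    ∃ s : Finset (Fin n × ℤ), ∀ x, ∀ q ∉ s, v x q = 0 := by
  obtain ⟨m, hm⟩ := exists_pieceOn_le_level p lam (a := 0) (b := n) le_rfl
  obtain ⟨F, hF⟩ := exists_finset_of_bounds m
    (fun i => if i = l then leftOrd p lam r l - s else mixOrd p lam l r i)
  refine ⟨F, fun x ⟨i, j⟩ hq => ?_⟩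
  rcases lt_or_ge j m with hj | hj
  · exact mem_level.1 (hm _ (hY x) (hv x).mem.1) i j hj
  by_cases hi : (l : ℕ) ≤ i ∧ (i : ℕ) < r + 1
  · rcases eq_or_ne i l with hil | hil
    · subst hil
      rw [(hv x).col, if_neg]
      intro hj'
      exact hq (hF i j hj (by simp [hj']))
    · by_contra hne
      refine hne ((hv x).zero i j (lt_of_le_of_ne hi.1 (Ne.symm hil)) (Nat.lt_succ_iff.1 hi.2) ?_)
      by_contra hlt
      exact hq (hF i j hj (by rw [if_neg hil]; omega))
  · exact mem_cols.1 (hv x).mem.2 i j hi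

/-- The positions in which the definition of a generator prescribes constants already determine it.
-/
theorem RegChart.regVec_of_isGen (hlr : l < r) (hY : ∀ x, PieceOn p lam 0 n (Y x))
    {J : Set (Fin n × ℤ)} (hJ : RegChart e Y J) {s : ℕ} {v : S → X n}
    (hv : ∀ x, IsGen p lam (Y x ⊓ cols n l (r + 1)) l r s (v x)) : RegVec e v := by
  have hlr' : (l : ℕ) < r := hlr
  have hrn := r.2
  refine hJ.regVec_of_determining (fun x => (hv x).mem.1) (bdd_of_isGen hY hv)
    (Q := chartSet (l + 1) (r + 1) (mixOrd p lam l r) ∪ {q | q.1 = l} ∪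
      {q | ¬ ((l : ℕ) ≤ q.1 ∧ (q.1 : ℕ) < r + 1)}) ?_ ?_
  · intro x z hz hzQ
    have hB := ((hY x).inf_cols (Nat.zero_le ((l : ℕ) + 1)) (by omega)).isChart_mixOrd hlr
    refine hB.1 z ⟨hz, mem_cols_succ rfl (mem_cols.2 fun i j hi => hzQ _ (Or.inr hi))
      fun j => hzQ _ (Or.inl (Or.inr rfl))⟩ fun q hq => hzQ q (Or.inl (Or.inl hq))
  · rintro ⟨i, j⟩ ((⟨h1, h2, h3⟩ | rfl) | hq)
    · simp only [fun x => (hv x).zero i j h1 (Nat.lt_succ_iff.1 h2) h3]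
      exact const_mem_regAlg 0
    · simp only [fun x => (hv x).col j]
      exact const_mem_regAlg _
    · simp only [fun x => mem_cols.1 (hv x).mem.2 i j hq]
      exact const_mem_regAlg 0

/-- If the coordinates of the lattices `Y x` are regular, so are the lattices. -/
theorem regChart_of_hasCoords (hY : ∀ x, PieceOn p lam 0 n (Y x))
    {ξ : S → Fin n → Fin n → ℕ → Fin n → ℂ} (hξ : ∀ x, HasCoords p lam (ξ x) 0 n (Y x))
    (hreg : ∀ (l r : Fin n) (s : ℕ) (i : Fin n), l < r → s < loops p l r → l < i → i ≤ r →
      (fun x => ξ x l r s i) ∈ regAlg e) {a b : ℕ} (hb : b ≤ n) :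
    RegChart e (fun x => Y x ⊓ cols n a b) (chartSet a b (leftOrd p lam b)) := by
  have hP : ∀ x {a b : ℕ}, b ≤ n → PieceOn p lam a b (Y x ⊓ cols n a b) := fun x _ _ hb =>
    (hY x).inf_cols (Nat.zero_le _) hb
  have hins : ∀ {a b : ℕ} (c : Fin n), (c : ℕ) = a → a < b → b ≤ n →
      RegChart e (fun x => Y x ⊓ cols n (a + 1) b) (chartSet (a + 1) b (leftOrd p lam b)) →
      ∀ g : S → X n, RegVec e g → (∀ x, g x ∈ Y x ⊓ cols n a b) →
      (∀ x j, g x (c, j) = if j = leftOrd p lam b c then 1 else 0) →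
      RegChart e (fun x => Y x ⊓ cols n a b) (chartSet a b (leftOrd p lam b)) := by
    rintro a b c rfl hcb hb h g hg hgY hgc
    rw [chartSet_eq_union _ c rfl hcb]
    refine RegChart.insert_column (fun x => (hP x hb).stable)
      (fun x => (hY x).left c b (Nat.zero_le _) hcb hb) ?_ hg hgY hgc
    convert h using 2 with x
    rw [inf_ker_colProj_left inf_le_right c rfl, inf_cols_inf_cols _ (Nat.le_succ _) le_rfl]
  induction hd : b - a using Nat.strong_induction_on generalizing a b with
  | _ d ih =>
    rcases le_or_gt b a with hab | hab
    · refine ⟨fun x => (hP x hb).isChart hb, fun u v _ hv _ => ?_⟩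
      have : v = fun _ => 0 := by
        ext1 x
        have := (hv x).2
        rw [cols_eq_bot hab] at this
        exact this
      rw [this]
      exact RegVec.const 0
    rcases eq_or_ne b (a + 1) with rfl | hab'
    · let c : Fin n := ⟨a, hb⟩
      refine hins c rfl hab hb (ih 0 (by omega) hb (by omega))
        (fun _ => vec c (leftOrd p lam (a + 1) c)) (RegVec.const _) (fun x => ?_) (fun x j => ?_)
      · refine ⟨(vec_mem_iff ((hY x).left c (a + 1) (Nat.zero_le _) hab hb) _).2 le_rfl, ?_⟩
        refine mem_cols.2 fun i j hi => ?_
        rw [vec_apply, if_neg]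
        rintro ⟨rfl, -⟩
        exact hi ⟨le_rfl, hab⟩
      · simp [vec_apply]
    · obtain ⟨r', rfl⟩ : ∃ r, b = r + 1 := ⟨b - 1, by omega⟩
      let l : Fin n := ⟨a, by omega⟩
      let r : Fin n := ⟨r', hb⟩
      have hlr' : (l : ℕ) < r := by change a < r'; omega
      have hlr : l < r := hlr'
      have hA : RegChart e (fun x => Y x ⊓ cols n l r) (chartSet l r (leftOrd p lam r)) :=
        ih (r' - a) (by omega) (a := a) (b := r') (by omega) rfl
      have hB : RegChart e (fun x => Y x ⊓ cols n (l + 1) (r + 1))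
          (chartSet (l + 1) (r + 1) (leftOrd p lam (r + 1))) :=
        ih (r' + 1 - (a + 1)) (by omega) (a := a + 1) (b := r' + 1) hb rfl
      have hC : ∀ x, PieceOn p lam l (r + 1) (Y x ⊓ cols n l (r + 1)) := fun x => hP x hb
      choose v hv using fun (s : Fin (loops p l r + 1)) (x : S) =>
        (hC x).exists_isGen hlr (Nat.lt_succ_iff.1 s.2)
      have hreg' : ∀ (s : ℕ) (hs : s < loops p l r + 1), RegVec e (v ⟨s, hs⟩) := by
        intro s
        induction s with
        | zero =>
          intro hs
          refine hA.regVec (fun _ => vec l (leftOrd p lam r l)) _ (RegVec.const _)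
            (fun x => ⟨(hv ⟨0, hs⟩ x).mem.1, (hv ⟨0, hs⟩ x).mem_cols_of_zero hlr (hC x)⟩) ?_
          rintro x ⟨i, j⟩ ⟨h1, h2, h3⟩
          rcases eq_or_ne i l with rfl | hil
          · rw [(hv ⟨0, hs⟩ x).col, vec_apply]
            simp
          · have hir : i ≠ r := by rintro rfl; exact lt_irrefl _ h2
            rw [vec_apply, if_neg fun h => hil h.1]
            refine (hv ⟨0, hs⟩ x).zero i j (lt_of_le_of_ne h1 (Ne.symm hil)) h2.le ?_
            rwa [mixOrd, if_neg hir]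
        | succ s ih' =>
          intro hs
          have h0 := ih' (by omega)
          set w := v ⟨s, by omega⟩ with hw
          set w' := v ⟨s + 1, hs⟩ with hw'
          have hgw : ∀ x, IsGen p lam (Y x ⊓ cols n l (r + 1)) l r s (w x) := hv ⟨s, by omega⟩
          have hgw' : ∀ x, IsGen p lam (Y x ⊓ cols n l (r + 1)) l r (s + 1) (w' x) := hv ⟨s + 1, hs⟩
          have hmem : ∀ x, t n (w' x) - w x ∈ Y x ⊓ cols n (l + 1) (r + 1) := by
            intro x
            have := (hgw x).t_sub_mem (hC x) (hgw' x)
            rwa [inf_cols_inf_cols _ (Nat.le_succ _) le_rfl] at this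
          -- The inductive chart `hB` uses the orders `leftOrd p lam (r + 1)`, whereas this vector
          -- is known in the positions of `mixOrd`. Both sets determine vectors without column `l`,
          -- so the change between them is regular.
          have hd : RegVec e fun x => t n (w' x) - w x := by
            refine hB.regVec_of_determining hmem ?_
              (Q := chartSet (l + 1) (r + 1) (mixOrd p lam l r)) ?_ ?_
            · classical
              obtain ⟨F, hF⟩ := bdd_of_isGen hY hgw'
              obtain ⟨F', hF'⟩ := h0.bdd
              refine ⟨F.image (fun q => (q.1, q.2 + 1)) ∪ F', fun x ⟨i, j⟩ hq => ?_⟩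
              rw [Finset.mem_union, not_or] at hq
              rw [Finsupp.sub_apply, hF' x _ hq.2, t_apply, hF x, sub_zero]
              exact fun h => hq.1 (Finset.mem_image.2 ⟨_, h, by simp⟩)
            · intro x
              exact ((hP x (a := l + 1) hb).isChart_mixOrd hlr).1
            · rintro ⟨i, j⟩ ⟨h1, h2, h3⟩
              have h2' := Nat.lt_succ_iff.1 h2
              simp only [fun x => (hgw x).t_sub_apply (hgw' x) h1 h2' h3]
              split_ifs with hj
              · have hx : ∀ x, w' x (i, mixOrd p lam l r i - 1) = ξ x l r s i := by
                  intro x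
                  obtain ⟨y, hy, hyξ⟩ := hξ x l r (Nat.zero_le _) hlr r.2 s (by omega)
                  rw [(hgw' x).unique hlr (hC x) hy, hyξ i h1 h2']
                simp only [hx]
                exact hreg l r s i hlr (by omega) h1 h2'
              · exact const_mem_regAlg 0
          have := (hd.add h0).sh (-1)
          simpa [t_eq_sh, sh_sh, sh_zero] using this
      refine hins l rfl hab hb hB (v (Fin.last _)) (hreg' _ _) (fun x => (hv _ x).mem)
        (fun x j => ?_)
      have := (hv (Fin.last _) x).col j
      rw [Fin.val_last] at this
      rw [this, ← leftOrd_succ hlr']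

end RegularGenerators

/-! ### The window and the Plücker chart of a piece -/

section WindowChart

variable {n : ℕ}

/-- Extension by zero from the window. -/
def winIncl (n N : ℕ) : (Window n N → ℂ) →ₗ[ℂ] X n :=
  (Finsupp.lmapDomain ℂ ℂ fun q : Window n N => (q.1, (q.2 : ℤ))).comp
    (Finsupp.linearEquivFunOnFinite ℂ ℂ (Window n N)).symm.toLinearMap

theorem winIncl_apply_of_mem {N : ℕ} (w : Window n N → ℂ) (q : Window n N) :
    winIncl n N w (q.1, q.2) = w q := by
  have hinj : Function.Injective fun q : Window n N => (q.1, (q.2 : ℤ)) := by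
    rintro ⟨i, j⟩ ⟨i', j'⟩ h
    obtain ⟨h1, h2⟩ := Prod.mk.inj h
    exact Prod.ext h1 (Subtype.ext h2)
  exact Finsupp.mapDomain_apply hinj _ q

theorem winIncl_apply_of_notMem {N : ℕ} (w : Window n N → ℂ) (i : Fin n) {j : ℤ}
    (hj : ¬ (-(N : ℤ) ≤ j ∧ j < N)) : winIncl n N w (i, j) = 0 := by
  refine Finsupp.mapDomain_of_notMem_range _ _ ?_
  rintro ⟨⟨i', j', hj'⟩, h⟩
  simp only [Prod.mk.injEq] at h
  rw [h.2, Finset.mem_Ico] at hj'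
  exact hj hj'

theorem toWindow_winIncl {N : ℕ} (w : Window n N → ℂ) : toWindow n N (winIncl n N w) = w := by
  ext q
  exact winIncl_apply_of_mem w q

theorem sub_winIncl_mem_level {N : ℕ} {y : X n} (hy : y ∈ level n (-N)) :
    y - winIncl n N (toWindow n N y) ∈ level n N := by
  refine mem_level.2 fun i j hj => ?_
  rw [Finsupp.sub_apply]
  rcases lt_or_ge j (-N : ℤ) with hj' | hj'
  · rw [mem_level.1 hy i j hj', winIncl_apply_of_notMem _ _ (by omega), sub_zero]
  · have := winIncl_apply_of_mem (toWindow n N y) (i, ⟨j, Finset.mem_Ico.2 ⟨hj', hj⟩⟩)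
    dsimp only at this
    rw [this, toWindow_apply, sub_self]

theorem winIncl_mem_iff {N : ℕ} {Y : Submodule ℂ (X n)} (h1 : level n N ≤ Y)
    (h2 : Y ≤ level n (-N)) {w : Window n N → ℂ} :
    winIncl n N w ∈ Y ↔ w ∈ Y.map (toWindow n N) := by
  constructor
  · intro h
    exact ⟨_, h, toWindow_winIncl w⟩
  · rintro ⟨y, hy, rfl⟩
    have := Y.sub_mem hy (h1 (sub_winIncl_mem_level (h2 hy)))
    rwa [sub_sub_cancel] at this

variable {p : Picture n} {lam : Fin n → ℤ}

/-- The positions of the window in the chart of a piece. -/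
abbrev ChartWindow (p : Picture n) (lam : Fin n → ℤ) (N : ℕ) : Type :=
  {q : Window n N // leftOrd p lam n q.1 ≤ q.2}

theorem PieceOn.isLat_of_inGrass {N k : ℕ} {Y : Submodule ℂ (X n)} (hY : PieceOn p lam 0 n Y)
    (h : InGrass N k Y) : IsLat N 0 n Y :=
  ⟨hY.stable, hY.le_cols, inf_le_left.trans h.1, h.2.1⟩

theorem PieceOn.leftOrd_le {N k : ℕ} {Y : Submodule ℂ (X n)} (hY : PieceOn p lam 0 n Y)
    (h : InGrass N k Y) (i : Fin n) : leftOrd p lam n i ≤ N :=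
  (((hY.isLat_of_inGrass h).inf_cols (Nat.zero_le i) le_rfl).hasOrd_bounds le_rfl i.2
    (hY.left i n (Nat.zero_le _) i.2 le_rfl)).2

theorem PieceOn.eq_zero_of_chartWindow {N k : ℕ} {Y : Submodule ℂ (X n)}
    (hY : PieceOn p lam 0 n Y) (h : InGrass N k Y) {w : Window n N → ℂ}
    (hw : w ∈ Y.map (toWindow n N)) (h0 : ∀ q : ChartWindow p lam N, w q = 0) : w = 0 := by
  have h1 := (winIncl_mem_iff h.1 h.2.1).2 hw
  have h2 := (hY.isChart le_rfl).1 _ h1 (by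
    rintro ⟨i, j⟩ ⟨-, -, hij⟩
    by_cases hj : -(N : ℤ) ≤ j ∧ j < N
    · have hj' : j ∈ Finset.Ico (-(N : ℤ)) N := Finset.mem_Ico.2 hj
      have h3 := h0 ⟨(i, ⟨j, hj'⟩), hij⟩
      rw [← h3]
      exact winIncl_apply_of_mem w (i, ⟨j, hj'⟩)
    · exact winIncl_apply_of_notMem _ _ hj)
  rw [← toWindow_winIncl w, h2, map_zero]

/-- A vector of the image in the window is freely and uniquely given by its coordinates in the chart
positions of the window. -/
theorem PieceOn.card_chartWindow {N k : ℕ} {Y : Submodule ℂ (X n)} (hY : PieceOn p lam 0 n Y)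
    (h : InGrass N k Y) : Fintype.card (ChartWindow p lam N) = k := by
  let f : Y.map (toWindow n N) →ₗ[ℂ] (ChartWindow p lam N → ℂ) :=
    (LinearMap.funLeft ℂ ℂ Subtype.val).comp (Submodule.subtype _)
  have hinj : Function.Injective f := by
    rw [← LinearMap.ker_eq_bot, LinearMap.ker_eq_bot']
    rintro ⟨w, hw⟩ h0
    exact Subtype.ext (hY.eq_zero_of_chartWindow h hw fun q => congrFun h0 q)
  have hsurj : Function.Surjective f := by
    intro u
    obtain ⟨y, hy, hyu⟩ := (hY.isChart le_rfl).2
      (winIncl n N fun q => if hq : leftOrd p lam n q.1 ≤ q.2 then u ⟨q, hq⟩ else 0)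
    refine ⟨⟨_, Submodule.mem_map_of_mem hy⟩, ?_⟩
    ext ⟨q, hq⟩
    change y (q.1, (q.2 : ℤ)) = u ⟨q, hq⟩
    rw [hyu (q.1, (q.2 : ℤ)) (mem_chartSet.2 ⟨Nat.zero_le _, q.1.2, hq⟩), winIncl_apply_of_mem,
      dif_pos hq]
  have := (LinearEquiv.ofBijective f ⟨hinj, hsurj⟩).finrank_eq
  rw [h.2.2, Module.finrank_fintype_fun_eq_card] at this
  exact this.symm

/-- A piece lies in one chart of the Grassmannian. -/
theorem PieceOn.exists_chart {N k : ℕ} {Y : Submodule ℂ (X n)} (hY : PieceOn p lam 0 n Y)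
    (h : InGrass N k Y) : ∃ I₀ : Fin k → Window n N,
      (∀ a, leftOrd p lam n (I₀ a).1 ≤ (I₀ a).2) ∧
      (∀ a b, I₀ a = I₀ b → a = b) ∧
      ∀ Y' : Submodule ℂ (X n), PieceOn p lam 0 n Y' → InGrass N k Y' →
        ∀ w ∈ Y'.map (toWindow n N), (∀ a, w (I₀ a) = 0) → w = 0 := by
  let f := (Fintype.equivFinOfCardEq (hY.card_chartWindow h)).symm
  refine ⟨fun a => f a, fun a => (f a).2, fun a b hab => f.injective (Subtype.ext hab),
    fun Y' hY' h' w hw h0 => hY'.eq_zero_of_chartWindow h' hw fun q => ?_⟩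
  have := h0 (f.symm q)
  dsimp only at this
  rwa [f.apply_symm_apply] at this

/-- The lattices of a piece depend regularly on their Plücker coordinates. -/
theorem regChart_pluckerEmb {N k : ℕ} (hM : ∀ Y ∈ piece p lam, InGrass N k Y) :
    RegChart (pluckerEmb hM) (fun Y : piece p lam => (Y : Submodule ℂ (X n)))
      (chartSet 0 n (leftOrd p lam n)) := by
  classical
  have hP : ∀ Y : piece p lam, PieceOn p lam 0 n (Y : Submodule ℂ (X n)) :=
    fun Y => mem_piece_iff.1 Y.2
  refine ⟨fun Y => (hP Y).isChart le_rfl, fun u v hu hv huv => ?_⟩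
  rcases isEmpty_or_nonempty (piece p lam) with hemp | ⟨⟨Y₀⟩⟩
  · exact ⟨fun q x => hemp.elim x, ∅, fun x => hemp.elim x⟩
  obtain ⟨I₀, hI₀, -, hI₀W⟩ := (hP Y₀).exists_chart (hM Y₀ Y₀.2)
  choose A hA hAW using fun Y : piece p lam =>
    exists_isReduced (hM Y Y.2).2.2 (hI₀W Y (hP Y) (hM Y Y.2))
  have hrep := fun Y : piece p lam => (hA Y).rep_pluckerPoint (hM Y Y.2).2.2 (hAW Y) ()
  -- An entry of the reduced basis is a quotient of two Plücker coordinates: one position of `I₀` is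
  -- replaced in the numerator.
  have hAreg : ∀ a q, (fun Y => A Y a q) ∈ regAlg (pluckerEmb hM) := by
    intro a q
    have := coord_div_mem_regAlg (e := pluckerEmb hM) () (Function.update I₀ a q) I₀
      (fun Y => (hrep Y).1)
    convert this using 2 with Y
    have h1 := (hrep Y).2 (Function.update I₀ a q)
    rw [(hA Y).minor_update] at h1
    change A Y a q = (pluckerPoint _ (hM Y Y.2).2.2 ()).rep (Function.update I₀ a q) /
      (pluckerPoint _ (hM Y Y.2).2.2 ()).rep I₀
    rw [h1, mul_div_cancel_left₀ _ (hrep Y).1]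
  constructor
  · rintro ⟨i, j⟩
    rcases le_or_gt (leftOrd p lam n i) j with hj | hj
    · have : (fun Y => v Y (i, j)) = fun Y => u Y (i, j) :=
        funext fun Y => huv Y (i, j) (mem_chartSet.2 ⟨Nat.zero_le _, i.2, hj⟩)
      rw [this]
      exact hu.coord _
    rcases lt_or_ge j (-N : ℤ) with hj' | hj'
    · have : (fun Y => v Y (i, j)) = fun _ => 0 :=
        funext fun Y => mem_level.1 ((hM Y Y.2).2.1 (hv Y)) i j hj'
      rw [this]
      exact const_mem_regAlg 0
    have hjN : j < N := hj.trans_le ((hP Y₀).leftOrd_le (hM Y₀ Y₀.2) i)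
    have hjW : j ∈ Finset.Ico (-(N : ℤ)) N := Finset.mem_Ico.2 ⟨hj', hjN⟩
    have : (fun Y => v Y (i, j)) =
        ∑ a, (fun Y => u Y ((I₀ a).1, ((I₀ a).2 : ℤ))) * (fun Y => A Y a (i, ⟨j, hjW⟩)) := by
      ext Y
      have h1 : v Y (i, j) = (∑ a, toWindow n N (v Y) (I₀ a) • A Y a) (i, ⟨j, hjW⟩) :=
        congrFun ((hA Y).sum_eq (hAW Y) (hI₀W Y (hP Y) (hM Y Y.2))
          (Submodule.mem_map_of_mem (hv Y))) (i, ⟨j, hjW⟩)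
      rw [h1, Finset.sum_apply, Finset.sum_apply]
      refine Finset.sum_congr rfl fun a _ => ?_
      rw [Pi.smul_apply, Pi.mul_apply, smul_eq_mul, toWindow_apply,
        huv Y ((I₀ a).1, ((I₀ a).2 : ℤ)) (mem_chartSet.2 ⟨Nat.zero_le _, (I₀ a).1.2, hI₀ a⟩)]
    rw [this]
    exact Subalgebra.sum_mem _ fun a _ => Subalgebra.mul_mem _ (hu.coord _) (hAreg _ _)
  · obtain ⟨s, hs⟩ := hu.bdd
    obtain ⟨F, hF⟩ := exists_finset_of_bounds (-N) (leftOrd p lam n)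
    refine ⟨s ∪ F, fun Y ⟨i, j⟩ hq => ?_⟩
    rw [Finset.mem_union, not_or] at hq
    rcases le_or_gt (leftOrd p lam n i) j with hj | hj
    · rw [huv Y (i, j) (mem_chartSet.2 ⟨Nat.zero_le _, i.2, hj⟩)]
      exact hs Y _ hq.1
    · refine mem_level.1 ((hM Y Y.2).2.1 (hv Y)) i j ?_
      by_contra hlt
      exact hq.2 (hF i j (by omega) hj.le)

/-- Regular families of lattices in a piece have regular Plücker coordinates. -/
theorem isRegularMap_pluckerEmb {ι : Type} {τ : ι → Type} {S : Type} {e : S → MultiProj τ}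
    {N k : ℕ} (hM : ∀ Y ∈ piece p lam, InGrass N k Y) (f : S → piece p lam)
    (hf : RegChart e (fun x => (f x : Submodule ℂ (X n))) (chartSet 0 n (leftOrd p lam n))) :
    IsRegularMap e (pluckerEmb hM) f := by
  have hP : ∀ Y : piece p lam, PieceOn p lam 0 n (Y : Submodule ℂ (X n)) :=
    fun Y => mem_piece_iff.1 Y.2
  rcases isEmpty_or_nonempty S with hemp | ⟨⟨x₀⟩⟩
  · exact fun x => hemp.elim x
  obtain ⟨I₀, hI₀, hinj, -⟩ := (hP (f x₀)).exists_chart (hM _ (f x₀).2)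
  -- The vectors dual to the chart positions in the window give a reduced basis, regular because its
  -- chart coordinates are constant.
  choose b hb hbJ using fun (a : Fin k) (x : S) => (hf.isChart x).2 (vec (I₀ a).1 (I₀ a).2)
  have hbreg : ∀ a, RegVec e (b a) := fun a =>
    hf.regVec (fun _ => vec (I₀ a).1 (I₀ a).2) _ (RegVec.const _) (hb a) (hbJ a)
  have hred : ∀ x, IsReduced I₀ fun a => toWindow n N (b a x) := by
    intro x a a'
    dsimp only
    rw [toWindow_apply, hbJ a x ((I₀ a').1, ((I₀ a').2 : ℤ))
      (mem_chartSet.2 ⟨Nat.zero_le _, (I₀ a').1.2, hI₀ a'⟩), vec_apply]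
    refine if_congr ⟨fun h => hinj _ _ (Prod.ext h.1.symm (Subtype.ext h.2.symm)), ?_⟩ rfl rfl
    rintro rfl
    exact ⟨rfl, rfl⟩
  refine isRegularMap_of_mem_regAlg _ _ (fun _ x => minor fun a => toWindow n N (b a x))
    (fun _ I => det_mem_regAlg fun a a' => (hbreg a).coord _) fun _ x =>
    ⟨minor_basis_ne_zero (hred x).linearIndependent, ?_⟩
  exact exists_rep_pluckerPoint _ (hred x).linearIndependent
    (fun a => Submodule.mem_map_of_mem (hb a x)) _

end WindowChart

/-! ### The bijection -/

section Bijection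

variable {n : ℕ} {p : Picture n} {lam : Fin n → ℤ}

/-- The right end of `L`, as a column of `L`. -/
def rightCol (L : Loop p) : Cols L :=
  ⟨L.1.right, L.1.2.le, le_rfl⟩

theorem leftCol_ne_rightCol (L : Loop p) : leftCol L ≠ rightCol L := fun h =>
  L.1.2.ne (congrArg Subtype.val h)

/-- A loop with the same ends just inside `L` is the largest candidate. If `L` is innermost among
its copies, a loop inside it with the same right end starts further right. -/
theorem pivot_eq_leftCol_iff (L : Loop p) : pivot L = leftCol L ↔ (L.2 : ℕ) ≠ 0 := by
  obtain ⟨R, s⟩ := L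
  constructor
  · intro h h0
    rw [pivot] at h
    split_ifs at h with hM
    · obtain ⟨h1, h2, -⟩ := hM.choose_spec
      have h3 : hM.choose.1.left = R.left := congrArg Subtype.val h
      rcases h1 with h1 | h1
      · exact h1.2.2 (Subtype.ext (Prod.ext h3 h2))
      · have := h1.2
        dsimp only at this h0
        omega
    · exact leftCol_ne_rightCol _ h.symm
  · intro h0
    dsimp only at h0
    let M₀ : Loop p := ⟨R, ⟨s - 1, by omega⟩⟩
    have hM₀ : IsLargestInner ⟨R, s⟩ M₀ := by
      refine ⟨Or.inr ⟨rfl, by change (s : ℕ) - 1 < s; omega⟩, rfl, ?_⟩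
      rintro ⟨R', s'⟩ (h | ⟨h, h'⟩) _
      · exact Or.inr (Or.inl h)
      · dsimp only at h h'
        subst h
        rcases eq_or_ne (s' : ℕ) (s - 1) with hs | hs
        · exact Or.inl (Sigma.ext rfl (heq_of_eq (Fin.ext hs)))
        · exact Or.inr (Or.inr ⟨rfl, by change (s' : ℕ) < s - 1; omega⟩)
    have hM : ∃ M, IsLargestInner ⟨R, s⟩ M := ⟨M₀, hM₀⟩
    rw [pivot, dif_pos hM]
    obtain ⟨h1, h2, h3⟩ := hM.choose_spec
    refine Subtype.ext ?_
    change hM.choose.1.left = R.left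
    have hge : R.left ≤ hM.choose.1.left := by
      rcases h1 with h1 | h1
      · exact h1.1
      · exact (congrArg Root.left h1.1).ge
    refine le_antisymm ?_ hge
    rcases h3 M₀ hM₀.1 rfl with h | h | h
    · exact (congrArg (fun M : Loop p => M.1.left) h).ge
    · exact h.1
    · exact (congrArg Root.left h.1).ge

open Classical in
/-- The transposition of the pivot and the right end, except when the pivot is the left end. -/
def colPerm (L : Loop p) : Equiv.Perm (Cols L) :=
  if pivot L = leftCol L then Equiv.refl _ else Equiv.swap (pivot L) (rightCol L)

theorem colPerm_leftCol (L : Loop p) : colPerm L (leftCol L) = leftCol L := by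
  classical
  rw [colPerm]
  split_ifs with h
  · rfl
  · rw [Equiv.swap_apply_of_ne_of_ne (Ne.symm h) (leftCol_ne_rightCol L)]

theorem colPerm_symm_leftCol (L : Loop p) : (colPerm L).symm (leftCol L) = leftCol L := by
  rw [Equiv.symm_apply_eq, colPerm_leftCol]

theorem colPerm_pivot (L : Loop p) (h : (L.2 : ℕ) = 0) : colPerm L (pivot L) = rightCol L := by
  classical
  rw [colPerm, if_neg (by rw [pivot_eq_leftCol_iff]; simpa using h), Equiv.swap_apply_left]

theorem mem_openPP_iff {x : PP p} :
    x ∈ openPP p ↔ ∀ L, (x L).rep (leftCol L) ≠ 0 ∧ (x L).rep (pivot L) ≠ 0 := by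
  have key : ∀ (L : Loop p) (k : Cols L),
      (x L).submodule.map (LinearMap.proj k : (Cols L → ℂ) →ₗ[ℂ] ℂ) ≠ ⊥ ↔ (x L).rep k ≠ 0 := by
    intro L k
    rw [Projectivization.submodule_eq, Submodule.map_span, Set.image_singleton, Ne,
      Submodule.span_singleton_eq_bot]
    rfl
  rw [openPP, Set.mem_ofPred_eq]
  simp only [key]

theorem isZariskiOpen_openPP (p : Picture n) : IsZariskiOpen (openPP p) := by
  let F : MvPolynomial (Σ L : Loop p, Cols L) ℂ :=
    ∏ L, (MvPolynomial.X ⟨L, leftCol L⟩ * MvPolynomial.X ⟨L, pivot L⟩)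
  have hF : IsMultiHom F _ := MvPolynomial.IsWeightedHomogeneous.prod Finset.univ _ _
    fun L _ => (isMultiHom_X ⟨L, leftCol L⟩).mul (isMultiHom_X ⟨L, pivot L⟩)
  convert isZariskiOpen_ne_zero hF using 1
  ext x
  simp only [mem_openPP_iff, Set.mem_ofPred_eq, F, evalAt_prod, evalAt_mul, Finset.prod_ne_zero_iff,
    Finset.mem_univ, true_imp_iff, mul_ne_zero_iff]
  simp [evalAt]

/-- The chosen generator. -/
def genOf (p : Picture n) (lam : Fin n → ℤ) (Y : Submodule ℂ (X n)) (l r : Fin n) (s : ℕ) : X n :=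
  open Classical in
  if h : ∃ y, IsGen p lam (Y ⊓ cols n l (r + 1)) l r s y then h.choose else 0

theorem PieceOn.isGen_genOf {Y : Submodule ℂ (X n)} (hY : PieceOn p lam 0 n Y) {l r : Fin n}
    (hlr : l < r) {s : ℕ} (hs : s ≤ loops p l r) :
    IsGen p lam (Y ⊓ cols n l (r + 1)) l r s (genOf p lam Y l r s) := by
  have h := (hY.inf_cols (Nat.zero_le l) r.2).exists_isGen hlr hs
  rw [genOf, dif_pos h]
  exact h.choose_spec

open Classical in
/-- The coordinates of a lattice that belong to the loop `L`. -/
def loopCoord (lam : Fin n → ℤ) (Y : Submodule ℂ (X n)) (L : Loop p) (k : Cols L) : ℂ :=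
  if k = leftCol L then 1 else
    genOf p lam Y L.1.left L.1.right (L.2 + 1) (k, mixOrd p lam L.1.left L.1.right k - 1)

theorem loopCoord_leftCol (Y : Submodule ℂ (X n)) (L : Loop p) :
    loopCoord lam Y L (leftCol L) = 1 := if_pos rfl

theorem loopCoord_ne_zero (Y : Submodule ℂ (X n)) (L : Loop p) :
    (fun k => loopCoord lam Y L (colPerm L k)) ≠ 0 := by
  intro h
  have := congrFun h (leftCol L)
  simp only [colPerm_leftCol, loopCoord_leftCol, Pi.zero_apply] at this
  exact one_ne_zero this

/-- The family of lines that belongs to a lattice. -/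
def toPP (lam : Fin n → ℤ) (Y : Submodule ℂ (X n)) : PP p := fun L =>
  Projectivization.mk ℂ (fun k => loopCoord lam Y L (colPerm L k)) (loopCoord_ne_zero Y L)

/-- The affine coordinates of a point of `ℙ^p`. -/
def affCoord (x : PP p) (L : Loop p) (k : Cols L) : ℂ :=
  (x L).rep ((colPerm L).symm k) / (x L).rep (leftCol L)

theorem exists_toPP_rep (Y : Submodule ℂ (X n)) (L : Loop p) :
    ∃ a : ℂ, a ≠ 0 ∧ ∀ k, (toPP (p := p) lam Y L).rep k = a * loopCoord lam Y L (colPerm L k) := by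
  obtain ⟨a, ha⟩ := Projectivization.exists_smul_eq_mk_rep ℂ
    (fun k => loopCoord lam Y L (colPerm L k)) (loopCoord_ne_zero (lam := lam) Y L)
  exact ⟨a, a.ne_zero, fun k => (congrFun ha k).symm⟩

theorem affCoord_toPP (Y : Submodule ℂ (X n)) (L : Loop p) (k : Cols L) :
    affCoord (toPP lam Y) L k = loopCoord lam Y L k := by
  obtain ⟨a, ha, h⟩ := exists_toPP_rep (lam := lam) Y L
  rw [affCoord, h, h, Equiv.apply_symm_apply, colPerm_leftCol, loopCoord_leftCol, mul_one,
    mul_div_cancel_left₀ _ ha]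

/-- For the innermost copy the pivot coordinate is the last coordinate of the first generator,
nonzero by `IsGen.apply_ne_zero`; for the other copies it is the normalized left coordinate. -/
theorem toPP_mem {Y : Submodule ℂ (X n)} (hY : Y ∈ piece p lam) : toPP lam Y ∈ openPP p := by
  rw [mem_piece_iff] at hY
  rw [mem_openPP_iff]
  intro L
  obtain ⟨a, ha, h⟩ := exists_toPP_rep (lam := lam) Y L
  rw [h, h, colPerm_leftCol, loopCoord_leftCol]
  refine ⟨by simpa using ha, mul_ne_zero ha ?_⟩
  by_cases h0 : (L.2 : ℕ) = 0
  · rw [colPerm_pivot L h0, loopCoord, if_neg (leftCol_ne_rightCol L).symm, h0]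
    have hs : 0 + 1 ≤ loops p L.1.left L.1.right := by
      rw [loops_root]
      have := L.2.2
      omega
    exact (hY.isGen_genOf L.1.2 hs).apply_ne_zero L.1.2 (hY.inf_cols (Nat.zero_le _) L.1.right.2)
  · rw [(pivot_eq_leftCol_iff L).2 h0, colPerm_leftCol, loopCoord_leftCol]
    exact one_ne_zero

theorem lt_of_lt_loops {l r : Fin n} (h : l < r) {s : ℕ} (hs : s < loops p l r) :
    s < p ⟨(l, r), h⟩ := by
  rwa [← loops_root p ⟨(l, r), h⟩]

/-- The affine coordinates of a point of `ℙ^p`, indexed by numbers. -/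
def coordFn (x : PP p) (l r : Fin n) (s : ℕ) (i : Fin n) : ℂ :=
  open Classical in
  if h : ∃ hlr : l < r, s < p ⟨(l, r), hlr⟩ ∧ l ≤ i ∧ i ≤ r then
    affCoord x ⟨⟨(l, r), h.1⟩, ⟨s, h.2.1⟩⟩ ⟨i, h.2.2⟩ else 0

theorem coordFn_eq (x : PP p) {l r : Fin n} {s : ℕ} {i : Fin n} (hlr : l < r)
    (hs : s < p ⟨(l, r), hlr⟩) (hi : l ≤ i ∧ i ≤ r) :
    coordFn x l r s i = affCoord x ⟨⟨(l, r), hlr⟩, ⟨s, hs⟩⟩ ⟨i, hi⟩ :=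
  dif_pos ⟨hlr, hs, hi⟩

theorem hasCoords_toPP {Y : Submodule ℂ (X n)} (hY : Y ∈ piece p lam) :
    HasCoords p lam (coordFn (p := p) (toPP lam Y)) 0 n Y := by
  rw [mem_piece_iff] at hY
  intro l r _ hlr _ s hs
  refine ⟨_, hY.isGen_genOf hlr hs, fun i h1 h2 => ?_⟩
  rw [coordFn_eq _ hlr (lt_of_lt_loops hlr hs) ⟨h1.le, h2⟩, affCoord_toPP, loopCoord, if_neg]
  exact fun h => h1.ne' (congrArg Subtype.val h)

theorem toPP_injective {Y Y' : Submodule ℂ (X n)} (hY : Y ∈ piece p lam) (hY' : Y' ∈ piece p lam)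
    (h : (toPP lam Y : PP p) = toPP lam Y') : Y = Y' := by
  have h1 := hasCoords_toPP hY
  have h2 := hasCoords_toPP hY'
  rw [← h] at h2
  exact PieceOn.eq_of_hasCoords le_rfl (mem_piece_iff.1 hY) (mem_piece_iff.1 hY') h1 h2

/-- The left coordinate permits passing to affine coordinates, and the pivot condition for innermost
copies is the nonvanishing that `exists_pieceOn` requires. -/
theorem toPP_surjective {x : PP p} (hx : x ∈ openPP p) : ∃ Y ∈ piece p lam, toPP lam Y = x := by
  rw [mem_openPP_iff] at hx
  obtain ⟨Y, hY, hYξ⟩ := exists_pieceOn (p := p) (lam := lam) (coordFn x) (fun l r hlr h0 => by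
    have hs := lt_of_lt_loops hlr h0
    rw [coordFn_eq x hlr hs ⟨hlr.le, le_rfl⟩, affCoord]
    refine div_ne_zero ?_ (hx _).1
    have h1 := colPerm_pivot (p := p) ⟨⟨(l, r), hlr⟩, ⟨0, hs⟩⟩ rfl
    rw [← Equiv.eq_symm_apply] at h1
    have h2 := (hx ⟨⟨(l, r), hlr⟩, ⟨0, hs⟩⟩).2
    rw [h1] at h2
    exact h2) (a := 0) (b := n) le_rfl
  refine ⟨Y, mem_piece_iff.2 hY, funext fun L => ?_⟩
  have hL : ∀ k, loopCoord lam Y L k = affCoord x L k := by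
    intro k
    by_cases hk : k = leftCol L
    · rw [hk, loopCoord_leftCol, affCoord, colPerm_symm_leftCol, div_self (hx L).1]
    · have hlk : L.1.left < k := lt_of_le_of_ne k.2.1 fun h => hk (Subtype.ext h.symm)
      have hs : (L.2 : ℕ) < loops p L.1.left L.1.right := by
        rw [loops_root]; exact L.2.2
      obtain ⟨y, hy, hyξ⟩ := hYξ L.1.left L.1.right (Nat.zero_le _) L.1.2 L.1.right.2 L.2 hs
      rw [loopCoord, if_neg hk, (hY.isGen_genOf L.1.2 hs).unique L.1.2
        (hY.inf_cols (Nat.zero_le _) L.1.right.2) hy, hyξ k hlk k.2.2]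
      exact coordFn_eq x L.1.2 L.2.2 k.2
  rw [toPP, ← Projectivization.mk_rep (x L), Projectivization.mk_eq_mk_iff']
  refine ⟨((x L).rep (leftCol L))⁻¹, ?_⟩
  ext k
  rw [hL, affCoord, Equiv.symm_apply_apply, Pi.smul_apply, smul_eq_mul, div_eq_inv_mul]

/-- The bijection from a piece to an open subset of a product of projective spaces. -/
def pieceEquiv (p : Picture n) (lam : Fin n → ℤ) : piece p lam ≃ openPP p :=
  Equiv.ofBijective (fun Y => ⟨toPP lam Y.1, toPP_mem Y.2⟩)
    ⟨fun Y Y' h => Subtype.ext (toPP_injective Y.2 Y'.2 (congrArg Subtype.val h)), fun x => by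
      obtain ⟨Y, hY, h⟩ := toPP_surjective (lam := lam) x.2
      exact ⟨⟨Y, hY⟩, Subtype.ext h⟩⟩

theorem isRegularMap_pieceEquiv {N k : ℕ} (hM : ∀ Y ∈ piece p lam, InGrass N k Y) :
    IsRegularMap (pluckerEmb hM) (fun x : openPP p => (x : PP p)) (pieceEquiv p lam) := by
  have hP : ∀ Y : piece p lam, PieceOn p lam 0 n (Y : Submodule ℂ (X n)) :=
    fun Y => mem_piece_iff.1 Y.2
  refine isRegularMap_of_mem_regAlg _ _
    (fun L Y k => loopCoord lam (Y : Submodule ℂ (X n)) L (colPerm L k)) (fun L k => ?_)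
    (fun L Y => ⟨loopCoord_ne_zero _ L, rfl⟩)
  have hs : (L.2 : ℕ) + 1 ≤ loops p L.1.left L.1.right := by
    rw [loops_root]; exact L.2.2
  have hreg := (regChart_pluckerEmb hM).regVec_of_isGen L.1.2 hP
    fun Y => (hP Y).isGen_genOf L.1.2 hs
  simp only [loopCoord]
  split_ifs with hk
  · exact const_mem_regAlg 1
  · exact hreg.coord _

theorem isRegularMap_pieceEquiv_symm {N k : ℕ} (hM : ∀ Y ∈ piece p lam, InGrass N k Y) :
    IsRegularMap (fun x : openPP p => (x : PP p)) (pluckerEmb hM) (pieceEquiv p lam).symm := by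
  refine isRegularMap_pluckerEmb hM _ ?_
  have hξ : ∀ x : openPP p, HasCoords p lam (coordFn x.1) 0 n ((pieceEquiv p lam).symm x).1 := by
    intro x
    have h1 := hasCoords_toPP ((pieceEquiv p lam).symm x).2
    have h2 : (toPP lam ((pieceEquiv p lam).symm x).1 : PP p) = x :=
      congrArg Subtype.val ((pieceEquiv p lam).apply_symm_apply x)
    rwa [h2] at h1
  have h := regChart_of_hasCoords (e := fun x : openPP p => (x : PP p))
    (Y := fun x => ((pieceEquiv p lam).symm x).1)
    (fun x => mem_piece_iff.1 ((pieceEquiv p lam).symm x).2) hξ (fun l r s i hlr hs h1 h2 => by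
      simp only [fun x : openPP p => coordFn_eq x.1 hlr (lt_of_lt_loops hlr hs) ⟨h1.le, h2⟩,
        affCoord]
      exact coord_div_mem_regAlg (e := fun x : openPP p => (x : PP p)) _ _ _
        fun x => (mem_openPP_iff.1 x.2 _).1) (a := 0) (b := n) le_rfl
  simpa only [cols_zero_top, inf_top_eq] using h

end Bijection

/-! ### The pieces are locally closed in the Grassmannian -/

section LocallyClosed

variable {n N k : ℕ}

/-- Multiplication by `t` on `t ^ (-N) X₀ / t ^ N X₀`. -/
def shiftWin (n N : ℕ) : (Window n N → ℂ) →ₗ[ℂ] (Window n N → ℂ) :=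
  (toWindow n N).comp ((t n).comp (winIncl n N))

theorem shiftWin_apply (w : Window n N → ℂ) (q : Window n N) : shiftWin n N w q =
    if h : (q.2 : ℤ) - 1 ∈ Finset.Ico (-(N : ℤ)) (N : ℤ) then w (q.1, ⟨(q.2 : ℤ) - 1, h⟩)
      else 0 := by
  change t n (winIncl n N w) (q.1, (q.2 : ℤ)) = _
  rw [t_apply]
  split_ifs with h
  · exact winIncl_apply_of_mem w (q.1, ⟨(q.2 : ℤ) - 1, h⟩)
  · exact winIncl_apply_of_notMem w q.1 fun h' => h (Finset.mem_Ico.2 h')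

theorem toWindow_eq_zero {y : X n} (hy : y ∈ level n N) : toWindow n N y = 0 := by
  ext q
  exact mem_level.1 hy q.1 q.2 (Finset.mem_Ico.1 q.2.2).2

/-- What lies above the window stays above it under `t`, so truncation may precede the shift. -/
theorem toWindow_t {y : X n} (hy : y ∈ level n (-N)) :
    toWindow n N (t n y) = shiftWin n N (toWindow n N y) := by
  have := toWindow_eq_zero (level_stable _ _ (sub_winIncl_mem_level hy))
  rw [map_sub, map_sub, sub_eq_zero] at this
  exact this

theorem winIncl_mem_level (w : Window n N → ℂ) : winIncl n N w ∈ level n (-N) :=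
  mem_level.2 fun i _ hj => winIncl_apply_of_notMem w i (by omega)

/-- The lattice with a given image in the window. -/
def latOf (W : Submodule ℂ (Window n N → ℂ)) : Submodule ℂ (X n) :=
  W.comap (toWindow n N) ⊓ level n (-N)

theorem map_latOf (W : Submodule ℂ (Window n N → ℂ)) : (latOf W).map (toWindow n N) = W := by
  apply le_antisymm
  · rintro _ ⟨y, hy, rfl⟩
    exact hy.1
  · intro w hw
    refine ⟨winIncl n N w, ⟨?_, winIncl_mem_level w⟩, toWindow_winIncl w⟩
    change toWindow n N (winIncl n N w) ∈ W
    rwa [toWindow_winIncl]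

theorem level_le_latOf (W : Submodule ℂ (Window n N → ℂ)) : level n N ≤ latOf W := by
  intro y hy
  refine ⟨?_, level_anti (by omega) hy⟩
  change toWindow n N y ∈ W
  rw [toWindow_eq_zero hy]
  exact W.zero_mem

theorem isLat_latOf {W : Submodule ℂ (Window n N → ℂ)} (hW : ∀ w ∈ W, shiftWin n N w ∈ W) :
    IsLat N 0 n (latOf W) where
  stable y hy := by
    refine ⟨?_, level_stable _ _ hy.2⟩
    change toWindow n N (t n y) ∈ W
    rw [toWindow_t hy.2]
    exact hW _ hy.1
  le_cols := by rw [cols_zero_top]; exact le_top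
  lower := inf_le_left.trans (level_le_latOf W)
  upper := inf_le_right

/-- The positions of the window outside the columns from `a` to `b - 1`. -/
def outside (n N a b : ℕ) : Set (Window n N) :=
  {q | ¬ (a ≤ (q.1 : ℕ) ∧ (q.1 : ℕ) < b)}

theorem map_inf_cols {Y : Submodule ℂ (X n)} (h1 : level n N ≤ Y) (h2 : Y ≤ level n (-N))
    (a b : ℕ) : (Y ⊓ cols n a b).map (toWindow n N) =
      Y.map (toWindow n N) ⊓ Submodule.pi (outside n N a b) (fun _ => (⊥ : Submodule ℂ ℂ)) := by
  ext w
  rw [Submodule.mem_inf, Submodule.mem_pi]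
  constructor
  · rintro ⟨y, hy, rfl⟩
    exact ⟨Submodule.mem_map_of_mem hy.1, fun q hq => mem_cols.1 hy.2 q.1 q.2 hq⟩
  · rintro ⟨hw, hw0⟩
    refine ⟨winIncl n N w, ⟨(winIncl_mem_iff h1 h2).2 hw, mem_cols.2 fun i j hi => ?_⟩,
      toWindow_winIncl w⟩
    by_cases hj : -(N : ℤ) ≤ j ∧ j < N
    · have hj' : j ∈ Finset.Ico (-(N : ℤ)) N := Finset.mem_Ico.2 hj
      exact (winIncl_apply_of_mem w (i, ⟨j, hj'⟩)).trans (hw0 (i, ⟨j, hj'⟩) hi)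
    · exact winIncl_apply_of_notMem w i hj

variable {p : Picture n} {lam : Fin n → ℤ}

/-- Orders are differences of dimensions of intersections with intervals of columns, so these
dimensions characterize a nonempty piece among lattices with the same bounds. -/
theorem pieceOn_of_winDim_eq {Y Y₀ : Submodule ℂ (X n)} (hY₀ : PieceOn p lam 0 n Y₀)
    (h₀ : IsLat N 0 n Y₀) (h : IsLat N 0 n Y)
    (hd : ∀ a ≤ n, ∀ b ≤ n, winDim N (Y ⊓ cols n a b) = winDim N (Y₀ ⊓ cols n a b)) :
    PieceOn p lam 0 n Y := by
  refine ⟨⟨N, h⟩, fun i c hi hic hc => ?_⟩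
  have hl := h.inf_cols (Nat.zero_le (i : ℕ)) hc
  obtain ⟨o, -, -, ho⟩ := hl.exists_hasOrd i le_rfl hic
  have e := hl.winDim_left rfl hic ho
  have e₀ := (h₀.inf_cols (Nat.zero_le (i : ℕ)) hc).winDim_left rfl hic (hY₀.left i c hi hic hc)
  rw [inf_cols_inf_cols _ (Nat.le_succ _) le_rfl] at e e₀
  have d1 := hd i i.2.le c hc
  have d2 := hd (i + 1) i.2 c hc
  rw [Nat.succ_eq_add_one] at e e₀
  convert ho using 1
  omega

/-- The coordinate `p_I`. -/
def coordX (I : Fin k → Window n N) :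
    MvPolynomial (Σ _ : Unit, Fin k → Window n N) ℂ := MvPolynomial.X ⟨(), I⟩

theorem isMultiHom_coordX (I : Fin k → Window n N) :
    IsMultiHom (τ := fun _ : Unit => Fin k → Window n N) (coordX I) (Finsupp.single () 1) :=
  isMultiHom_X _

theorem evalAt_coordX (y : MultiProj fun _ : Unit => Fin k → Window n N)
    (I : Fin k → Window n N) : evalAt y (coordX I) = (y ()).rep I := by
  simp [evalAt, coordX]

theorem isMultiHom_det {ι : Type} {τ : ι → Type} {m : Type} [Fintype m] [DecidableEq m]
    {M : Matrix m m (MvPolynomial (Σ i, τ i) ℂ)} {d : ι →₀ ℕ} (hM : ∀ a b, IsMultiHom (M a b) d) :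
    IsMultiHom M.det (∑ _ : m, d) := by
  rw [Matrix.det_apply']
  refine MvPolynomial.IsWeightedHomogeneous.sum _ _ _ fun s _ => ?_
  have hc : (((s.sign : ℤ) : MvPolynomial (Σ i, τ i) ℂ)) = MvPolynomial.C ((s.sign : ℤ) : ℂ) :=
    (map_intCast _ _).symm
  rw [hc]
  exact (MvPolynomial.IsWeightedHomogeneous.prod Finset.univ _ (fun _ => d)
    fun a _ => hM _ _).C_mul _

theorem isZariskiClosed_eq {ι : Type} {τ : ι → Type} {F G : MvPolynomial (Σ i, τ i) ℂ}
    {d : ι →₀ ℕ} (hF : IsMultiHom F d) (hG : IsMultiHom G d) :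
    IsZariskiClosed {x : MultiProj τ | evalAt x F = evalAt x G} := by
  have hsub : IsMultiHom (F + MvPolynomial.C (-1) * G) d := hF.add (hG.C_mul _)
  convert isZariskiClosed_eq_zero hsub using 1
  ext x
  have : evalAt x (F + MvPolynomial.C (-1) * G) = evalAt x F - evalAt x G := by
    simp [evalAt, sub_eq_add_neg]
  rw [Set.mem_ofPred_eq, Set.mem_ofPred_eq, this, sub_eq_zero]

variable (I₀ : Fin k → Window n N)

open Classical in
/-- The rows of a subspace in the chart `I₀`, up to a common factor. -/
def chartRow (y : MultiProj fun _ : Unit => Fin k → Window n N) (a : Fin k) (q : Window n N) : ℂ :=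
  (y ()).rep (Function.update I₀ a q)

/-- In the chart `p_(I₀) ≠ 0`, a point comes from a subspace when its coordinates are the minors of
its chart rows. Both sides have degree `k + 1`; this form avoids the exponent `k - 1`, which would
be wrong for `k = 0`. -/
theorem isZariskiClosed_plucker : IsZariskiClosed
    {y : MultiProj fun _ : Unit => Fin k → Window n N | ∀ J : Fin k → Window n N,
      (y ()).rep I₀ ^ k * (y ()).rep J =
        (y ()).rep I₀ * (Matrix.of fun a b => chartRow I₀ y a (J b)).det} := by
  classical
  rw [Set.ofPred_forall]
  refine IsZariskiClosed.iInter fun J => ?_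
  have hF := (MvPolynomial.IsWeightedHomogeneous.prod (Finset.univ : Finset (Fin k))
    (fun _ => coordX I₀) (fun _ => Finsupp.single () 1) fun _ _ => isMultiHom_coordX I₀).mul
      (isMultiHom_coordX J)
  have hG := (isMultiHom_coordX I₀).mul (isMultiHom_det
    (τ := fun _ : Unit => Fin k → Window n N)
    (M := Matrix.of fun a b => coordX (Function.update I₀ a (J b))) (d := Finsupp.single () 1)
    fun a b => isMultiHom_coordX _)
  rw [add_comm] at hF
  convert isZariskiClosed_eq hF hG using 1
  ext y
  have hdet : evalAt y (Matrix.of fun a b => coordX (Function.update I₀ a (J b))).det =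
      (Matrix.of fun a b => chartRow I₀ y a (J b)).det := by
    rw [evalAt, RingHom.map_det]
    congr 1
    ext a b
    exact evalAt_coordX y _
  rw [Set.mem_ofPred_eq, Set.mem_ofPred_eq, evalAt_mul, evalAt_mul, evalAt_prod, hdet,
    evalAt_coordX, evalAt_coordX, Finset.prod_const, Finset.card_univ, Fintype.card_fin]

/-- A vector of the subspace is the combination of the reduced rows with its own entries in the
positions `I₀` as coefficients. The equations say this for the shifted rows, homogenized to degree
two. -/
theorem isZariskiClosed_stable : IsZariskiClosed
    {y : MultiProj fun _ : Unit => Fin k → Window n N | ∀ a q,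
      (y ()).rep I₀ * shiftWin n N (chartRow I₀ y a) q =
        ∑ a', shiftWin n N (chartRow I₀ y a) (I₀ a') * chartRow I₀ y a' q} := by
  classical
  rw [Set.ofPred_forall]
  refine IsZariskiClosed.iInter fun a => ?_
  rw [Set.ofPred_forall]
  refine IsZariskiClosed.iInter fun q => ?_
  let R : Fin k → Window n N → MvPolynomial (Σ _ : Unit, Fin k → Window n N) ℂ :=
    fun a q => coordX (Function.update I₀ a q)
  let T : Window n N → MvPolynomial (Σ _ : Unit, Fin k → Window n N) ℂ := fun q =>
    if h : (q.2 : ℤ) - 1 ∈ Finset.Ico (-(N : ℤ)) (N : ℤ) then R a (q.1, ⟨(q.2 : ℤ) - 1, h⟩) else 0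
  have hT : ∀ q, IsMultiHom (τ := fun _ : Unit => Fin k → Window n N) (T q)
      (Finsupp.single () 1) := by
    intro q
    dsimp only [T]
    split_ifs
    · exact isMultiHom_coordX _
    · exact MvPolynomial.isWeightedHomogeneous_zero _ _ _
  have hF := (isMultiHom_coordX I₀).mul (hT q)
  have hG := MvPolynomial.IsWeightedHomogeneous.sum Finset.univ
    (fun a' => T (I₀ a') * R a' q) _ fun a' _ =>
      (hT (I₀ a')).mul (isMultiHom_coordX (Function.update I₀ a' q))
  convert isZariskiClosed_eq hF hG using 1
  ext y
  have hTe : ∀ q, evalAt y (T q) = shiftWin n N (chartRow I₀ y a) q := by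
    intro q
    rw [shiftWin_apply]
    dsimp only [T]
    split_ifs
    · exact evalAt_coordX y _
    · exact map_zero _
  have hsum : evalAt y (∑ a', T (I₀ a') * R a' q) =
      ∑ a', evalAt y (T (I₀ a')) * evalAt y (R a' q) := by
    rw [evalAt, map_sum]
    exact Finset.sum_congr rfl fun _ _ => map_mul _ _ _
  rw [Set.mem_ofPred_eq, Set.mem_ofPred_eq, evalAt_mul, hsum, evalAt_coordX, hTe]
  simp only [hTe, R, evalAt_coordX]
  rfl

open Classical in
/-- The points with a nonzero coordinate `p_I` such that at least `s` entries of `I` are in `C`. -/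
def rankSet (k : ℕ) (C : Set (Window n N)) (s : ℕ) :
    Set (MultiProj fun _ : Unit => Fin k → Window n N) :=
  {y | ∃ I, (y ()).rep I ≠ 0 ∧ s ≤ (Finset.univ.filter fun b => I b ∈ C).card}

theorem isZariskiOpen_rankSet (C : Set (Window n N)) (s : ℕ) :
    IsZariskiOpen (rankSet k C s) := by
  classical
  refine ⟨{F | ∃ I : Fin k → Window n N, s ≤ (Finset.univ.filter fun b => I b ∈ C).card ∧
    F = coordX I}, ?_, ?_⟩
  · rintro F ⟨I, -, rfl⟩
    exact ⟨_, isMultiHom_coordX I⟩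
  · ext y
    simp only [rankSet, Set.mem_compl_iff, Set.mem_ofPred_eq, not_exists, not_and]
    constructor
    · rintro h F ⟨I, hI, rfl⟩
      rw [evalAt_coordX]
      by_contra hne
      exact h I hne hI
    · intro h I hne hI
      exact hne (by rw [← evalAt_coordX]; exact h _ ⟨I, hI, rfl⟩)

variable {I₀}

/-- Points of the Grassmannian satisfy the equations of the chart. -/
theorem IsReduced.equations {W : Submodule ℂ (Window n N → ℂ)} (hW : Module.finrank ℂ W = k)
    {A : Fin k → Window n N → ℂ} (hA : IsReduced I₀ A) (hAW : ∀ a, A a ∈ W)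
    (y : MultiProj fun _ : Unit => Fin k → Window n N) (hy : y = pluckerPoint W hW) :
    (y ()).rep I₀ ≠ 0 ∧ (∀ I, (y ()).rep I = (y ()).rep I₀ * minor A I) ∧
      ∀ a, chartRow I₀ y a = (y ()).rep I₀ • A a := by
  subst hy
  obtain ⟨h1, h2⟩ := hA.rep_pluckerPoint hW hAW ()
  refine ⟨h1, h2, fun a => ?_⟩
  classical
  ext q
  have h3 := h2 (Function.update I₀ a q)
  rw [hA.minor_update] at h3
  rw [Pi.smul_apply, smul_eq_mul, ← h3, chartRow]

/-- Conversely, the equations of the chart define points of the Grassmannian. -/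
theorem exists_isReduced_of_equations (y : MultiProj fun _ : Unit => Fin k → Window n N)
    (h0 : (y ()).rep I₀ ≠ 0) (hpl : ∀ J : Fin k → Window n N,
      (y ()).rep I₀ ^ k * (y ()).rep J =
        (y ()).rep I₀ * (Matrix.of fun a b => chartRow I₀ y a (J b)).det) :
    ∃ A, IsReduced I₀ A ∧ (∀ I, (y ()).rep I = (y ()).rep I₀ * minor A I) ∧
      ∀ a, chartRow I₀ y a = (y ()).rep I₀ • A a := by
  classical
  have hrow : ∀ a, chartRow I₀ y a = (y ()).rep I₀ • ((y ()).rep I₀)⁻¹ • chartRow I₀ y a := by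
    intro a
    rw [smul_smul, mul_inv_cancel₀ h0, one_smul]
  refine ⟨fun a => ((y ()).rep I₀)⁻¹ • chartRow I₀ y a, fun a b => ?_, fun J => ?_, hrow⟩
  · dsimp only
    rw [Pi.smul_apply, smul_eq_mul]
    split_ifs with hab
    · subst hab
      have : chartRow I₀ y a (I₀ a) = (y ()).rep I₀ := by
        rw [chartRow, Function.update_eq_self]
      rw [this, inv_mul_cancel₀ h0]
    -- This sequence repeats the column `I₀ b`, so the determinant vanishes and with it the
    -- off-diagonal entry.
    · have h1 := hpl (Function.update I₀ a (I₀ b))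
      rw [Matrix.det_zero_of_column_eq hab (fun c => by
        simp [Function.update_of_ne (Ne.symm hab)]), mul_zero] at h1
      have h2 : chartRow I₀ y a (I₀ b) = (y ()).rep (Function.update I₀ a (I₀ b)) := by
        rw [chartRow]
      rw [h2, (mul_eq_zero.1 h1).resolve_left (pow_ne_zero k h0), mul_zero]
  · have h1 := hpl J
    have h2 : (Matrix.of fun a b => chartRow I₀ y a (J b)) = (y ()).rep I₀ •
        Matrix.of fun a b => (((y ()).rep I₀)⁻¹ • chartRow I₀ y a) (J b) := by
      ext a b
      exact congrFun (hrow a) (J b)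
    rw [h2, Matrix.det_smul, Fintype.card_fin, mul_left_comm] at h1
    exact mul_left_cancel₀ (pow_ne_zero k h0) h1

theorem mem_rankSet_iff {A : Fin k → Window n N → ℂ} (hA : LinearIndependent ℂ A)
    {y : MultiProj fun _ : Unit => Fin k → Window n N} {c : ℂ} (hc : c ≠ 0)
    (hy : ∀ I, (y ()).rep I = c * minor A I) (C : Set (Window n N)) (s : ℕ) :
    y ∈ rankSet k C s ↔ Module.finrank ℂ (Submodule.span ℂ (Set.range A) ⊓
        Submodule.pi C (fun _ => (⊥ : Submodule ℂ ℂ)) : Submodule ℂ (Window n N → ℂ)) + s ≤ k := by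
  classical
  rw [← exists_minor_ne_zero_iff hA C s, rankSet, Set.mem_ofPred_eq]
  refine exists_congr fun I => and_congr ?_ (by congr!)
  rw [hy, mul_ne_zero_iff]
  exact and_iff_right hc

theorem IsReduced.span_eq {W : Submodule ℂ (Window n N → ℂ)} (hW : Module.finrank ℂ W = k)
    {A : Fin k → Window n N → ℂ} (hA : IsReduced I₀ A) (hAW : ∀ a, A a ∈ W) :
    Submodule.span ℂ (Set.range A) = W := by
  apply Submodule.eq_of_le_of_finrank_eq
  · rw [Submodule.span_le]
    rintro _ ⟨a, rfl⟩
    exact hAW a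
  · rw [finrank_span_eq_card hA.linearIndependent, hW, Fintype.card_fin]

theorem winDim_le {Y : Submodule ℂ (X n)} (h : InGrass N k Y) (a b : ℕ) :
    winDim N (Y ⊓ cols n a b) ≤ k := by
  rw [← h.2.2]
  exact Submodule.finrank_mono (Submodule.map_mono inf_le_left)

/-- The first three conditions describe subspaces in the chart that are stable under `t`. Lying in
the rank set for `k - d` but not in that for `k - d + 1` says that the intersection with the given
columns has dimension exactly `d`. -/
theorem range_pluckerEmb_eq (hM : ∀ Y ∈ piece p lam, InGrass N k Y) {Y₀ : Submodule ℂ (X n)}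
    (hY₀ : Y₀ ∈ piece p lam)
    (hI₀ : ∀ Y' : Submodule ℂ (X n), PieceOn p lam 0 n Y' → InGrass N k Y' →
        ∀ w ∈ Y'.map (toWindow n N), (∀ a, w (I₀ a) = 0) → w = 0) :
    Set.range (pluckerEmb hM) =
      ({y | (y ()).rep I₀ ≠ 0} ∩ ({y | ∀ J : Fin k → Window n N,
        (y ()).rep I₀ ^ k * (y ()).rep J =
          (y ()).rep I₀ * (Matrix.of fun a b => chartRow I₀ y a (J b)).det} ∩
        {y | ∀ a q, (y ()).rep I₀ * shiftWin n N (chartRow I₀ y a) q =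
          ∑ a', shiftWin n N (chartRow I₀ y a) (I₀ a') * chartRow I₀ y a' q})) ∩
      ⋂ c ∈ Finset.range (n + 1) ×ˢ Finset.range (n + 1),
        (rankSet k (outside n N c.1 c.2) (k - winDim N (Y₀ ⊓ cols n c.1 c.2)) ∩
          (rankSet k (outside n N c.1 c.2) (k - winDim N (Y₀ ⊓ cols n c.1 c.2) + 1))ᶜ) := by
  have hY₀P := mem_piece_iff.1 hY₀
  have hlat : ∀ Y ∈ piece p lam, IsLat N 0 n Y := fun Y hY =>
    (mem_piece_iff.1 hY).isLat_of_inGrass (hM Y hY)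
  ext y
  simp only [Set.mem_inter_iff, Set.mem_iInter, Set.mem_ofPred_eq, Finset.mem_product,
    Finset.mem_range, Set.mem_compl_iff]
  constructor
  · rintro ⟨⟨Y, hY⟩, rfl⟩
    have hYP := mem_piece_iff.1 hY
    have hG := hM Y hY
    obtain ⟨A, hA, hAW⟩ := exists_isReduced hG.2.2 (hI₀ Y hYP hG)
    obtain ⟨h0, hmin, hrow⟩ := hA.equations hG.2.2 hAW (pluckerEmb hM ⟨Y, hY⟩) rfl
    set y := pluckerEmb hM ⟨Y, hY⟩
    refine ⟨⟨h0, fun J => ?_, fun a q => ?_⟩, ?_⟩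
    · have h2 : (Matrix.of fun a b => chartRow I₀ y a (J b)) = (y ()).rep I₀ •
          Matrix.of fun a b => A a (J b) := by
        ext a b
        exact congrFun (hrow a) (J b)
      rw [h2, Matrix.det_smul, Fintype.card_fin, hmin J, minor, mul_left_comm]
    · have hs : shiftWin n N (A a) ∈ Y.map (toWindow n N) :=
        Submodule.mem_map_of_mem (hYP.stable _ ((winIncl_mem_iff hG.1 hG.2.1).2 (hAW a)))
      have h1 := congrFun (hA.sum_eq hAW (hI₀ Y hYP hG) hs) q
      simp only [hrow, map_smul, Pi.smul_apply, smul_eq_mul]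
      rw [h1, Finset.sum_apply, Finset.mul_sum, Finset.mul_sum]
      refine Finset.sum_congr rfl fun a' _ => ?_
      rw [Pi.smul_apply, smul_eq_mul]
      ring
    · rintro ⟨a, b⟩ hab
      dsimp only at hab ⊢
      have hd := PieceOn.winDim_eq (p := p) (lam := lam) (N := N) (by omega)
        (hYP.inf_cols (Nat.zero_le a) (by omega : b ≤ n))
        (hY₀P.inf_cols (Nat.zero_le a) (by omega : b ≤ n))
        ((hlat Y hY).inf_cols (Nat.zero_le a) (by omega : b ≤ n))
        ((hlat Y₀ hY₀).inf_cols (Nat.zero_le a) (by omega : b ≤ n))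
      have hle := winDim_le (hM Y₀ hY₀) a b
      rw [mem_rankSet_iff hA.linearIndependent h0 hmin,
        mem_rankSet_iff hA.linearIndependent h0 hmin,
        hA.span_eq hG.2.2 hAW, ← map_inf_cols hG.1 hG.2.1, ← winDim, hd]
      omega
  · rintro ⟨⟨h0, hpl, hst⟩, hrk⟩
    obtain ⟨A, hA, hmin, hrow⟩ := exists_isReduced_of_equations y h0 hpl
    set W := Submodule.span ℂ (Set.range A) with hW
    have hAW : ∀ a, A a ∈ W := fun a => Submodule.subset_span ⟨a, rfl⟩
    have hWst : ∀ w ∈ W, shiftWin n N w ∈ W := by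
      suffices W ≤ W.comap (shiftWin n N) from this
      rw [hW, Submodule.span_le]
      rintro _ ⟨a, rfl⟩
      change shiftWin n N (A a) ∈ W
      have : shiftWin n N (A a) = ∑ a', shiftWin n N (A a) (I₀ a') • A a' := by
        ext q
        have h1 := hst a q
        simp only [hrow, map_smul, Pi.smul_apply, smul_eq_mul] at h1
        rw [Finset.sum_apply]
        -- The chart rows are `p_(I₀)` times the reduced rows, so both sides of the quadratic
        -- equation carry the square of `p_(I₀)`.
        apply mul_left_cancel₀ (mul_ne_zero h0 h0)
        rw [mul_assoc, h1, Finset.mul_sum]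
        refine Finset.sum_congr rfl fun a' _ => ?_
        rw [Pi.smul_apply, smul_eq_mul]
        ring
      rw [this]
      exact W.sum_mem fun a' _ => W.smul_mem _ (hAW a')
    have hlatW := isLat_latOf hWst
    have hG : InGrass N k (latOf W) := ⟨level_le_latOf W, inf_le_right, by
      rw [map_latOf, finrank_span_eq_card hA.linearIndependent, Fintype.card_fin]⟩
    have hP : PieceOn p lam 0 n (latOf W) := by
      refine pieceOn_of_winDim_eq hY₀P (hlat Y₀ hY₀) hlatW fun a ha b hb => ?_
      have h1 := hrk ⟨a, b⟩ ⟨by dsimp only; omega, by dsimp only; omega⟩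
      dsimp only at h1
      rw [mem_rankSet_iff hA.linearIndependent h0 hmin,
        mem_rankSet_iff hA.linearIndependent h0 hmin,
        ← hW, ← map_latOf W, ← map_inf_cols hG.1 hG.2.1, ← winDim] at h1
      have hle := winDim_le (hM Y₀ hY₀) a b
      omega
    have hmem := mem_piece_iff.2 hP
    refine ⟨⟨latOf W, hmem⟩, funext fun u => ?_⟩
    rw [pluckerEmb, exists_rep_pluckerPoint _ hA.linearIndependent
      (fun a => by rw [map_latOf]; exact hAW a) u, ← Projectivization.mk_rep (y u),
      Projectivization.mk_eq_mk_iff']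
    refine ⟨((y ()).rep I₀)⁻¹, ?_⟩
    ext I
    rw [Pi.smul_apply, smul_eq_mul, hmin I, inv_mul_cancel_left₀ h0]

theorem isZariskiLocallyClosed_range_pluckerEmb (hM : ∀ Y ∈ piece p lam, InGrass N k Y) :
    IsZariskiLocallyClosed (Set.range (pluckerEmb hM)) := by
  rcases isEmpty_or_nonempty (piece p lam) with hemp | ⟨⟨Y₀, hY₀⟩⟩
  · rw [Set.range_eq_empty]
    exact isZariskiClosed_empty.isZariskiLocallyClosed
  obtain ⟨I₀, -, -, hI₀⟩ := (mem_piece_iff.1 hY₀).exists_chart (hM Y₀ hY₀)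
  rw [range_pluckerEmb_eq hM hY₀ hI₀]
  refine (IsZariskiLocallyClosed.inter ?_ (IsZariskiLocallyClosed.inter
    (isZariskiClosed_plucker I₀).isZariskiLocallyClosed
    (isZariskiClosed_stable I₀).isZariskiLocallyClosed)).inter
    (IsZariskiLocallyClosed.biInter _ fun c => ?_)
  · have := (isZariskiOpen_ne_zero (isMultiHom_coordX I₀)).isZariskiLocallyClosed
    simpa only [evalAt_coordX] using this
  · refine (isZariskiOpen_rankSet _ _).isZariskiLocallyClosed.inter
      (IsZariskiClosed.isZariskiLocallyClosed ?_)
    exact isZariskiOpen_rankSet _ _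

end LocallyClosed

end LoopGr

end

theorem mainTheorem6 (n : ℕ) (p : LoopGr.Picture n) (lam : Fin n → ℤ) :
    LoopGr.IsZariskiOpen (LoopGr.openPP p) ∧
    (∃ N k : ℕ, ∀ Y ∈ LoopGr.piece p lam, LoopGr.InGrass N k Y) ∧
    ∃ Φ : LoopGr.piece p lam ≃ LoopGr.openPP p,
      ∀ (N k : ℕ) (hM : ∀ Y ∈ LoopGr.piece p lam, LoopGr.InGrass N k Y),
        LoopGr.IsZariskiLocallyClosed (Set.range (LoopGr.pluckerEmb hM)) ∧
        LoopGr.IsRegularMap (LoopGr.pluckerEmb hM)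
          (fun x : LoopGr.openPP p => (x : LoopGr.PP p)) Φ ∧
        LoopGr.IsRegularMap (fun x : LoopGr.openPP p => (x : LoopGr.PP p))
          (LoopGr.pluckerEmb hM) Φ.symm :=
  ⟨LoopGr.isZariskiOpen_openPP p, LoopGr.exists_inGrass p lam, LoopGr.pieceEquiv p lam,
    fun _ _ hM => ⟨LoopGr.isZariskiLocallyClosed_range_pluckerEmb hM,
      LoopGr.isRegularMap_pieceEquiv hM, LoopGr.isRegularMap_pieceEquiv_symm hM⟩⟩
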